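/- **Notation.** Let $f$ be a continuously differentiable probability density with support $\Omega=(x_i,x_f)$, $-\infty<x_i<x_f\le\infty$ ($f>0$ on $\Omega$, $f=0$ elsewhere), such that $f'<0$ on $\Omega$. All integrals below are over the support of the density, and all functionals take values in $[0,\infty]$: $$N_\lambda[f]=\Big(\int f^\lambda\Big)^{\frac1{1-\lambda}},\quad F_{p,\lambda}[f]=\int |f^{\lambda-2}f'|^p f,\quad \phi_{p,\lambda}[f]=F_{p,\lambda}[f]^{\frac1{p\lambda}},$$ $$\varphi_{p,q,r}[f]=\int f^{1+p(r-2)}|f'|^q\left|\frac{pr}{p-q}-\frac{ff''}{(f')^2}\right|^p .$$ For $\alpha\ne2$ the down transform of $f$ is the density $f^\downarrow_\alpha(t)=f^\alpha(x(t))/|f'(x(t))|$, where $x(t)$ is the inverse of $t(x)=f(x)^{2-\alpha}/(\alpha-2)$, $x\in\Omega$, extended by $0$ to $\mathbb R$. The up transform of a density $g$ with support $(a,b)$ is $g^\uparrow_\alpha(u)=|(\alpha-2)x(u)|^{\frac1{2-\alpha}}$, where $x(u)$ is the inverse of $u(x)=\int_x^{b}|(\alpha-2)v|^{\frac1{\alpha-2}}g(v)\,dv$,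 extended by $0$. For $p\ne 1$ put $p^*=p/(p-1)$, let $g_{p,\mu}$ be the probability density on $\mathbb R$ proportional to $\exp_{2-\mu}(-|x|^{p^*})$, where $\exp_\kappa(y)=(1+(1-\kappa)y)_+^{1/(1-\kappa)}$ for $\kappa\neq1$ and $\exp_1=\exp$, and let $g^+_{p,\mu}=2g_{p,\mu}\mathbf 1_{(0,\infty)}$. **Statement.** Let $p\ge1$, $q\notin\{0,p\}$, $\lambda\ne0$, $s=q/p$, $r=\frac{(2-\lambda)(p-q)}p$. Consider the conditions (C) $\operatorname{sign}\big(\tfrac{p-q}{p-1}-s\big)=\operatorname{sign}\big(\tfrac{p-q}p+s\big)\ne0$, where for $p=1$ the left-hand side means $\operatorname{sign}(p-q)$; (M) $s<1$, $\ \operatorname{sign}(s^*\lambda+\lambda-1)=\operatorname{sign}(2\lambda-1)\ne0$, $\ \operatorname{sign}(\lambda-1)=\operatorname{sign}(\lambda)\ne 0$, with $s^*=\frac s{s-1}$; (A) $f^\downarrow_{2-\lambda}$ is locally absolutely continuous on $\mathbb R$. Define $$\kappa^{(2)}_{s,p,q}=\phi_{p,\mu}[g_{p,\mu}]\,N_\mu[g_{p,\mu}]\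 \text{ with } \mu=\tfrac{p-q}p\ (p>1),\qquad \kappa^{(2)}_{s,1,q}=(2/\mu)^{1/\mu}\ \text{ with } \mu=1-q\ (p=1),$$ $$\kappa^{(1)}_{s,\lambda}=\big(\phi_{s,\lambda}[\widetilde g]\,N_\lambda[\widetilde g]\big)^{-\lambda},\qquad \widetilde g=\big(g^+_{1-\lambda,1-s}\big)^\uparrow_{2-\lambda}.$$ 1. If (C), (A) hold and $F_{s,\lambda}[f]<\infty$, then $F_{s,\lambda}[f]^{\frac1s}\,\varphi_{p,q,r}[f]^{\frac1{p-q}}\ge\kappa^{(2)}_{s,p,q}$. 2. If (M) holds and $F_{s,\lambda}[f]<\infty$, then $F_{s,\lambda}[f]^{-\frac1s}N_\lambda[f]^{-\lambda}\ge\kappa^{(1)}_{s,\lambda}$. 3. If (C), (M), (A) hold, then $\widehat\kappa:=\kappa^{(1)}_{s,\lambda}\kappa^{(2)}_{s,p,q}\in(0,\infty)$ and $$\frac{\varphi_{p,q,r}[f]^{\frac1{p-q}}}{N_\lambda[f]^\lambda}\ge\widehat\kappa .$$ Consequently, with $\mathscr D=\widehat\kappa^{-1/\lambda}$: if $\lambda>0$,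 then $$N_\lambda[f]\le\mathscr D\,\varphi_{p,q,r}[f]^{\frac1{\lambda(p-q)}},\qquad N_\lambda[f]\,\phi_{p,\beta}[f]\le\mathscr D\,\varphi_{p,q,r}[f]^{\frac1{\lambda(p-q)}}\phi_{p,\beta}[f]\quad(\beta\ne0),$$ while for $\lambda<0$ both inequalities hold with $\ge$ in place of $\le$. -/

import Mathlib

open MeasureTheory Set
open scoped ENNReal

noncomputable section

namespace DownFisher

/-- The set where a density is positive; all informational integrals are taken over it. -/
def supp (f : ℝ → ℝ) : Set ℝ := {x | 0 < f x}

/-- The open interval `(xi, xf)`, with a finite left end and a right end that may be `+∞`. -/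
def interval (xi : ℝ) (xf : EReal) : Set ℝ := {x : ℝ | xi < x ∧ (x : EReal) < xf}

/-- `f` is a continuously differentiable, strictly decreasing (`f' < 0`) probability density
with support `(xi, xf)`; outside of the support `f` is `0`. -/
structure IsDecreasingDensity (f : ℝ → ℝ) (xi : ℝ) (xf : EReal) : Prop where
  pos : ∀ x ∈ interval xi xf, 0 < f x
  zero : ∀ x ∉ interval xi xf, f x = 0
  deriv_neg : ∀ x ∈ interval xi xf, deriv f x < 0
  deriv_cont : ContinuousOn (deriv f) (interval xi xf)
  mass : ∫⁻ x, ENNReal.ofReal (f x) = 1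

/-- Local absolute continuity on the whole line. -/
def LocallyAC (h : ℝ → ℝ) : Prop := ∀ a b : ℝ, AbsolutelyContinuousOnInterval h a b

/-! ### Classical functionals, with values in `[0, ∞]` -/

/-- Rényi entropy power `N_lam[f] = (∫ f ^ lam) ^ (1 / (1 - lam))`; for `lam = 1` it is the
exponential of the Shannon entropy. -/
def N (lam : ℝ) (f : ℝ → ℝ) : ℝ≥0∞ :=
  if lam = 1 then ENNReal.ofReal (Real.exp (-∫ x in supp f, f x * Real.log (f x)))
  else (∫⁻ x in supp f, ENNReal.ofReal (f x ^ lam)) ^ (1 / (1 - lam))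

/-- `(p, lam)`-Fisher information `F_{p,lam}[f] = ∫ |f ^ (lam - 2) f'| ^ p f`. -/
def F (p lam : ℝ) (f : ℝ → ℝ) : ℝ≥0∞ :=
  ∫⁻ x in supp f, ENNReal.ofReal |f x ^ (lam - 2) * deriv f x| ^ p * ENNReal.ofReal (f x)

/-- `φ_{p,lam}[f] = F_{p,lam}[f] ^ (1 / (p lam))`. -/
def phi (p lam : ℝ) (f : ℝ → ℝ) : ℝ≥0∞ := F p lam f ^ (1 / (p * lam))

/-- The down-Fisher measure
`∫ f ^ (1 + p (r - 2)) |f'| ^ q |p r / (p - q) - f f'' / (f') ^ 2| ^ p`. -/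
def downFisher (p q r : ℝ) (f : ℝ → ℝ) : ℝ≥0∞ :=
  ∫⁻ x in supp f, ENNReal.ofReal (f x ^ (1 + p * (r - 2))) *
    ENNReal.ofReal |deriv f x| ^ q *
    ENNReal.ofReal |p * r / (p - q) - f x * deriv (deriv f) x / deriv f x ^ 2| ^ p

/-! ### The down and up transformations -/

/-- The change of variable `s(x)` of the down transformation (canonical choice). -/
def downMap (α : ℝ) (f : ℝ → ℝ) (x : ℝ) : ℝ :=
  if α = 2 then -Real.log (f x) else f x ^ (2 - α) / (α - 2)

open Classical in
/-- The down transformed density `s ↦ f(x(s)) ^ α / |f'(x(s))|` on the image of the support of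
`f` under `s(x)`, extended by `0` to the line. -/
def down (α : ℝ) (f : ℝ → ℝ) (s : ℝ) : ℝ :=
  if s ∈ downMap α f '' supp f then
    f (Function.invFunOn (downMap α f) (supp f) s) ^ α /
      |deriv f (Function.invFunOn (downMap α f) (supp f) s)|
  else 0

/-- The change of variable `u(x) = ∫_x^{x_f} |(α - 2) v| ^ (1 / (α - 2)) g(v) dv` of the up
transformation, with weight `exp v` for `α = 2`. -/
def upMap (α : ℝ) (g : ℝ → ℝ) (x : ℝ) : ℝ :=
  ∫ v in supp g ∩ Ioi x,
    (if α = 2 then Real.exp v else |(α - 2) * v| ^ (1 / (α - 2))) * g v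

open Classical in
/-- The up transformed density `u ↦ |(α - 2) x(u)| ^ (1 / (2 - α))`, or `u ↦ exp (-x(u))` for
`α = 2`, on the image of the support of `g` under `u(x)`, extended by `0`. -/
def up (α : ℝ) (g : ℝ → ℝ) (u : ℝ) : ℝ :=
  if u ∈ upMap α g '' supp g then
    if α = 2 then Real.exp (-(Function.invFunOn (upMap α g) (supp g) u))
    else |(α - 2) * Function.invFunOn (upMap α g) (supp g) u| ^ (1 / (2 - α))
  else 0

/-! ### Generalized Gaussians and the constants -/

/-- Tsallis exponential `exp_κ(y) = (1 + (1 - κ) y)_+ ^ (1 / (1 - κ))`, with `exp_1 = exp`. -/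
def qexp (κ y : ℝ) : ℝ :=
  if κ = 1 then Real.exp y else max (1 + (1 - κ) * y) 0 ^ (1 / (1 - κ))

/-- The conjugate exponent `p* = p / (p - 1)`, for `p ≠ 1`. -/
def pstar (p : ℝ) : ℝ := p / (p - 1)

/-- The generalized Gaussian density `g_{p,μ}(x) = a exp_{2-μ}(-|x| ^ p*)`. -/
def gauss (p μ x : ℝ) : ℝ :=
  qexp (2 - μ) (-(|x| ^ pstar p)) / ∫ y, qexp (2 - μ) (-(|y| ^ pstar p))

/-- The generalized Gaussian density conditioned to the half-line `(0, ∞)`. -/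
def halfGauss (p μ x : ℝ) : ℝ := if 0 < x then 2 * gauss p μ x else 0

/-- Optimal constant of the classical bi-parametric Stam inequality `φ_{p,μ}[h] N_μ[h] ≥ K`,
for `p ≥ 1`. For `p > 1` it is the value at `g_{p,μ}`; for `p = 1` the minimizer is the uniform
density of unit length, for which `F_{1,μ}` is the total variation of `h ^ μ / μ`, that is
`2 / μ` (and `N_μ = 1`). -/
def stamConst (p μ : ℝ) : ℝ≥0∞ :=
  if p = 1 then ENNReal.ofReal ((2 / μ) ^ (1 / μ))
  else phi p μ (gauss p μ) * N μ (gauss p μ)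

/-- Constant of the down-Fisher--Fisher inequality in the case `s = q / p`: the Stam constant with
parameters `((p - q) / p, 1 - s)`, which are equal here. -/
def kappa2 (p q : ℝ) : ℝ≥0∞ := stamConst p ((p - q) / p)

/-- The extremal density of the mirrored Stam inequality with parameters `(s, lam, lam)`: the up
transform of a generalized Gaussian on a half-line. -/
def mirroredMin (s lam : ℝ) : ℝ → ℝ := up (2 - lam) (halfGauss (1 - lam) (1 - s))

/-- Constant of the mirrored Stam inequality with parameters `(s, lam, lam)`. -/
def kappa1 (s lam : ℝ) : ℝ≥0∞ :=
  (phi s lam (mirroredMin s lam) * N lam (mirroredMin s lam)) ^ (-lam)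

/-! ### Ranges of parameters -/

/-- `sign ((p-q)/(p-1) - s) = sign ((p-q)/p + s) ≠ 0`; for `p = 1` the quotient
`(p-q)/(p-1)` is read as `±∞`, with the sign of `p - q`. -/
def DownFisherRange (p q s : ℝ) : Prop :=
  (if p = 1 then SignType.sign (p - q) else SignType.sign ((p - q) / (p - 1) - s)) =
      SignType.sign ((p - q) / p + s) ∧
    SignType.sign ((p - q) / p + s) ≠ 0

/-- Mirrored domain of the tri-parametric Stam inequality with parameters `(p, β, lam)`. -/
def MirroredRange (p β lam : ℝ) : Prop :=
  p < 1 ∧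
    SignType.sign (pstar p * β + lam - 1) = SignType.sign (β + lam - 1) ∧
    SignType.sign (β + lam - 1) ≠ 0 ∧
    SignType.sign (lam - 1) = SignType.sign β ∧
    SignType.sign β ≠ 0

end DownFisher

end

open DownFisher

namespace DownFisher

open Filter Topology

/-! ### Local inverses -/

/-! The down transform with `α = 2 - lam` trades every functional of `f` for a more classical one of
`D = down (2 - lam) f`. Along `t(x) = -f(x)^lam / lam` one has `D(t) dt = f dx`, and with `u =
f^(lam-2) |f'|` also `D = 1/u` and `dt = u f dx`. Hence `∫ D^(1-s) = F_{s,lam}[f]`, `∫ |lam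
t|^((lam-1)/lam) D = ∫ f^lam`, and, when `D` is locally absolutely continuous, the down-Fisher
measure of `f` is the Fisher information `F_{p,μ}[D]` with `μ = (p-q)/p = 1 - q/p`
(`lintegral_down_rpow`, `lintegral_moment_down`, `downFisher_eq`).

Item 1 is then the Stam inequality for `D`. For `p > 1` it is proved by mass transport. If `T`
carries `h` to the generalized Gaussian `g`, then `∫ g^μ = ∫ h^μ T'^(1-μ)`; Hölder compares this
with `∫ h^μ` and `∫ h^μ T'`. Integration by parts bounds the latter by `∫ |(h^μ)'| |T|`, and a
second Hölder inequality produces `F_{p,μ}[h]` and the moment of order `p*` of `g`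
(`rpow_le_rpow_mul_F`). The Fisher information of `g` is an explicit multiple of that moment, and an
integration by parts for `g` identifies the constant (`stam_of_one_lt`). For `p = 1` the Fisher
information is a total variation and bounds `sup h`, hence the Rényi power (`stam_one`).

Item 2 is a moment-entropy inequality for `D`, which lives on a half-line because `t` has constant
sign. It follows from Hölder against a rescaled half-line Gaussian `g`, since `g^(μ-1)` is affine in
`x^P` and its integral against `D` sees only mass and moment (`moment_entropy`). The up transform
undoes the down transform on this Gaussian, so `kappa1` is the same bound read at the extremal
(`kappa1_eq`).

Item 3 is the product of the two: `F_{s,lam}[f]` cancels when finite, and when it is infinite the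
quotient to be bounded below is itself infinite. -/

lemma image_mem_nhds_of_hasStrictDerivAt {φ : ℝ → ℝ} {c x : ℝ} {U : Set ℝ}
    (hd : HasStrictDerivAt φ c x) (hc : c ≠ 0) (hU : U ∈ 𝓝 x) : φ '' U ∈ 𝓝 (φ x) := by
  rw [← hd.map_nhds_eq hc]
  exact image_mem_map hU

lemma isOpen_image_of_hasStrictDerivAt {φ φ' : ℝ → ℝ} {S : Set ℝ} (hS : IsOpen S)
    (hd : ∀ x ∈ S, HasStrictDerivAt φ (φ' x) x) (hne : ∀ x ∈ S, φ' x ≠ 0) :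
    IsOpen (φ '' S) := by
  rw [isOpen_iff_mem_nhds]
  rintro _ ⟨x, hx, rfl⟩
  exact image_mem_nhds_of_hasStrictDerivAt (hd x hx) (hne x hx) (hS.mem_nhds hx)

/-- The inverse function rule needs continuity of the inverse. Injectivity makes `invFunOn` a left
inverse on `S`, and a nonzero strict derivative maps neighbourhoods onto neighbourhoods, which is
that continuity. -/
lemma hasDerivAt_invFunOn {φ φ' : ℝ → ℝ} {S : Set ℝ} (hS : IsOpen S) (hinj : InjOn φ S)
    (hd : ∀ x ∈ S, HasStrictDerivAt φ (φ' x) x) (hne : ∀ x ∈ S, φ' x ≠ 0) {x : ℝ} (hx : x ∈ S) :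
    HasDerivAt (Function.invFunOn φ S) (φ' x)⁻¹ (φ x) := by
  have hleft : ∀ y ∈ S, Function.invFunOn φ S (φ y) = y := fun y hy =>
    hinj.leftInvOn_invFunOn hy
  have hcont : ContinuousAt (Function.invFunOn φ S) (φ x) := by
    intro U hU
    rw [hleft x hx] at hU
    rw [mem_map]
    filter_upwards [image_mem_nhds_of_hasStrictDerivAt (hd x hx) (hne x hx)
      (inter_mem hU (hS.mem_nhds hx))]
    rintro _ ⟨y, hy, rfl⟩
    rw [mem_preimage, hleft y hy.2]
    exact hy.1
  refine HasDerivAt.of_local_left_inverse (f := φ) hcont ?_ (hne x hx) ?_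
  · rw [hleft x hx]
    exact (hd x hx).hasDerivAt
  · filter_upwards [image_mem_nhds_of_hasStrictDerivAt (hd x hx) (hne x hx) (hS.mem_nhds hx)]
    rintro _ ⟨y, hy, rfl⟩
    rw [hleft y hy]

/-! ### Distribution functions -/

lemma hasStrictDerivAt_integral_Iic {k : ℝ → ℝ} (hk : Integrable k) {S : Set ℝ} (hS : IsOpen S)
    (hc : ContinuousOn k S) {x : ℝ} (hx : x ∈ S) :
    HasStrictDerivAt (fun y => ∫ v in Iic y, k v) (k x) x := by
  have h1 : HasStrictDerivAt (fun y => ∫ v in x..y, k v) (k x) x := by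
    refine intervalIntegral.integral_hasStrictDerivAt_right hk.intervalIntegrable ?_
      (hc.continuousAt (hS.mem_nhds hx))
    exact hk.aestronglyMeasurable.stronglyMeasurableAtFilter
  refine (h1.const_add (∫ v in Iic x, k v)).congr_of_eventuallyEq (Eventually.of_forall fun y => ?_)
  have := intervalIntegral.integral_Iic_sub_Iic (a := x) (b := y) hk.integrableOn hk.integrableOn
  simp only
  linarith

lemma integral_Ioi_eq_sub {k : ℝ → ℝ} (hk : Integrable k) (x : ℝ) :
    ∫ v in Ioi x, k v = (∫ v, k v) - ∫ v in Iic x, k v := by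
  have := intervalIntegral.integral_Iic_add_Ioi (b := x) hk.integrableOn hk.integrableOn
  linarith

lemma hasStrictDerivAt_integral_Ioi {k : ℝ → ℝ} (hk : Integrable k) {S : Set ℝ} (hS : IsOpen S)
    (hc : ContinuousOn k S) {x : ℝ} (hx : x ∈ S) :
    HasStrictDerivAt (fun y => ∫ v in Ioi y, k v) (-k x) x := by
  refine ((hasStrictDerivAt_integral_Iic hk hS hc hx).const_sub
    (∫ v, k v)).congr_of_eventuallyEq (Eventually.of_forall fun y => ?_)
  exact (integral_Ioi_eq_sub hk y).symm

/-! ### Densities on an interval and monotone transport between them. -/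

lemma measurable_indicator_of_continuousOn {β : Type*} [TopologicalSpace β] [MeasurableSpace β]
    [BorelSpace β] [Zero β] {k : ℝ → β} {S : Set ℝ} (hS : MeasurableSet S)
    (hk : ContinuousOn k S) : Measurable (S.indicator k) := by
  classical
  rw [← piecewise_eq_indicator]
  exact hk.measurable_piecewise continuousOn_const hS

/-- A probability density, positive and continuous on an open interval and `0` elsewhere. -/
structure IsIntervalDensity (h : ℝ → ℝ) : Prop where
  nonneg : ∀ x, 0 ≤ h x
  cont : ContinuousOn h (supp h)
  isOpen : IsOpen (supp h)
  ordConnected : (supp h).OrdConnected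
  mass : ∫⁻ x, ENNReal.ofReal (h x) = 1

namespace IsIntervalDensity

variable {h : ℝ → ℝ}

lemma eq_zero (H : IsIntervalDensity h) {x : ℝ} (hx : x ∉ supp h) : h x = 0 :=
  le_antisymm (not_lt.1 hx) (H.nonneg x)

lemma eq_indicator (H : IsIntervalDensity h) : h = (supp h).indicator h := by
  ext x
  by_cases hx : x ∈ supp h
  · rw [indicator_of_mem hx]
  · rw [indicator_of_notMem hx, H.eq_zero hx]

lemma measurable (H : IsIntervalDensity h) : Measurable h := by
  rw [H.eq_indicator]
  exact measurable_indicator_of_continuousOn H.isOpen.measurableSet H.cont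

lemma lintegral_supp (H : IsIntervalDensity h) : ∫⁻ x in supp h, ENNReal.ofReal (h x) = 1 := by
  rw [← H.mass]
  refine setLIntegral_eq_of_support_subset ?_
  intro x hx
  by_contra hx'
  simp [H.eq_zero hx'] at hx

lemma integrable (H : IsIntervalDensity h) : Integrable h := by
  refine ⟨H.measurable.aestronglyMeasurable, ?_⟩
  rw [hasFiniteIntegral_iff_ofReal (ae_of_all _ H.nonneg), H.mass]
  exact ENNReal.one_lt_top

lemma integral_eq_one (H : IsIntervalDensity h) : ∫ x, h x = 1 := by
  rw [integral_eq_lintegral_of_nonneg_ae (ae_of_all _ H.nonneg)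
    H.measurable.aestronglyMeasurable, H.mass, ENNReal.toReal_one]

lemma supp_nonempty (H : IsIntervalDensity h) : (supp h).Nonempty := by
  by_contra hne
  have := H.lintegral_supp
  rw [not_nonempty_iff_eq_empty.1 hne] at this
  simp at this

lemma strictMonoOn_cdf (H : IsIntervalDensity h) :
    StrictMonoOn (fun y => ∫ v in Iic y, h v) (supp h) := by
  refine strictMonoOn_of_deriv_pos H.ordConnected.convex ?_ ?_
  · intro x hx
    exact (hasStrictDerivAt_integral_Iic H.integrable H.isOpen H.cont
      hx).hasDerivAt.continuousAt.continuousWithinAt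
  · intro x hx
    rw [H.isOpen.interior_eq] at hx
    rw [(hasStrictDerivAt_integral_Iic H.integrable H.isOpen H.cont hx).hasDerivAt.deriv]
    exact hx

/-- Strict monotonicity on an open interval excludes the values 0 and 1. Conversely a value in
between is attained somewhere by continuity, and not off the support, where the distribution
function is 0 or 1 because the support is connected. -/
lemma image_cdf (H : IsIntervalDensity h) :
    (fun y => ∫ v in Iic y, h v) '' supp h = Ioo 0 1 := by
  have hmono : Monotone (fun y => ∫ v in Iic y, h v) := fun a b hab =>
    setIntegral_mono_set H.integrable.integrableOn (ae_of_all _ H.nonneg)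
      (Iic_subset_Iic.2 hab).eventuallyLE
  have hnn : ∀ y, 0 ≤ ∫ v in Iic y, h v := fun y => integral_nonneg H.nonneg
  have hle : ∀ y, ∫ v in Iic y, h v ≤ 1 := fun y => by
    rw [← H.integral_eq_one]
    exact setIntegral_le_integral H.integrable (ae_of_all _ H.nonneg)
  refine Subset.antisymm ?_ ?_
  · rintro _ ⟨x, hx, rfl⟩
    obtain ⟨l, u, hlu, hs⟩ := mem_nhds_iff_exists_Ioo_subset.1 (H.isOpen.mem_nhds hx)
    have h1 := H.strictMonoOn_cdf (hs ⟨by linarith [hlu.1] , by linarith [hlu.1, hlu.2]⟩ :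
      (l + x) / 2 ∈ supp h) hx (by linarith [hlu.1])
    have h2 := H.strictMonoOn_cdf hx (hs ⟨by linarith [hlu.1, hlu.2], by linarith [hlu.2]⟩ :
      (x + u) / 2 ∈ supp h) (by linarith [hlu.2])
    exact ⟨(hnn _).trans_lt h1, h2.trans_le (hle _)⟩
  · intro y hy
    have hcont : Continuous (fun y => ∫ v in Iic y, h v) := by
      refine ((H.integrable.continuous_primitive 0).const_add (∫ v in Iic 0, h v)).congr
        fun y => ?_
      have := intervalIntegral.integral_Iic_sub_Iic (a := 0) (b := y) H.integrable.integrableOn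
        H.integrable.integrableOn
      linarith
    have hbot : Tendsto (fun y => ∫ v in Iic y, h v) atBot (𝓝 0) :=
      tendsto_integral_Iic_zero tendsto_id
    have htop : Tendsto (fun y => ∫ v in Iic y, h v) atTop (𝓝 1) := by
      have h1 : Tendsto (fun y => ∫ v in Ioi y, h v) atTop (𝓝 0) :=
        tendsto_integral_Ioi_zero tendsto_id
      have h2 := h1.const_sub 1
      rw [sub_zero] at h2
      refine h2.congr fun y => ?_
      rw [integral_Ioi_eq_sub H.integrable, H.integral_eq_one]
      ring
    obtain ⟨x, hx⟩ := mem_range_of_exists_le_of_exists_ge hcont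
      (((hbot.eventually_lt_const hy.1).exists).imp fun _ h => h.le)
      (((htop.eventually_const_lt hy.2).exists).imp fun _ h => h.le)
    refine ⟨x, ?_, hx⟩
    by_contra hxS
    obtain ⟨z, hz⟩ := H.supp_nonempty
    rcases lt_or_ge z x with hzx | hzx
    · have h0 : ∫ v in Ioi x, h v = 0 := by
        refine setIntegral_eq_zero_of_forall_eq_zero fun v hv => H.eq_zero fun hv' => hxS ?_
        exact H.ordConnected.out hz hv' ⟨hzx.le, le_of_lt hv⟩
      rw [integral_Ioi_eq_sub H.integrable, H.integral_eq_one] at h0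
      simp only at hx
      linarith [hy.2]
    · have h0 : ∫ v in Iic x, h v = 0 := by
        refine setIntegral_eq_zero_of_forall_eq_zero fun v hv => H.eq_zero fun hv' => hxS ?_
        exact H.ordConnected.out hv' hz ⟨hv, hzx⟩
      simp only at hx
      linarith [hy.1]

/-- Monotone transport between two densities. -/
lemma exists_transport {g : ℝ → ℝ} (H : IsIntervalDensity h) (K : IsIntervalDensity g) :
    ∃ T : ℝ → ℝ, (∀ x ∈ supp h, HasDerivAt T (h x / g (T x)) x) ∧ T '' supp h = supp g ∧
      StrictMonoOn T (supp h) := by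
  -- The transport is `Ψ⁻¹ ∘ Φ`, with `Φ` and `Ψ` the two distribution functions.
  set Φ : ℝ → ℝ := fun y => ∫ v in Iic y, h v with hΦ
  set Ψ : ℝ → ℝ := fun y => ∫ v in Iic y, g v with hΨ
  have hinv : ∀ y ∈ Ioo (0 : ℝ) 1, Function.invFunOn Ψ (supp g) y ∈ supp g ∧
      Ψ (Function.invFunOn Ψ (supp g) y) = y := fun y hy => by
    rw [← K.image_cdf] at hy
    exact ⟨Function.invFunOn_mem hy, Function.invFunOn_eq hy⟩
  have hΦm : ∀ x ∈ supp h, Φ x ∈ Ioo (0 : ℝ) 1 := fun x hx => by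
    rw [← H.image_cdf]
    exact mem_image_of_mem _ hx
  have hd : ∀ x ∈ supp h, HasDerivAt (fun x => Function.invFunOn Ψ (supp g) (Φ x))
      (h x / g (Function.invFunOn Ψ (supp g) (Φ x))) x := fun x hx => by
    obtain ⟨hm, he⟩ := hinv _ (hΦm x hx)
    have h1 := hasDerivAt_invFunOn K.isOpen K.strictMonoOn_cdf.injOn
      (fun y hy => hasStrictDerivAt_integral_Iic K.integrable K.isOpen K.cont hy)
      (fun y hy => ne_of_gt hy) hm
    have h2 := (hasStrictDerivAt_integral_Iic H.integrable H.isOpen H.cont hx).hasDerivAt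
    change HasDerivAt (Function.invFunOn Ψ (supp g)) _ (Ψ _) at h1
    rw [he] at h1
    have := h1.comp x h2
    rwa [mul_comm, ← div_eq_mul_inv] at this
  refine ⟨fun x => Function.invFunOn Ψ (supp g) (Φ x), hd, ?_, ?_⟩
  · refine Subset.antisymm ?_ ?_
    · rintro _ ⟨x, hx, rfl⟩
      exact (hinv _ (hΦm x hx)).1
    · intro y hy
      have hyΨ : Ψ y ∈ Ioo (0 : ℝ) 1 := by
        rw [← K.image_cdf]
        exact mem_image_of_mem _ hy
      have := hyΨ
      rw [← H.image_cdf] at this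
      obtain ⟨x, hx, hxy⟩ := this
      refine ⟨x, hx, ?_⟩
      change Function.invFunOn Ψ (supp g) (Φ x) = y
      rw [show Φ x = Ψ y from hxy]
      exact K.strictMonoOn_cdf.injOn.leftInvOn_invFunOn hy
  · refine strictMonoOn_of_deriv_pos H.ordConnected.convex
      (fun x hx => (hd x hx).continuousAt.continuousWithinAt) fun x hx => ?_
    rw [H.isOpen.interior_eq] at hx
    rw [(hd x hx).deriv]
    exact div_pos hx (hinv _ (hΦm x hx)).1

end IsIntervalDensity

/-! ### Weighted integration by parts -/

/-- Parts on `[x, b]` leave the boundary term `T b * w b`. Writing `w b = w c - ∫_b^c w'` and using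
`T b ≤ T y` on `[b, c]` moves the loss into `∫ |w'| T` and leaves `T b * w c`. As `c` can be chosen
after `b`, smallness of `w c` alone suffices and no decay of the product `w T` is required. -/
lemma intervalIntegral_mul_deriv_le {w T : ℝ → ℝ} {S : Set ℝ} (hS : IsOpen S) (hoc : S.OrdConnected)
    (hw : ∀ a ∈ S, ∀ b ∈ S, AbsolutelyContinuousOnInterval w a b) (hw0 : ∀ x ∈ S, 0 ≤ w x)
    (hT : ContDiffOn ℝ 1 T S) (hmono : MonotoneOn T S) {x b c : ℝ} (hx : x ∈ S) (hTx : 0 ≤ T x)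
    (hc : c ∈ S) (hxb : x ≤ b) (hbc : b ≤ c) :
    ENNReal.ofReal (w x * T x) + ∫⁻ y in Ioc x b, ENNReal.ofReal (w y * deriv T y) ≤
      ENNReal.ofReal (T b * w c) + ∫⁻ y in S ∩ Ioi x, ENNReal.ofReal (|deriv w y| * T y) := by
  have hb : b ∈ S := hoc.out hx hc ⟨hxb, hbc⟩
  have hxc := hxb.trans hbc
  have hsub : ∀ {y z : ℝ}, y ∈ S → z ∈ S → y ≤ z → uIcc y z ⊆ S := fun hy hz hyz => by
    rw [uIcc_of_le hyz]
    exact hoc.out hy hz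
  have hTAC : ∀ {y z : ℝ}, y ∈ S → z ∈ S → y ≤ z → AbsolutelyContinuousOnInterval T y z :=
    fun hy hz hyz => (hT.mono (hsub hy hz hyz)).absolutelyContinuousOnInterval
  have hT0 : ∀ y ∈ S, x ≤ y → 0 ≤ T y := fun y hy hxy => hTx.trans (hmono hx hy hxy)
  have hdT : ∀ y ∈ S, 0 ≤ deriv T y := fun y hy => by
    have : derivWithin T S y = deriv T y := derivWithin_of_isOpen hS hy
    rw [← this]
    exact hmono.derivWithin_nonneg
  have I1 := (hw x hx b hb).integral_mul_deriv_eq_deriv_mul (hTAC hx hb hxb)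
  have I2 := (hw b hb c hc).integral_deriv_eq_sub
  have iw : ∀ {y z : ℝ}, y ∈ S → z ∈ S → y ≤ z →
      IntervalIntegrable (fun v => |deriv w v| * T v) volume y z := fun hy hz hyz =>
    ((hw _ hy _ hz).intervalIntegrable_deriv.abs).mul_continuousOn (hTAC hy hz hyz).continuousOn
  have J1 : -∫ y in x..b, deriv w y * T y ≤ ∫ y in x..b, |deriv w y| * T y := by
    rw [← intervalIntegral.integral_neg]
    refine intervalIntegral.integral_mono_on hxb
      ((hw x hx b hb).intervalIntegrable_deriv.mul_continuousOn
        (hTAC hx hb hxb).continuousOn).neg (iw hx hb hxb) fun y hy => ?_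
    rw [← neg_mul]
    exact mul_le_mul_of_nonneg_right (neg_le_abs _) (hT0 y (hoc.out hx hb hy) hy.1)
  have J2 : -(T b * ∫ y in b..c, deriv w y) ≤ ∫ y in b..c, |deriv w y| * T y := by
    rw [← intervalIntegral.integral_const_mul, ← intervalIntegral.integral_neg]
    refine intervalIntegral.integral_mono_on hbc
      ((hw b hb c hc).intervalIntegrable_deriv.const_mul _).neg (iw hb hc hbc) fun y hy => ?_
    have hy' : y ∈ S := hoc.out hb hc hy
    have h1 : T b ≤ T y := hmono hb hy' hy.1
    have h2 := hT0 b hb hxb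
    calc -(T b * deriv w y) = T b * -deriv w y := by ring
      _ ≤ T b * |deriv w y| := mul_le_mul_of_nonneg_left (neg_le_abs _) h2
      _ ≤ |deriv w y| * T y := by
        rw [mul_comm]
        exact mul_le_mul_of_nonneg_left h1 (abs_nonneg _)
  have J3 := intervalIntegral.integral_add_adjacent_intervals (iw hx hb hxb) (iw hb hc hbc)
  have key : w x * T x + ∫ y in x..b, w y * deriv T y ≤
      T b * w c + ∫ y in x..c, |deriv w y| * T y := by
    rw [I1]
    rw [I2] at J2
    nlinarith
  have hwint : IntervalIntegrable (fun y => w y * deriv T y) volume x b :=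
    (hTAC hx hb hxb).intervalIntegrable_deriv.continuousOn_mul (hw x hx b hb).continuousOn
  have e1 : ∫⁻ y in Ioc x b, ENNReal.ofReal (w y * deriv T y) =
      ENNReal.ofReal (∫ y in x..b, w y * deriv T y) := by
    rw [intervalIntegral.integral_of_le hxb, ofReal_integral_eq_lintegral_ofReal hwint.1]
    refine (ae_restrict_iff' measurableSet_Ioc).2 (ae_of_all _ fun y hy => ?_)
    have hy' : y ∈ S := hoc.out hx hb ⟨hy.1.le, hy.2⟩
    exact mul_nonneg (hw0 y hy') (hdT y hy')
  have e2 : ENNReal.ofReal (∫ y in x..c, |deriv w y| * T y) ≤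
      ∫⁻ y in S ∩ Ioi x, ENNReal.ofReal (|deriv w y| * T y) := by
    rw [intervalIntegral.integral_of_le hxc,
      ofReal_integral_eq_lintegral_ofReal (iw hx hc hxc).1]
    · refine lintegral_mono_set fun y hy => ⟨hoc.out hx hc ⟨hy.1.le, hy.2⟩, hy.1⟩
    · refine (ae_restrict_iff' measurableSet_Ioc).2 (ae_of_all _ fun y hy => ?_)
      exact mul_nonneg (abs_nonneg _) (hT0 y (hoc.out hx hc ⟨hy.1.le, hy.2⟩) hy.1.le)
  have n1 : 0 ≤ ∫ y in x..b, w y * deriv T y :=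
    intervalIntegral.integral_nonneg hxb fun y hy =>
      mul_nonneg (hw0 y (hoc.out hx hb hy)) (hdT y (hoc.out hx hb hy))
  calc _ = ENNReal.ofReal (w x * T x + ∫ y in x..b, w y * deriv T y) := by
        rw [e1, ENNReal.ofReal_add (mul_nonneg (hw0 x hx) hTx) n1]
    _ ≤ ENNReal.ofReal (T b * w c + ∫ y in x..c, |deriv w y| * T y) := ENNReal.ofReal_le_ofReal key
    _ ≤ _ := ENNReal.ofReal_add_le.trans (add_le_add le_rfl e2)

/-- Rational right ends make this a countable directed union, so monotone convergence applies. -/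
lemma inter_Ioi_eq_iUnion {S : Set ℝ} (hS : IsOpen S) (hoc : S.OrdConnected) {x : ℝ} (hx : x ∈ S) :
    S ∩ Ioi x = ⋃ b : {q : ℚ // (q : ℝ) ∈ S ∧ x ≤ q}, Ioc x (b : ℚ) := by
  ext y
  simp only [mem_inter_iff, mem_Ioi, mem_iUnion, mem_Ioc, Subtype.exists]
  constructor
  · rintro ⟨hy, hxy⟩
    obtain ⟨l, u, hlu, hs⟩ := mem_nhds_iff_exists_Ioo_subset.1 (hS.mem_nhds hy)
    obtain ⟨q, hq1, hq2⟩ := exists_rat_btwn hlu.2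
    exact ⟨q, ⟨hs ⟨hlu.1.trans hq1, hq2⟩, (hxy.trans hq1).le⟩, hxy, hq1.le⟩
  · rintro ⟨q, ⟨hq, _⟩, h1, h2⟩
    exact ⟨hoc.out hx hq ⟨h1.le, h2⟩, h1⟩

lemma setLIntegral_inter_Ioi_le {S : Set ℝ} (hS : IsOpen S) (hoc : S.OrdConnected) {x : ℝ}
    (hx : x ∈ S) {φ : ℝ → ℝ≥0∞} {A K : ℝ≥0∞} (hA : A ≤ K)
    (hK : ∀ b ∈ S, x ≤ b → A + ∫⁻ y in Ioc x b, φ y ≤ K) :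
    A + ∫⁻ y in S ∩ Ioi x, φ y ≤ K := by
  rw [inter_Ioi_eq_iUnion hS hoc hx, setLIntegral_iUnion_of_directed]
  · by_cases hne : Nonempty {q : ℚ // (q : ℝ) ∈ S ∧ x ≤ q}
    · rw [ENNReal.add_iSup]
      exact iSup_le fun b => hK _ b.2.1 b.2.2
    · rw [not_nonempty_iff] at hne
      simpa using hA
  · intro a b
    rcases le_total a.1 b.1 with h | h
    · exact ⟨b, Ioc_subset_Ioc_right (by exact_mod_cast h), subset_rfl⟩
    · exact ⟨a, subset_rfl, Ioc_subset_Ioc_right (by exact_mod_cast h)⟩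

/-- With `b` fixed, `T b` is a constant and a good choice of `c` makes the boundary term as small as
desired; then `b` exhausts `S`. -/
lemma lintegral_mul_deriv_le_right {w T : ℝ → ℝ} {S : Set ℝ} (hS : IsOpen S) (hoc : S.OrdConnected)
    (hw : ∀ a ∈ S, ∀ b ∈ S, AbsolutelyContinuousOnInterval w a b) (hw0 : ∀ x ∈ S, 0 ≤ w x)
    (hT : ContDiffOn ℝ 1 T S) (hmono : MonotoneOn T S)
    (hlim : ∀ b ∈ S, ∀ ε > 0, ∃ c ∈ S, b ≤ c ∧ w c < ε)
    {x : ℝ} (hx : x ∈ S) (hTx : 0 ≤ T x) :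
    ENNReal.ofReal (w x * T x) + ∫⁻ y in S ∩ Ioi x, ENNReal.ofReal (w y * deriv T y) ≤
      ∫⁻ y in S ∩ Ioi x, ENNReal.ofReal (|deriv w y| * T y) := by
  have main : ∀ b ∈ S, x ≤ b →
      ENNReal.ofReal (w x * T x) + ∫⁻ y in Ioc x b, ENNReal.ofReal (w y * deriv T y) ≤
        ∫⁻ y in S ∩ Ioi x, ENNReal.ofReal (|deriv w y| * T y) := by
    intro b hb hxb
    refine ENNReal.le_of_forall_pos_le_add fun ε hε _ => ?_
    have hTb : 0 ≤ T b := hTx.trans (hmono hx hb hxb)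
    -- The `+ 1` keeps the threshold meaningful when `T b = 0`.
    obtain ⟨c, hc, hbc, hwc⟩ := hlim b hb (ε / (T b + 1)) (by positivity)
    refine (intervalIntegral_mul_deriv_le hS hoc hw hw0 hT hmono hx hTx hc hxb hbc).trans ?_
    rw [add_comm]
    refine add_le_add le_rfl ?_
    rw [← ENNReal.ofReal_coe_nnreal]
    refine ENNReal.ofReal_le_ofReal ?_
    rw [lt_div_iff₀ (by positivity)] at hwc
    nlinarith [hw0 c hc]
  refine setLIntegral_inter_Ioi_le hS hoc hx ?_ main
  simpa using main x hx le_rfl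

lemma absolutelyContinuousOnInterval_comp_neg {w : ℝ → ℝ} {a b : ℝ}
    (h : AbsolutelyContinuousOnInterval w (-a) (-b)) :
    AbsolutelyContinuousOnInterval (fun x => w (-x)) a b := by
  rw [absolutelyContinuousOnInterval_iff] at h ⊢
  intro ε hε
  obtain ⟨δ, hδ, H⟩ := h ε hε
  refine ⟨δ, hδ, fun E hE hsum => ?_⟩
  have hneg : ∀ x ∈ uIcc a b, -x ∈ uIcc (-a) (-b) := fun x hx => by
    rw [mem_uIcc] at hx ⊢
    rcases hx with hx | hx
    · exact Or.inr ⟨by linarith, by linarith⟩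
    · exact Or.inl ⟨by linarith, by linarith⟩
  refine H (E.1, fun i => (-(E.2 i).1, -(E.2 i).2)) ⟨fun i hi => ?_, ?_⟩ ?_
  · have := hE.1 i hi
    exact ⟨hneg _ this.1, hneg _ this.2⟩
  · intro i hi j hj hij
    have := hE.2 hi hj hij
    simp only [Function.onFun, uIoc, Ioc_disjoint_Ioc] at this ⊢
    rw [min_neg_neg, min_neg_neg, max_neg_neg, max_neg_neg, max_neg_neg, min_neg_neg]
    linarith
  · simpa using hsum

/-- Reflection: `y ↦ -T (-y)` is again monotone, and it is nonnegative at `-x`. -/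
lemma lintegral_mul_deriv_le_left {w T : ℝ → ℝ} {S : Set ℝ} (hS : IsOpen S) (hoc : S.OrdConnected)
    (hw : ∀ a ∈ S, ∀ b ∈ S, AbsolutelyContinuousOnInterval w a b) (hw0 : ∀ x ∈ S, 0 ≤ w x)
    (hT : ContDiffOn ℝ 1 T S) (hmono : MonotoneOn T S)
    (hlim : ∀ b ∈ S, ∀ ε > 0, ∃ c ∈ S, c ≤ b ∧ w c < ε)
    {x : ℝ} (hx : x ∈ S) (hTx : T x ≤ 0) :
    ENNReal.ofReal (w x * -T x) + ∫⁻ y in S ∩ Iio x, ENNReal.ofReal (w y * deriv T y) ≤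
      ∫⁻ y in S ∩ Iio x, ENNReal.ofReal (|deriv w y| * -T y) := by
  have hnn : ∀ {y}, y ∈ -S ↔ -y ∈ S := mem_neg
  have key := lintegral_mul_deriv_le_right (w := fun y => w (-y)) (T := fun y => -T (-y))
    (S := -S) hS.neg ⟨fun a ha b hb y hy => hoc.out hb ha ⟨neg_le_neg hy.2, neg_le_neg hy.1⟩⟩
    (fun a ha b hb => absolutelyContinuousOnInterval_comp_neg (hw _ ha _ hb))
    (fun y hy => hw0 _ hy) ((hT.comp contDiff_neg.contDiffOn fun y hy => hy).neg)
    (fun a ha b hb hab => neg_le_neg (hmono hb ha (neg_le_neg hab)))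
    (fun b hb ε hε => by
      obtain ⟨c, hc, hcb, hwc⟩ := hlim _ hb ε hε
      exact ⟨-c, by simpa using hc, by linarith, by simpa using hwc⟩)
    (x := -x) (by simpa using hx) (by simpa using hTx)
  have hpre : ∀ φ : ℝ → ℝ≥0∞, ∫⁻ y in -S ∩ Ioi (-x), φ (-y) = ∫⁻ y in S ∩ Iio x, φ y := by
    intro φ
    have := (Measure.measurePreserving_neg (volume : Measure ℝ)).setLIntegral_comp_preimage_emb
      (MeasurableEquiv.neg ℝ).measurableEmbedding φ (S ∩ Iio x)
    rw [← this]
    congr 2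
    ext y
    simp
  have d1 : ∀ y, deriv (fun y => -T (-y)) y = deriv T (-y) := fun y => by
    have := deriv_comp_neg T y
    rw [deriv.fun_neg, this, neg_neg]
  have d2 : ∀ y, deriv (fun y => w (-y)) y = -deriv w (-y) := fun y => deriv_comp_neg w y
  simp only [d1, d2, abs_neg, neg_neg] at key
  rwa [hpre (fun y => ENNReal.ofReal (w y * deriv T y)),
    hpre (fun y => ENNReal.ofReal (|deriv w y| * -T y))] at key

lemma lintegral_inter_Iio_add_inter_Ioi_le (S : Set ℝ) (x : ℝ) (φ : ℝ → ℝ≥0∞) :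
    (∫⁻ y in S ∩ Iio x, φ y) + ∫⁻ y in S ∩ Ioi x, φ y = ∫⁻ y in S, φ y := by
  have h1 := lintegral_inter_add_sdiff (μ := volume) φ S (measurableSet_Iio (a := x))
  rw [← h1]
  congr 1
  refine setLIntegral_congr ?_
  have h2 : S \ Iio x = S ∩ Ici x := by
    ext
    simp
  rw [h2]
  exact (ae_eq_refl S).inter Ioi_ae_eq_Ici

/-- Integration by parts against a monotone function vanishing somewhere. -/
lemma lintegral_mul_deriv_le {w T : ℝ → ℝ} {S : Set ℝ} (hS : IsOpen S) (hoc : S.OrdConnected)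
    (hw : ∀ a ∈ S, ∀ b ∈ S, AbsolutelyContinuousOnInterval w a b) (hw0 : ∀ x ∈ S, 0 ≤ w x)
    (hT : ContDiffOn ℝ 1 T S) (hmono : MonotoneOn T S)
    (hlim : ∀ b ∈ S, ∀ ε > 0, ∃ c ∈ S, b ≤ c ∧ w c < ε)
    (hlim' : ∀ b ∈ S, ∀ ε > 0, ∃ c ∈ S, c ≤ b ∧ w c < ε)
    {x : ℝ} (hx : x ∈ S) (hTx : T x = 0) :
    ∫⁻ y in S, ENNReal.ofReal (w y * deriv T y) ≤
      ∫⁻ y in S, ENNReal.ofReal (|deriv w y| * |T y|) := by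
  have h1 := lintegral_mul_deriv_le_right hS hoc hw hw0 hT hmono hlim hx hTx.ge
  have h2 := lintegral_mul_deriv_le_left hS hoc hw hw0 hT hmono hlim' hx hTx.le
  rw [← lintegral_inter_Iio_add_inter_Ioi_le S x, ← lintegral_inter_Iio_add_inter_Ioi_le S x]
  refine add_le_add (le_add_self.trans (h2.trans ?_)) (le_add_self.trans (h1.trans ?_))
  · exact lintegral_mono fun y => ENNReal.ofReal_le_ofReal
      (mul_le_mul_of_nonneg_left (neg_le_abs _) (abs_nonneg _))
  · exact lintegral_mono fun y => ENNReal.ofReal_le_ofReal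
      (mul_le_mul_of_nonneg_left (le_abs_self _) (abs_nonneg _))

/-- The weight must climb from nearly 0 to `w x` and descend again. Formally this is the integration
by parts on each side of `x` with `T` constant, equal to `1` and to `-1`. -/
lemma two_mul_le_lintegral_abs_deriv {w : ℝ → ℝ} {S : Set ℝ} (hS : IsOpen S) (hoc : S.OrdConnected)
    (hw : ∀ a ∈ S, ∀ b ∈ S, AbsolutelyContinuousOnInterval w a b) (hw0 : ∀ x ∈ S, 0 ≤ w x)
    (hlim : ∀ b ∈ S, ∀ ε > 0, ∃ c ∈ S, b ≤ c ∧ w c < ε)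
    (hlim' : ∀ b ∈ S, ∀ ε > 0, ∃ c ∈ S, c ≤ b ∧ w c < ε) {x : ℝ} (hx : x ∈ S) :
    2 * ENNReal.ofReal (w x) ≤ ∫⁻ y in S, ENNReal.ofReal |deriv w y| := by
  have h1 := lintegral_mul_deriv_le_right (T := fun _ => 1) hS hoc hw hw0 contDiffOn_const
    (fun _ _ _ _ _ => le_rfl) hlim hx zero_le_one
  have h2 := lintegral_mul_deriv_le_left (T := fun _ => -1) hS hoc hw hw0 contDiffOn_const
    (fun _ _ _ _ _ => le_rfl) hlim' hx (by norm_num)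
  simp only [neg_neg, mul_one] at h1 h2
  rw [← lintegral_inter_Iio_add_inter_Ioi_le S x, two_mul]
  exact add_le_add (le_self_add.trans h2) (le_self_add.trans h1)

/-! ### Powers of a locally absolutely continuous density -/

/-- On the compact interval `h` takes values between two positive numbers, where `y ↦ y ^ μ` is
Lipschitz for every real `μ`. -/
lemma absolutelyContinuousOnInterval_rpow {h : ℝ → ℝ} {a b : ℝ} (μ : ℝ)
    (H : AbsolutelyContinuousOnInterval h a b) (hpos : ∀ x ∈ uIcc a b, 0 < h x) :
    AbsolutelyContinuousOnInterval (fun x => h x ^ μ) a b := by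
  obtain ⟨x₀, hx₀, hmin⟩ := isCompact_uIcc.exists_isMinOn nonempty_uIcc H.continuousOn
  obtain ⟨x₁, hx₁, hmax⟩ := isCompact_uIcc.exists_isMaxOn nonempty_uIcc H.continuousOn
  have hpow : ContDiffOn ℝ 1 (fun y : ℝ => y ^ μ) (Icc (h x₀) (h x₁)) := fun y hy =>
    (Real.contDiffAt_rpow_const_of_ne ((hpos x₀ hx₀).trans_le hy.1).ne').contDiffWithinAt
  obtain ⟨K, hK⟩ := hpow.exists_lipschitzOnWith (by decide) (convex_Icc _ _) isCompact_Icc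
  rw [absolutelyContinuousOnInterval_iff] at H ⊢
  intro ε hε
  obtain ⟨δ, hδ, H⟩ := H (ε / (K + 1)) (by positivity)
  refine ⟨δ, hδ, fun E hE hsum => ?_⟩
  have hmem : ∀ y ∈ uIcc a b, h y ∈ Icc (h x₀) (h x₁) := fun y hy => ⟨hmin hy, hmax hy⟩
  have h1 := H E hE hsum
  rw [lt_div_iff₀ (by positivity)] at h1
  calc _ ≤ ∑ i ∈ Finset.range E.1, K * dist (h (E.2 i).1) (h (E.2 i).2) :=
        Finset.sum_le_sum fun i hi =>
          hK.dist_le_mul _ (hmem _ (hE.1 i hi).1) _ (hmem _ (hE.1 i hi).2)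
    _ = (∑ i ∈ Finset.range E.1, dist (h (E.2 i).1) (h (E.2 i).2)) * K := by
        rw [← Finset.mul_sum, mul_comm]
    _ ≤ (∑ i ∈ Finset.range E.1, dist (h (E.2 i).1) (h (E.2 i).2)) * (K + 1) := by
        gcongr
        linarith
    _ < ε := h1

lemma exists_lt_of_lintegral_ne_top {h : ℝ → ℝ} {A : Set ℝ} (hAm : MeasurableSet A)
    (hA : volume A = ∞) (hi : ∫⁻ x, ENNReal.ofReal (h x) ≠ ∞) {δ : ℝ} (hδ : 0 < δ) :
    ∃ z ∈ A, h z < δ := by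
  by_contra! hcon
  refine hi (top_le_iff.1 ?_)
  calc ∞ = ENNReal.ofReal δ * volume A := by
        rw [hA, ENNReal.mul_top (ENNReal.ofReal_pos.2 hδ).ne']
    _ = ∫⁻ _ in A, ENNReal.ofReal δ := by rw [setLIntegral_const]
    _ ≤ ∫⁻ x in A, ENNReal.ofReal (h x) :=
        setLIntegral_mono' hAm fun x hx => ENNReal.ofReal_le_ofReal (hcon x hx)
    _ ≤ ∫⁻ x, ENNReal.ofReal (h x) := setLIntegral_le_lintegral _ _

/-- Integrability forces small values of `h` on a set `A` of infinite measure, but possibly only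
where `h` vanishes. The intermediate value theorem between such a point and `b` yields a value that
is small and still positive, which keeps `c` in the support. -/
lemma exists_mem_supp_rpow_lt {h : ℝ → ℝ} (hc : Continuous h) (h0 : ∀ x, 0 ≤ h x) {A : Set ℝ}
    (hAoc : A.OrdConnected) (hAm : MeasurableSet A) (hA : volume A = ∞)
    (hi : ∫⁻ x, ENNReal.ofReal (h x) ≠ ∞) {μ : ℝ} (hμ : 0 < μ) {b : ℝ} (hbA : b ∈ A)
    (hb : b ∈ supp h) {ε : ℝ} (hε : 0 < ε) : ∃ c ∈ supp h, c ∈ A ∧ h c ^ μ < ε := by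
  have hη : 0 < ε ^ μ⁻¹ := Real.rpow_pos_of_pos hε _
  have hbpos : 0 < h b := hb
  obtain ⟨z, hz, hlt⟩ := exists_lt_of_lintegral_ne_top hAm hA hi (lt_min hη hbpos)
  -- The midpoint is positive even if `h z = 0`, and lies below both `h b` and `ε ^ μ⁻¹`.
  have hv : (h z + min (ε ^ μ⁻¹) (h b)) / 2 ∈ uIcc (h z) (h b) := by
    rw [mem_uIcc]
    have := min_le_right (ε ^ μ⁻¹) (h b)
    exact Or.inl ⟨by linarith, by linarith⟩
  obtain ⟨c, hcm, hcv⟩ := intermediate_value_uIcc hc.continuousOn hv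
  have hm := lt_min hη hbpos
  have hcpos : 0 < h c := by
    rw [hcv]
    linarith [h0 z]
  refine ⟨c, hcpos, hAoc.uIcc_subset hz hbA hcm, ?_⟩
  have hcη : h c < ε ^ μ⁻¹ := by
    rw [hcv]
    linarith [min_le_left (ε ^ μ⁻¹) (h b)]
  calc h c ^ μ < (ε ^ μ⁻¹) ^ μ := Real.rpow_lt_rpow hcpos.le hcη hμ
    _ = ε := Real.rpow_inv_rpow hε.le hμ.ne'

/-! ### Locally absolutely continuous densities and their Fisher information. -/

lemma LocallyAC.continuous {h : ℝ → ℝ} (H : LocallyAC h) : Continuous h :=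
  continuous_iff_continuousAt.2 fun x =>
    ((H (x - 1) (x + 1)).continuousOn).continuousAt
      (by rw [uIcc_of_le (by linarith)]; exact Icc_mem_nhds (by linarith) (by linarith))

lemma LocallyAC.ae_differentiableAt {h : ℝ → ℝ} (H : LocallyAC h) :
    ∀ᵐ x, DifferentiableAt ℝ h x := by
  have h1 : ∀ᵐ x, ∀ n : ℕ, x ∈ uIcc (-(n : ℝ)) n → DifferentiableAt ℝ h x :=
    ae_all_iff.2 fun n => (H (-(n : ℝ)) n).ae_differentiableAt
  filter_upwards [h1] with x hx
  obtain ⟨n, hn⟩ := exists_nat_ge |x|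
  refine hx n ?_
  rw [uIcc_of_le (by linarith [abs_nonneg x])]
  exact abs_le.1 hn

/-- A locally absolutely continuous probability density with connected support. -/
structure IsACDensity (h : ℝ → ℝ) : Prop extends IsIntervalDensity h where
  ac : LocallyAC h

namespace IsACDensity

variable {h : ℝ → ℝ}

lemma mass_ne_top (H : IsACDensity h) : ∫⁻ x, ENNReal.ofReal (h x) ≠ ∞ := by
  rw [H.mass]
  exact ENNReal.one_ne_top

lemma ac_rpow (H : IsACDensity h) (μ : ℝ) {a b : ℝ} (ha : a ∈ supp h) (hb : b ∈ supp h) :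
    AbsolutelyContinuousOnInterval (fun x => h x ^ μ) a b :=
  absolutelyContinuousOnInterval_rpow μ (H.ac a b) (H.ordConnected.uIcc_subset ha hb)

/-- Together with its mirror image below, this supplies the boundary hypotheses `hlim`, `hlim'` of
the integration by parts for the weight `h ^ μ`. -/
lemma exists_ge_rpow_lt (H : IsACDensity h) {μ : ℝ} (hμ : 0 < μ) (b : ℝ) (hb : b ∈ supp h)
    (ε : ℝ) (hε : ε > 0) : ∃ c ∈ supp h, b ≤ c ∧ h c ^ μ < ε :=
  exists_mem_supp_rpow_lt H.ac.continuous H.nonneg ordConnected_Ici measurableSet_Ici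
    Real.volume_Ici H.mass_ne_top hμ self_mem_Ici hb hε

lemma exists_le_rpow_lt (H : IsACDensity h) {μ : ℝ} (hμ : 0 < μ) (b : ℝ) (hb : b ∈ supp h)
    (ε : ℝ) (hε : ε > 0) : ∃ c ∈ supp h, c ≤ b ∧ h c ^ μ < ε :=
  exists_mem_supp_rpow_lt H.ac.continuous H.nonneg ordConnected_Iic measurableSet_Iic
    Real.volume_Iic H.mass_ne_top hμ self_mem_Iic hb hε

lemma ae_abs_deriv_rpow (H : IsACDensity h) {μ : ℝ} (hμ : 0 < μ) :
    ∀ᵐ x, x ∈ supp h →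
      |deriv (fun x => h x ^ μ) x| = μ * (|h x ^ (μ - 2) * deriv h x| * h x) := by
  filter_upwards [H.ac.ae_differentiableAt] with x hx hxs
  have hpos : 0 < h x := hxs
  rw [(hx.hasDerivAt.rpow_const (p := μ) (Or.inl hpos.ne')).deriv, abs_mul, abs_mul, abs_mul,
    abs_of_pos hμ, abs_of_pos (Real.rpow_pos_of_pos hpos _),
    abs_of_pos (Real.rpow_pos_of_pos hpos _), show μ - 1 = (μ - 2) + 1 by ring,
    Real.rpow_add_one hpos.ne']
  ring

/-- Hölder's inequality for a weighted Fisher information. -/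
lemma lintegral_abs_deriv_rpow_mul_le (H : IsACDensity h) {μ p : ℝ} (hμ : 0 < μ) (hp : 1 ≤ p)
    {W : ℝ → ℝ≥0∞} (hW : AEMeasurable W (volume.restrict (supp h))) :
    ∫⁻ x in supp h, ENNReal.ofReal |deriv (fun x => h x ^ μ) x| * W x ^ (1 - 1 / p) ≤
      ENNReal.ofReal μ * (F p μ h ^ (1 / p) *
        (∫⁻ x in supp h, W x * ENNReal.ofReal (h x)) ^ (1 - 1 / p)) := by
  have hp0 : 0 < p := by linarith
  have hp1 : 0 ≤ 1 - 1 / p := by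
    rw [sub_nonneg, div_le_one hp0]
    exact hp
  have hm := H.measurable
  have e1 : ∫⁻ x in supp h, ENNReal.ofReal |deriv (fun x => h x ^ μ) x| * W x ^ (1 - 1 / p) =
      ENNReal.ofReal μ * ∫⁻ x in supp h,
        (ENNReal.ofReal |h x ^ (μ - 2) * deriv h x| ^ p * ENNReal.ofReal (h x)) ^ (1 / p) *
          (W x * ENNReal.ofReal (h x)) ^ (1 - 1 / p) := by
    rw [← lintegral_const_mul' _ _ ENNReal.ofReal_ne_top]
    refine lintegral_congr_ae ?_
    filter_upwards [(ae_restrict_iff' H.isOpen.measurableSet).2 (H.ae_abs_deriv_rpow hμ),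
      ae_restrict_mem H.isOpen.measurableSet] with x hx hxs
    have hpos : 0 < h x := hxs
    rw [hx, ENNReal.ofReal_mul hμ.le, ENNReal.ofReal_mul (abs_nonneg _),
      ENNReal.mul_rpow_of_nonneg _ _ (by positivity), ← ENNReal.rpow_mul,
      ENNReal.mul_rpow_of_nonneg _ _ hp1, mul_one_div_cancel hp0.ne', ENNReal.rpow_one]
    -- The density is shared between the two Hölder factors, with exponents `1 / p` and `1 - 1 / p`.
    have : ENNReal.ofReal (h x) =
        ENNReal.ofReal (h x) ^ (1 / p) * ENNReal.ofReal (h x) ^ (1 - 1 / p) := by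
      rw [← ENNReal.rpow_add _ _ (ENNReal.ofReal_pos.2 hpos).ne' ENNReal.ofReal_ne_top,
        add_sub_cancel, ENNReal.rpow_one]
    nth_rw 1 [this]
    ring
  rw [e1]
  refine mul_le_mul_right ?_ _
  refine ENNReal.lintegral_mul_norm_pow_le ?_ (hW.mul hm.ennreal_ofReal.aemeasurable)
    (by positivity) hp1 (by ring)
  refine (Measurable.aemeasurable ?_)
  exact ((((hm.pow_const _).mul (measurable_deriv h)).abs.ennreal_ofReal).pow_const _).mul
    hm.ennreal_ofReal

/-- The total variation of `h ^ μ` is estimated by Hölder with weight `1`, whose second factor is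
the mass. This sup bound serves the case `p = 1` and also the case of infinite `F_{s,lam}[f]`. -/
lemma two_mul_rpow_le (H : IsACDensity h) {μ p : ℝ} (hμ : 0 < μ) (hp : 1 ≤ p) {x : ℝ}
    (hx : x ∈ supp h) :
    2 * ENNReal.ofReal (h x ^ μ) ≤ ENNReal.ofReal μ * F p μ h ^ (1 / p) := by
  refine (two_mul_le_lintegral_abs_deriv H.isOpen H.ordConnected (fun a ha b hb => H.ac_rpow μ ha hb)
    (fun y _ => Real.rpow_nonneg (H.nonneg y) _) (H.exists_ge_rpow_lt hμ)
    (H.exists_le_rpow_lt hμ) hx).trans ?_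
  simpa [H.lintegral_supp] using H.lintegral_abs_deriv_rpow_mul_le hμ hp (W := fun _ => 1)
    aemeasurable_const

lemma F_ne_zero (H : IsACDensity h) {μ p : ℝ} (hμ : 0 < μ) (hp : 1 ≤ p) : F p μ h ≠ 0 := by
  intro h0
  obtain ⟨x, hx⟩ := H.supp_nonempty
  have := H.two_mul_rpow_le hμ hp hx
  rw [h0, ENNReal.zero_rpow_of_pos (by positivity), mul_zero] at this
  have h2 : 0 < ENNReal.ofReal (h x ^ μ) := ENNReal.ofReal_pos.2 (Real.rpow_pos_of_pos hx _)
  simp [h2.ne'] at this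

end IsACDensity

/-! ### Comparison of Rényi integrals along a monotone transport -/

/-- Hölder with exponents `μ` and `1 - μ` applied to `h^μ t^(1-μ) = (h^μ)^μ (h^μ t)^(1-μ)`. -/
lemma lintegral_rpow_le_of_lt_one {α : Type*} [MeasurableSpace α] {ν : Measure α} {h t : α → ℝ}
    {μ : ℝ} (hμ0 : 0 < μ) (hμ1 : μ < 1) (hh : AEMeasurable h ν) (ht : AEMeasurable t ν)
    (hpos : ∀ᵐ x ∂ν, 0 < h x ∧ 0 < t x) :
    (∫⁻ x, ENNReal.ofReal (h x ^ μ * t x ^ (1 - μ)) ∂ν) ^ (1 / (1 - μ)) ≤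
      (∫⁻ x, ENNReal.ofReal (h x ^ μ) ∂ν) ^ (μ / (1 - μ)) *
        ∫⁻ x, ENNReal.ofReal (h x ^ μ * t x) ∂ν := by
  have h1 : 0 < 1 - μ := by linarith
  have key : ∫⁻ x, ENNReal.ofReal (h x ^ μ * t x ^ (1 - μ)) ∂ν ≤
      (∫⁻ x, ENNReal.ofReal (h x ^ μ) ∂ν) ^ μ *
        (∫⁻ x, ENNReal.ofReal (h x ^ μ * t x) ∂ν) ^ (1 - μ) := by
    refine le_trans (le_of_eq (lintegral_congr_ae ?_)) (ENNReal.lintegral_mul_norm_pow_le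
      (hh.pow_const μ).ennreal_ofReal ((hh.pow_const μ).mul ht).ennreal_ofReal hμ0.le h1.le
      (by ring))
    filter_upwards [hpos] with x hx
    have e : 0 < h x ^ μ := Real.rpow_pos_of_pos hx.1 _
    rw [Pi.mul_apply, ENNReal.ofReal_rpow_of_pos e, ENNReal.ofReal_rpow_of_pos (mul_pos e hx.2),
      ← ENNReal.ofReal_mul (Real.rpow_nonneg e.le _), Real.mul_rpow e.le hx.2.le, ← mul_assoc,
      ← Real.rpow_add e, add_sub_cancel, Real.rpow_one]
  calc _ ≤ ((∫⁻ x, ENNReal.ofReal (h x ^ μ) ∂ν) ^ μ *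
        (∫⁻ x, ENNReal.ofReal (h x ^ μ * t x) ∂ν) ^ (1 - μ)) ^ (1 / (1 - μ)) :=
        ENNReal.rpow_le_rpow key (by positivity)
    _ = _ := by
        rw [ENNReal.mul_rpow_of_nonneg _ _ (by positivity), ← ENNReal.rpow_mul,
          ← ENNReal.rpow_mul, mul_one_div_cancel h1.ne', ENNReal.rpow_one, mul_one_div]

/-- The same conclusion, with the roles exchanged: Hölder is applied to `h^μ = (h^μ t^(1-μ))^(1/μ)
(h^μ t)^(1-1/μ)`. Solving for the negative powers requires the two Rényi integrals to be positive
and finite. -/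
lemma lintegral_rpow_le_of_one_lt {α : Type*} [MeasurableSpace α] {ν : Measure α} {h t : α → ℝ}
    {μ : ℝ} (hμ1 : 1 < μ) (hh : AEMeasurable h ν) (ht : AEMeasurable t ν)
    (hpos : ∀ᵐ x ∂ν, 0 < h x ∧ 0 < t x) (h0 : ∫⁻ x, ENNReal.ofReal (h x ^ μ) ∂ν ≠ 0)
    (htop : ∫⁻ x, ENNReal.ofReal (h x ^ μ) ∂ν ≠ ∞)
    (g0 : ∫⁻ x, ENNReal.ofReal (h x ^ μ * t x ^ (1 - μ)) ∂ν ≠ 0)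
    (gtop : ∫⁻ x, ENNReal.ofReal (h x ^ μ * t x ^ (1 - μ)) ∂ν ≠ ∞) :
    (∫⁻ x, ENNReal.ofReal (h x ^ μ * t x ^ (1 - μ)) ∂ν) ^ (1 / (1 - μ)) ≤
      (∫⁻ x, ENNReal.ofReal (h x ^ μ) ∂ν) ^ (μ / (1 - μ)) *
        ∫⁻ x, ENNReal.ofReal (h x ^ μ * t x) ∂ν := by
  have hμ0 : 0 < μ := by linarith
  have h1 : 0 < μ - 1 := by linarith
  have h1' : 0 ≤ 1 - 1 / μ := by
    rw [sub_nonneg, div_le_one hμ0]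
    exact hμ1.le
  have key : ∫⁻ x, ENNReal.ofReal (h x ^ μ) ∂ν ≤
      (∫⁻ x, ENNReal.ofReal (h x ^ μ * t x ^ (1 - μ)) ∂ν) ^ (1 / μ) *
        (∫⁻ x, ENNReal.ofReal (h x ^ μ * t x) ∂ν) ^ (1 - 1 / μ) := by
    refine le_trans (le_of_eq (lintegral_congr_ae ?_)) (ENNReal.lintegral_mul_norm_pow_le
      ((hh.pow_const μ).mul (ht.pow_const (1 - μ))).ennreal_ofReal
      ((hh.pow_const μ).mul ht).ennreal_ofReal (by positivity) h1' (by ring))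
    filter_upwards [hpos] with x hx
    have e : 0 < h x ^ μ := Real.rpow_pos_of_pos hx.1 _
    have e2 : 0 < t x ^ (1 - μ) := Real.rpow_pos_of_pos hx.2 _
    rw [Pi.mul_apply, Pi.mul_apply, ENNReal.ofReal_rpow_of_pos (mul_pos e e2),
      ENNReal.ofReal_rpow_of_pos (mul_pos e hx.2),
      ← ENNReal.ofReal_mul (Real.rpow_nonneg (mul_pos e e2).le _), Real.mul_rpow e.le e2.le,
      Real.mul_rpow e.le hx.2.le, ← Real.rpow_mul hx.2.le,
      mul_mul_mul_comm, ← Real.rpow_add e, ← Real.rpow_add hx.2, add_sub_cancel, Real.rpow_one,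
      show (1 - μ) * (1 / μ) + (1 - 1 / μ) = 0 by field_simp; ring, Real.rpow_zero, mul_one]
  set E := ∫⁻ x, ENNReal.ofReal (h x ^ μ) ∂ν
  set G := ∫⁻ x, ENNReal.ofReal (h x ^ μ * t x ^ (1 - μ)) ∂ν
  set B := ∫⁻ x, ENNReal.ofReal (h x ^ μ * t x) ∂ν
  have key2 : E ^ (μ / (μ - 1)) ≤ G ^ (1 / (μ - 1)) * B := by
    calc _ ≤ (G ^ (1 / μ) * B ^ (1 - 1 / μ)) ^ (μ / (μ - 1)) :=
          ENNReal.rpow_le_rpow key (by positivity)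
      _ = _ := by
          rw [ENNReal.mul_rpow_of_nonneg _ _ (by positivity), ← ENNReal.rpow_mul,
            ← ENNReal.rpow_mul, show 1 / μ * (μ / (μ - 1)) = 1 / (μ - 1) by field_simp,
            show (1 - 1 / μ) * (μ / (μ - 1)) = 1 by field_simp, ENNReal.rpow_one]
  rw [show 1 / (1 - μ) = -(1 / (μ - 1)) by rw [← neg_sub μ 1, div_neg],
    show μ / (1 - μ) = -(μ / (μ - 1)) by rw [← neg_sub μ 1, div_neg]]
  have hG0 : G ^ (1 / (μ - 1)) ≠ 0 := (ENNReal.rpow_pos (pos_iff_ne_zero.2 g0) gtop).ne'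
  have hGt : G ^ (1 / (μ - 1)) ≠ ∞ := ENNReal.rpow_ne_top_of_nonneg (by positivity) gtop
  have hE0 : E ^ (μ / (μ - 1)) ≠ 0 := (ENNReal.rpow_pos (pos_iff_ne_zero.2 h0) htop).ne'
  have hEt : E ^ (μ / (μ - 1)) ≠ ∞ := ENNReal.rpow_ne_top_of_nonneg (by positivity) htop
  rw [ENNReal.rpow_neg, ENNReal.rpow_neg, mul_comm, ← div_eq_mul_inv, ENNReal.le_div_iff_mul_le (Or.inl hE0) (Or.inl hEt), mul_comm,
    ← div_eq_mul_inv]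
  refine ENNReal.div_le_of_le_mul ?_
  rwa [mul_comm]

lemma lintegral_rpow_pos {h : ℝ → ℝ} (H : IsIntervalDensity h) (μ : ℝ) :
    ∫⁻ x in supp h, ENNReal.ofReal (h x ^ μ) ≠ 0 := by
  intro h0
  rw [lintegral_eq_zero_iff (H.measurable.pow_const μ).ennreal_ofReal, EventuallyEq,
    ae_restrict_iff' H.isOpen.measurableSet] at h0
  have : volume (supp h) = 0 := by
    rw [measure_eq_zero_iff_ae_notMem]
    filter_upwards [h0] with x hx hxs
    have := ENNReal.ofReal_pos.2 (Real.rpow_pos_of_pos (show 0 < h x from hxs) μ)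
    rw [hx hxs] at this
    exact lt_irrefl _ this
  exact (H.isOpen.measure_pos volume H.supp_nonempty).ne' this

/-- The Stam inequality before identification of the constant. -/
lemma rpow_le_rpow_mul_F {h g : ℝ → ℝ} (H : IsACDensity h) (K : IsIntervalDensity g)
    (hg0 : (0 : ℝ) ∈ supp g) {p μ : ℝ} (hp : 1 < p) (hμ : 0 < μ) (hμ1 : μ ≠ 1)
    (hE : ∫⁻ x in supp h, ENNReal.ofReal (h x ^ μ) ≠ ∞)
    (hG : ∫⁻ x in supp g, ENNReal.ofReal (g x ^ μ) ≠ ∞) :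
    (∫⁻ x in supp g, ENNReal.ofReal (g x ^ μ)) ^ (1 / (1 - μ)) ≤
      (∫⁻ x in supp h, ENNReal.ofReal (h x ^ μ)) ^ (μ / (1 - μ)) *
        (ENNReal.ofReal μ * (F p μ h ^ (1 / p) *
          (∫⁻ x in supp g, ENNReal.ofReal (|x| ^ pstar p) * ENNReal.ofReal (g x)) ^
            (1 - 1 / p))) := by
  obtain ⟨T, hT, hTi, hTm⟩ := H.toIsIntervalDensity.exists_transport K
  have hTmem : ∀ x ∈ supp h, T x ∈ supp g := fun x hx => by
    rw [← hTi]
    exact mem_image_of_mem _ hx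
  have hTcont : ContinuousOn T (supp h) := fun x hx => (hT x hx).continuousAt.continuousWithinAt
  have hdT : ∀ x ∈ supp h, deriv T x = h x / g (T x) := fun x hx => (hT x hx).deriv
  have hdpos : ∀ x ∈ supp h, 0 < deriv T x := fun x hx => by
    rw [hdT x hx]
    exact div_pos hx (hTmem x hx)
  have hTC : ContDiffOn ℝ 1 T (supp h) := by
    rw [show (1 : WithTop ℕ∞) = 0 + 1 by simp, contDiffOn_succ_iff_deriv_of_isOpen H.isOpen]
    refine ⟨fun x hx => (hT x hx).differentiableAt.differentiableWithinAt, by simp, ?_⟩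
    rw [contDiffOn_zero]
    refine ContinuousOn.congr ?_ hdT
    exact H.cont.div (K.cont.comp hTcont hTmem) fun x hx => ne_of_gt (hTmem x hx)
  have hms := H.isOpen.measurableSet
  have hcv : ∀ φ : ℝ → ℝ≥0∞, ∫⁻ y in supp g, φ y =
      ∫⁻ x in supp h, ENNReal.ofReal (deriv T x) * φ (T x) := fun φ => by
    rw [← hTi, lintegral_image_eq_lintegral_abs_deriv_mul hms
      (fun x hx => (hT x hx).hasDerivWithinAt) hTm.injOn]
    refine setLIntegral_congr_fun hms fun x hx => ?_
    rw [hdT x hx, abs_of_pos (div_pos hx (hTmem x hx))]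
  -- Substituting `y = T x`, the relation `g (T x) = h x / T' x` turns `g^μ dy` into `h^μ T'^(1-μ)
  -- dx`.
  have eG : ∫⁻ x in supp g, ENNReal.ofReal (g x ^ μ) =
      ∫⁻ x in supp h, ENNReal.ofReal (h x ^ μ * deriv T x ^ (1 - μ)) := by
    rw [hcv]
    refine setLIntegral_congr_fun hms fun x hx => ?_
    have hx0 : 0 < h x := hx
    have hTx0 : 0 < g (T x) := hTmem x hx
    rw [← ENNReal.ofReal_mul (hdpos x hx).le, hdT x hx]
    congr 1
    rw [Real.rpow_sub (div_pos hx0 hTx0), Real.rpow_one, Real.div_rpow hx0.le hTx0.le]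
    have := (Real.rpow_pos_of_pos hx0 μ).ne'
    have := (Real.rpow_pos_of_pos hTx0 μ).ne'
    field_simp
  have em : ∫⁻ x in supp g, ENNReal.ofReal (|x| ^ pstar p) * ENNReal.ofReal (g x) =
      ∫⁻ x in supp h, ENNReal.ofReal (|T x| ^ pstar p) * ENNReal.ofReal (h x) := by
    rw [hcv]
    refine setLIntegral_congr_fun hms fun x hx => ?_
    rw [mul_left_comm, ← ENNReal.ofReal_mul (hdpos x hx).le, hdT x hx,
      div_mul_cancel₀ _ (ne_of_gt (hTmem x hx))]
  have hB : ∫⁻ x in supp h, ENNReal.ofReal (h x ^ μ * deriv T x) ≤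
      ENNReal.ofReal μ * (F p μ h ^ (1 / p) *
          (∫⁻ x in supp g, ENNReal.ofReal (|x| ^ pstar p) * ENNReal.ofReal (g x)) ^
            (1 - 1 / p)) := by
    -- Since `0` lies in the support of `g`, the transport vanishes somewhere; that zero is where
    -- the integration by parts is split.
    obtain ⟨x₀, hx₀, hTx₀⟩ : (0 : ℝ) ∈ T '' supp h := by rwa [hTi]
    rw [em]
    refine (lintegral_mul_deriv_le H.isOpen H.ordConnected (fun a ha b hb => H.ac_rpow μ ha hb)
      (fun y _ => Real.rpow_nonneg (H.nonneg y) _) hTC hTm.monotoneOn (H.exists_ge_rpow_lt hμ)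
      (H.exists_le_rpow_lt hμ) hx₀ hTx₀).trans ?_
    refine le_trans (le_of_eq (lintegral_congr fun x => ?_))
      (H.lintegral_abs_deriv_rpow_mul_le hμ hp.le
        (((hTcont.aemeasurable hms).abs.pow_const _).ennreal_ofReal))
    have h1 : pstar p * (1 - 1 / p) = 1 := by
      have : p - 1 ≠ 0 := by linarith
      rw [pstar]
      field_simp
    have h2 : 0 ≤ 1 - 1 / p := by
      rw [sub_nonneg, div_le_one (by linarith)]
      exact hp.le
    rw [ENNReal.ofReal_mul (abs_nonneg _), ENNReal.ofReal_rpow_of_nonneg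
      (Real.rpow_nonneg (abs_nonneg _) _) h2, ← Real.rpow_mul (abs_nonneg _), h1, Real.rpow_one]
  have hpos : ∀ᵐ x ∂volume.restrict (supp h), 0 < h x ∧ 0 < deriv T x :=
    (ae_restrict_iff' hms).2 (ae_of_all _ fun x hx => ⟨hx, hdpos x hx⟩)
  have hmh : AEMeasurable h (volume.restrict (supp h)) := H.measurable.aemeasurable
  have hmt : AEMeasurable (deriv T) (volume.restrict (supp h)) := (measurable_deriv T).aemeasurable
  have g0 := lintegral_rpow_pos K μ
  refine le_trans ?_ (mul_le_mul_right hB _)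
  rw [eG] at hG g0 ⊢
  rcases lt_or_gt_of_ne hμ1 with h1 | h1
  · exact lintegral_rpow_le_of_lt_one hμ h1 hmh hmt hpos
  · exact lintegral_rpow_le_of_one_lt h1 hmh hmt hpos
      (lintegral_rpow_pos H.toIsIntervalDensity μ) hE g0 hG

/-! ### The Tsallis profile -/

/-- The unnormalised generalized Gaussian `exp_{2-μ}(-|x| ^ P)`. -/
noncomputable def profile (P μ x : ℝ) : ℝ := qexp (2 - μ) (-(|x| ^ P))

/-- `profile P μ ^ (μ - 1)` on its support. -/
noncomputable def profileBase (P μ x : ℝ) : ℝ := 1 - (μ - 1) * |x| ^ P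

section Profile

variable {P μ : ℝ}

lemma profile_eq (hμ : μ ≠ 1) (x : ℝ) :
    profile P μ x = max (profileBase P μ x) 0 ^ (1 / (μ - 1)) := by
  have h1 : (2 : ℝ) - μ ≠ 1 := fun h => hμ (by linarith)
  rw [profile, qexp, if_neg h1, profileBase]
  ring_nf

lemma profile_nonneg (hμ : μ ≠ 1) (x : ℝ) : 0 ≤ profile P μ x := by
  rw [profile_eq hμ]
  exact Real.rpow_nonneg (le_max_right _ _) _

lemma profile_neg (x : ℝ) : profile P μ (-x) = profile P μ x := by
  rw [profile, profile, abs_neg]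

lemma one_le_profileBase (hμ : μ ≤ 1) (x : ℝ) : 1 ≤ profileBase P μ x := by
  have : 0 ≤ |x| ^ P := Real.rpow_nonneg (abs_nonneg _) _
  rw [profileBase]
  nlinarith

lemma profileBase_le_one (hμ : 1 ≤ μ) (x : ℝ) : profileBase P μ x ≤ 1 := by
  have : 0 ≤ |x| ^ P := Real.rpow_nonneg (abs_nonneg _) _
  rw [profileBase]
  nlinarith

lemma mem_supp_profile (hμ : μ ≠ 1) {x : ℝ} : x ∈ supp (profile P μ) ↔ 0 < profileBase P μ x := by
  rw [supp, mem_ofPred_eq, profile_eq hμ]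
  constructor
  · intro h
    by_contra hb
    rw [max_eq_right (not_lt.1 hb), Real.zero_rpow (by simpa [sub_eq_zero] using hμ)] at h
    exact lt_irrefl _ h
  · intro h
    exact Real.rpow_pos_of_pos (lt_max_of_lt_left h) _

lemma profile_rpow_sub_one (hμ : μ ≠ 1) {x : ℝ} (hx : x ∈ supp (profile P μ)) :
    profile P μ x ^ (μ - 1) = profileBase P μ x := by
  have hb := (mem_supp_profile hμ).1 hx
  rw [profile_eq hμ, max_eq_left hb.le, ← Real.rpow_mul hb.le,
    one_div_mul_cancel (sub_ne_zero.2 hμ), Real.rpow_one]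

lemma profile_le_one (hμ : μ ≠ 1) (x : ℝ) : profile P μ x ≤ 1 := by
  rw [profile_eq hμ]
  rcases lt_or_gt_of_ne hμ with h | h
  · exact Real.rpow_le_one_of_one_le_of_nonpos
      ((one_le_profileBase h.le x).trans (le_max_left _ _))
      (one_div_nonpos.2 (by linarith))
  · exact Real.rpow_le_one (le_max_right _ _) (max_le (profileBase_le_one h.le x) zero_le_one)
      (one_div_nonneg.2 (by linarith))

lemma continuous_profileBase (hP : 0 < P) : Continuous (profileBase P μ) := by
  unfold profileBase
  exact continuous_const.sub (continuous_const.mul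
    (continuous_abs.rpow_const fun _ => Or.inr hP.le))

lemma continuous_profile (hP : 0 < P) (hμ : μ ≠ 1) : Continuous (profile P μ) := by
  rw [funext (profile_eq hμ)]
  refine ((continuous_profileBase hP).max continuous_const).rpow_const fun x => ?_
  rcases lt_or_gt_of_ne hμ with h | h
  · exact Or.inl (ne_of_gt (zero_lt_one.trans_le
      ((one_le_profileBase h.le x).trans (le_max_left _ _))))
  · exact Or.inr (one_div_nonneg.2 (by linarith))

lemma isOpen_supp_profile (hP : 0 < P) (hμ : μ ≠ 1) : IsOpen (supp (profile P μ)) :=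
  isOpen_lt continuous_const (continuous_profile hP hμ)

lemma profileBase_pos_of_abs_le (hP : 0 < P) {x y : ℝ} (hxy : |x| ≤ |y|)
    (hy : 0 < profileBase P μ y) : 0 < profileBase P μ x := by
  rcases le_total μ 1 with h | h
  · exact zero_lt_one.trans_le (one_le_profileBase h x)
  · have h1 := Real.rpow_le_rpow (abs_nonneg x) hxy hP.le
    rw [profileBase] at hy ⊢
    nlinarith

lemma ordConnected_supp_profile (hP : 0 < P) (hμ : μ ≠ 1) : (supp (profile P μ)).OrdConnected := by
  refine ⟨fun a ha b hb y hy => ?_⟩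
  rw [mem_supp_profile hμ] at *
  rcases le_total 0 y with h0 | h0
  · refine profileBase_pos_of_abs_le hP ?_ hb
    rw [abs_of_nonneg h0]
    exact hy.2.trans (le_abs_self b)
  · refine profileBase_pos_of_abs_le hP ?_ ha
    rw [abs_of_nonpos h0, abs_of_nonpos (hy.1.trans h0)]
    exact neg_le_neg hy.1

lemma zero_mem_supp_profile (hP : 0 < P) (hμ : μ ≠ 1) : (0 : ℝ) ∈ supp (profile P μ) := by
  rw [mem_supp_profile hμ, profileBase, abs_zero, Real.zero_rpow hP.ne']
  norm_num

lemma setLIntegral_Iio_eq_Ioi_of_even {S : Set ℝ} (hS : ∀ x, -x ∈ S ↔ x ∈ S) {φ : ℝ → ℝ≥0∞}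
    (hφ : ∀ x, φ (-x) = φ x) : ∫⁻ x in S ∩ Iio 0, φ x = ∫⁻ x in S ∩ Ioi 0, φ x := by
  have := (Measure.measurePreserving_neg (volume : Measure ℝ)).setLIntegral_comp_preimage_emb
    (MeasurableEquiv.neg ℝ).measurableEmbedding φ (S ∩ Iio 0)
  rw [← this]
  simp only [hφ]
  congr 2
  ext x
  simp [hS]

lemma setLIntegral_eq_two_mul_of_even {S : Set ℝ} (hS : ∀ x, -x ∈ S ↔ x ∈ S) {φ : ℝ → ℝ≥0∞}
    (hφ : ∀ x, φ (-x) = φ x) : ∫⁻ x in S, φ x = 2 * ∫⁻ x in S ∩ Ioi 0, φ x := by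
  rw [← lintegral_inter_Iio_add_inter_Ioi_le S 0, setLIntegral_Iio_eq_Ioi_of_even hS hφ, two_mul]

lemma neg_mem_supp_profile (x : ℝ) : -x ∈ supp (profile P μ) ↔ x ∈ supp (profile P μ) := by
  rw [supp, mem_ofPred_eq, mem_ofPred_eq, profile_neg]

/-- For `μ < 1` the profile decays like `x^(-P/(1-μ))`, so `x^P` times it is integrable at infinity
exactly when `P μ / (1 - μ) > 1`, that is `1 < μ (1 + P)`. For `μ > 1` the support is bounded. The
weight `1 + |x|^P` treats mass and moment together. -/
lemma lintegral_profile_ne_top (hP : 0 < P) (hμ : μ ≠ 1) (hμP : 1 < μ * (1 + P)) :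
    ∫⁻ x in Ioi (0 : ℝ), ENNReal.ofReal ((1 + |x| ^ P) * profile P μ x) ≠ ∞ := by
  have hμ0 : 0 < μ := by
    by_contra h
    nlinarith
  have hsplit : ∀ R : ℝ, 0 < R → ∫⁻ x in Ioi R, ENNReal.ofReal ((1 + |x| ^ P) * profile P μ x) ≠ ∞ →
      ∫⁻ x in Ioi (0 : ℝ), ENNReal.ofReal ((1 + |x| ^ P) * profile P μ x) ≠ ∞ := by
    intro R hR h
    rw [← Ioc_union_Ioi_eq_Ioi hR.le]
    refine ((lintegral_union_le _ _ _).trans_lt (ENNReal.add_lt_top.2 ⟨?_, h.lt_top⟩)).ne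
    have hc : Continuous fun x => (1 + |x| ^ P) * profile P μ x :=
      (continuous_const.add (continuous_abs.rpow_const fun _ => Or.inr hP.le)).mul
        (continuous_profile hP hμ)
    exact (hc.integrableOn_Ioc).lintegral_lt_top
  rcases lt_or_gt_of_ne hμ with h | h
  · refine hsplit 1 one_pos ?_
    have h1 : 0 < 1 - μ := by linarith
    have hint : IntegrableOn (fun x : ℝ => (2 * (1 - μ) ^ (1 / (μ - 1))) * x ^ (-(P * μ / (1 - μ))))
        (Ioi 1) := by
      refine (integrableOn_Ioi_rpow_of_lt ?_ one_pos).const_mul _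
      rw [neg_lt_neg_iff, lt_div_iff₀ h1]
      linarith
    refine ne_top_of_le_ne_top hint.lintegral_lt_top.ne (setLIntegral_mono' measurableSet_Ioi
      fun x (hx : 1 < x) => ENNReal.ofReal_le_ofReal ?_)
    have hx0 : 0 < x := by linarith
    have hxP : 1 ≤ x ^ P := Real.one_le_rpow hx.le hP.le
    have hxP0 : 0 < x ^ P := by linarith
    have hprof : profile P μ x ≤ (1 - μ) ^ (1 / (μ - 1)) * (x ^ P) ^ (1 / (μ - 1)) := by
      rw [profile_eq hμ, ← Real.mul_rpow h1.le hxP0.le]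
      refine Real.rpow_le_rpow_of_nonpos (mul_pos h1 hxP0) ?_ (one_div_nonpos.2 (by linarith))
      refine le_max_of_le_left ?_
      rw [profileBase, abs_of_pos hx0]
      nlinarith
    have hk : 0 < (1 - μ) ^ (1 / (μ - 1)) := Real.rpow_pos_of_pos h1 _
    calc (1 + |x| ^ P) * profile P μ x
        ≤ (2 * x ^ P) * ((1 - μ) ^ (1 / (μ - 1)) * (x ^ P) ^ (1 / (μ - 1))) := by
          rw [abs_of_pos hx0]
          refine mul_le_mul (by linarith) hprof (profile_nonneg hμ x) (by positivity)
      _ = (2 * (1 - μ) ^ (1 / (μ - 1))) * ((x ^ P) ^ (1 : ℝ) * (x ^ P) ^ (1 / (μ - 1))) := by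
          rw [Real.rpow_one]
          ring
      _ = _ := by
          rw [← Real.rpow_add hxP0, ← Real.rpow_mul hx0.le]
          congr 2
          have : μ - 1 ≠ 0 := by linarith
          field_simp
          ring
  · have h1 : 0 < μ - 1 := by linarith
    -- This is the radius where `profileBase` reaches 0.
    refine hsplit ((1 / (μ - 1)) ^ (1 / P)) (by positivity) ?_
    rw [setLIntegral_congr_fun (g := fun _ => 0) measurableSet_Ioi ?_]
    · simp
    · intro x hx
      have hR : 0 < (1 / (μ - 1)) ^ (1 / P) := by positivity
      have hx0 : 0 < x := hR.trans hx
      have h2 : 1 / (μ - 1) < x ^ P := by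
        have := Real.rpow_lt_rpow hR.le hx hP
        rwa [← Real.rpow_mul (by positivity), one_div_mul_cancel hP.ne', Real.rpow_one] at this
      rw [div_lt_iff₀ h1] at h2
      have hb : profileBase P μ x ≤ 0 := by
        rw [profileBase, abs_of_pos hx0]
        linarith
      simp only
      rw [profile_eq hμ, max_eq_right hb, Real.zero_rpow (by positivity), mul_zero,
        ENNReal.ofReal_zero]

/-- Differentiating lowers the exponent of the base to `1/(μ-1) - 1 = (2-μ)/(μ-1)`, which is the
power `2 - μ` of the profile. -/
lemma hasDerivAt_profile (hP : 0 < P) (hμ : μ ≠ 1) {x : ℝ} (hx0 : 0 < x)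
    (hx : x ∈ supp (profile P μ)) :
    HasDerivAt (profile P μ) (-(P * x ^ (P - 1) * profile P μ x ^ (2 - μ))) x := by
  have hb := (mem_supp_profile hμ).1 hx
  have hμ' : μ - 1 ≠ 0 := sub_ne_zero.2 hμ
  have h1 : HasDerivAt (fun y : ℝ => 1 - (μ - 1) * y ^ P) (-((μ - 1) * (P * x ^ (P - 1)))) x := by
    simpa using (((Real.hasDerivAt_rpow_const (p := P) (Or.inl hx0.ne')).const_mul
      (μ - 1)).const_sub 1)
  have hbx : 1 - (μ - 1) * x ^ P = profileBase P μ x := by rw [profileBase, abs_of_pos hx0]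
  have h2 := h1.rpow_const (p := 1 / (μ - 1)) (Or.inl (by rw [hbx]; exact hb.ne'))
  have h3 : HasDerivAt (profile P μ) _ x := h2.congr_of_eventuallyEq (by
    filter_upwards [(isOpen_supp_profile hP hμ).mem_nhds hx, lt_mem_nhds hx0] with y hy hy0
    rw [profile_eq hμ, max_eq_left ((mem_supp_profile hμ).1 hy).le, profileBase, abs_of_pos hy0])
  convert h3 using 1
  rw [hbx, profile_eq hμ, max_eq_left hb.le, ← Real.rpow_mul hb.le,
    show 1 / (μ - 1) * (2 - μ) = 1 / (μ - 1) - 1 by field_simp; ring]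
  field_simp

/-- For `x > 0` the derivative of `x ψ^μ`, with `ψ` the profile, is `ψ^μ - μ P x^P ψ`. The boundary
term at the right end is nonnegative and may be dropped, so no decay has to be checked; only this
direction is needed. -/
lemma profile_integration_by_parts (hP : 0 < P) (hμ : μ ≠ 1) (hμ0 : 0 < μ) :
    ENNReal.ofReal (μ * P) * ∫⁻ x in supp (profile P μ), ENNReal.ofReal (|x| ^ P * profile P μ x) ≤
      ∫⁻ x in supp (profile P μ), ENNReal.ofReal (profile P μ x ^ μ) := by
  have hc := continuous_profile hP hμ
  have hoc := ordConnected_supp_profile hP hμ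
  have hcμ : Continuous fun x => profile P μ x ^ μ := hc.rpow_const fun _ => Or.inr hμ0.le
  rw [setLIntegral_eq_two_mul_of_even neg_mem_supp_profile (by simp [profile_neg]),
    setLIntegral_eq_two_mul_of_even neg_mem_supp_profile (by simp [profile_neg]), mul_left_comm]
  refine mul_le_mul_right ?_ _
  rw [← lintegral_const_mul' _ _ ENNReal.ofReal_ne_top]
  have hz := zero_mem_supp_profile hP hμ
  rw [← zero_add (∫⁻ x in _, _)]
  refine setLIntegral_inter_Ioi_le (isOpen_supp_profile hP hμ) hoc hz zero_le fun b hb hb0 => ?_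
  rw [zero_add]
  have hcP : Continuous fun x => μ * P * (|x| ^ P * profile P μ x) :=
    continuous_const.mul ((continuous_abs.rpow_const fun _ => Or.inr hP.le).mul hc)
  have hftc := intervalIntegral.integral_eq_sub_of_hasDerivAt_of_le hb0
    (f := fun x => x * profile P μ x ^ μ)
    (f' := fun x => profile P μ x ^ μ - μ * P * (|x| ^ P * profile P μ x))
    (continuous_id.mul hcμ).continuousOn (fun x hx => ?_)
    ((hcμ.sub hcP).intervalIntegrable _ _)
  · rw [intervalIntegral.integral_sub (hcμ.intervalIntegrable _ _)
      (hcP.intervalIntegrable _ _), zero_mul, sub_zero] at hftc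
    have h1 : 0 ≤ b * profile P μ b ^ μ := mul_nonneg hb0 (Real.rpow_nonneg (profile_nonneg hμ b) _)
    have h2 : ∫ x in 0..b, μ * P * (|x| ^ P * profile P μ x) ≤ ∫ x in 0..b, profile P μ x ^ μ := by
      linarith
    rw [intervalIntegral.integral_of_le hb0, intervalIntegral.integral_of_le hb0] at h2
    have e1 : ∫⁻ x in Ioc 0 b, ENNReal.ofReal (μ * P) * ENNReal.ofReal (|x| ^ P * profile P μ x) =
        ENNReal.ofReal (∫ x in Ioc 0 b, μ * P * (|x| ^ P * profile P μ x)) := by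
      rw [ofReal_integral_eq_lintegral_ofReal hcP.integrableOn_Ioc (ae_of_all _ fun x =>
        mul_nonneg (by positivity) (mul_nonneg (Real.rpow_nonneg (abs_nonneg _) _)
          (profile_nonneg hμ x)))]
      exact lintegral_congr fun x => (ENNReal.ofReal_mul (by positivity)).symm
    rw [e1]
    refine (ENNReal.ofReal_le_ofReal h2).trans ?_
    rw [ofReal_integral_eq_lintegral_ofReal hcμ.integrableOn_Ioc (ae_of_all _ fun x =>
      Real.rpow_nonneg (profile_nonneg hμ x) _)]
    exact lintegral_mono_set fun x hx => ⟨hoc.out hz hb ⟨hx.1.le, hx.2⟩, hx.1⟩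
  · have hxS := hoc.out hz hb ⟨hx.1.le, hx.2.le⟩
    have hpos : 0 < profile P μ x := hxS
    have := (hasDerivAt_id x).mul ((hasDerivAt_profile hP hμ hx.1 hxS).rpow_const (p := μ)
      (Or.inl hpos.ne'))
    have e2 : profile P μ x ^ (2 - μ) * profile P μ x ^ (μ - 1) = profile P μ x := by
      rw [← Real.rpow_add hpos]
      ring_nf
      rw [Real.rpow_one]
    have e3 : x * x ^ (P - 1) = x ^ P := by
      rw [mul_comm, ← Real.rpow_add_one hx.1.ne', sub_add_cancel]
    refine this.congr_deriv ?_
    simp only [id]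
    rw [abs_of_pos hx.1]
    linear_combination (-(μ * P * profile P μ x)) * e3 + (-(x * P * x ^ (P - 1) * μ)) * e2

end Profile

/-! ### Generalized Gaussians -/

section Gauss

variable {p μ : ℝ}

lemma lintegral_profile_line_ne_top {P : ℝ} (hP : 0 < P) (hμ : μ ≠ 1) (hμP : 1 < μ * (1 + P)) :
    ∫⁻ x, ENNReal.ofReal ((1 + |x| ^ P) * profile P μ x) ≠ ∞ := by
  rw [← setLIntegral_univ, setLIntegral_eq_two_mul_of_even (by simp) (by simp [profile_neg]),
    univ_inter]
  exact ENNReal.mul_ne_top (by simp) (lintegral_profile_ne_top hP hμ hμP)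

lemma integrable_profile {P : ℝ} (hP : 0 < P) (hμ : μ ≠ 1) (hμP : 1 < μ * (1 + P)) :
    Integrable (profile P μ) := by
  refine ⟨(continuous_profile hP hμ).aestronglyMeasurable, ?_⟩
  rw [hasFiniteIntegral_iff_ofReal (ae_of_all _ (profile_nonneg hμ))]
  refine (lintegral_mono fun x => ENNReal.ofReal_le_ofReal ?_).trans_lt
    (lintegral_profile_line_ne_top hP hμ hμP).lt_top
  have h1 : 0 ≤ |x| ^ P := Real.rpow_nonneg (abs_nonneg _) _
  nlinarith [profile_nonneg (P := P) hμ x]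

lemma integral_profile_pos {P : ℝ} (hP : 0 < P) (hμ : μ ≠ 1) (hμP : 1 < μ * (1 + P)) :
    0 < ∫ x, profile P μ x := by
  refine integral_pos_of_integrable_nonneg_nonzero (continuous_profile hP hμ)
    (integrable_profile hP hμ hμP) (profile_nonneg hμ) (x := 0) ?_
  exact ne_of_gt (zero_mem_supp_profile hP hμ)

lemma gauss_eq (x : ℝ) :
    gauss p μ x = profile (pstar p) μ x / ∫ y, profile (pstar p) μ y := rfl

lemma gauss_neg (x : ℝ) : gauss p μ (-x) = gauss p μ x := by
  rw [gauss_eq, gauss_eq, profile_neg]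

lemma supp_gauss (hP : 0 < pstar p) (hμ : μ ≠ 1) (hμP : 1 < μ * (1 + pstar p)) : supp (gauss p μ) = supp (profile (pstar p) μ) := by
  ext x
  rw [supp, supp, mem_ofPred_eq, mem_ofPred_eq, gauss_eq,
    div_pos_iff_of_pos_right (integral_profile_pos hP hμ hμP)]

lemma gauss_nonneg (hP : 0 < pstar p) (hμ : μ ≠ 1) (hμP : 1 < μ * (1 + pstar p))
    (x : ℝ) : 0 ≤ gauss p μ x := by
  rw [gauss_eq]
  exact div_nonneg (profile_nonneg hμ x) (integral_profile_pos hP hμ hμP).le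

lemma continuous_gauss (hP : 0 < pstar p) (hμ : μ ≠ 1) : Continuous (gauss p μ) :=
  (continuous_profile hP hμ).div_const _

lemma isIntervalDensity_gauss (hP : 0 < pstar p) (hμ : μ ≠ 1) (hμP : 1 < μ * (1 + pstar p)) : IsIntervalDensity (gauss p μ) where
  nonneg := gauss_nonneg hP hμ hμP
  cont := (continuous_gauss hP hμ).continuousOn
  isOpen := isOpen_lt continuous_const (continuous_gauss hP hμ)
  ordConnected := by
    rw [supp_gauss hP hμ hμP]
    exact ordConnected_supp_profile hP hμ
  mass := by
    have hZ := integral_profile_pos hP hμ hμP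
    have hi : Integrable (gauss p μ) := (integrable_profile hP hμ hμP).div_const _
    rw [← ofReal_integral_eq_lintegral_ofReal hi (ae_of_all _ (gauss_nonneg hP hμ hμP)),
      ← ENNReal.ofReal_one]
    simp only [gauss_eq]
    rw [integral_div, div_self hZ.ne']

lemma gauss_moment_ne_top (hP : 0 < pstar p) (hμ : μ ≠ 1) (hμP : 1 < μ * (1 + pstar p)) :
    ∫⁻ x in supp (gauss p μ), ENNReal.ofReal (|x| ^ pstar p) * ENNReal.ofReal (gauss p μ x) ≠ ∞ := by
  have hZ := integral_profile_pos hP hμ hμP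
  refine ne_top_of_le_ne_top (ENNReal.mul_ne_top (ENNReal.ofReal_ne_top
    (r := (∫ y, profile (pstar p) μ y)⁻¹)) (lintegral_profile_line_ne_top hP hμ hμP)) ?_
  rw [← lintegral_const_mul' _ _ ENNReal.ofReal_ne_top]
  refine (setLIntegral_le_lintegral _ _).trans (lintegral_mono fun x => ?_)
  have h1 : 0 ≤ |x| ^ pstar p := Real.rpow_nonneg (abs_nonneg _) _
  rw [← ENNReal.ofReal_mul h1, ← ENNReal.ofReal_mul (inv_nonneg.2 hZ.le), gauss_eq]
  refine ENNReal.ofReal_le_ofReal ?_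
  rw [div_eq_inv_mul, mul_left_comm]
  refine mul_le_mul_of_nonneg_left ?_ (inv_nonneg.2 hZ.le)
  nlinarith [profile_nonneg (P := pstar p) hμ x]

lemma gauss_moment_ne_zero (hP : 0 < pstar p) (hμ : μ ≠ 1) (hμP : 1 < μ * (1 + pstar p)) :
    ∫⁻ x in supp (gauss p μ), ENNReal.ofReal (|x| ^ pstar p) * ENNReal.ofReal (gauss p μ x) ≠ 0 := by
  have H := isIntervalDensity_gauss hP hμ hμP
  intro h0
  have hm : Measurable fun x => ENNReal.ofReal (|x| ^ pstar p) * ENNReal.ofReal (gauss p μ x) :=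
    ((measurable_id.abs).pow_const _).ennreal_ofReal.mul H.measurable.ennreal_ofReal
  rw [lintegral_eq_zero_iff hm, EventuallyEq, ae_restrict_iff' H.isOpen.measurableSet] at h0
  have : volume (supp (gauss p μ)) = 0 := by
    rw [measure_eq_zero_iff_ae_notMem]
    filter_upwards [h0, Measure.ae_ne volume 0] with x hx hx0 hxs
    have h2 : 0 < |x| ^ pstar p := Real.rpow_pos_of_pos (abs_pos.2 hx0) _
    have := hx hxs
    simp only [Pi.zero_apply, mul_eq_zero, ENNReal.ofReal_eq_zero] at this
    rcases this with h | h
    · exact absurd h2 (not_lt.2 h)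
    · exact absurd hxs (not_lt.2 h)
  exact (H.isOpen.measure_pos volume H.supp_nonempty).ne' this

/-- On the support `ψ^μ = ψ * profileBase`, and the base is at most `(1 + |μ-1|) (1 + |x|^P)`;
finite mass and moment therefore suffice. -/
lemma gauss_rpow_ne_top (hP : 0 < pstar p) (hμ : μ ≠ 1) (hμP : 1 < μ * (1 + pstar p)) : ∫⁻ x in supp (gauss p μ), ENNReal.ofReal (gauss p μ x ^ μ) ≠ ∞ := by
  have hZ := integral_profile_pos hP hμ hμP
  have hc : 0 < (∫ y, profile (pstar p) μ y) ^ μ := Real.rpow_pos_of_pos hZ _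
  have hC : 0 ≤ (1 + |μ - 1|) / (∫ y, profile (pstar p) μ y) ^ μ := by positivity
  refine ne_top_of_le_ne_top (ENNReal.mul_ne_top (ENNReal.ofReal_ne_top
    (r := (1 + |μ - 1|) / (∫ y, profile (pstar p) μ y) ^ μ))
    (lintegral_profile_line_ne_top hP hμ hμP)) ?_
  rw [← lintegral_const_mul' _ _ ENNReal.ofReal_ne_top]
  refine (setLIntegral_mono' (isIntervalDensity_gauss hP hμ hμP).isOpen.measurableSet
    fun x hx => ?_).trans (setLIntegral_le_lintegral _ _)
  rw [supp_gauss hP hμ hμP] at hx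
  have hpos : 0 < profile (pstar p) μ x := hx
  rw [← ENNReal.ofReal_mul hC]
  refine ENNReal.ofReal_le_ofReal ?_
  rw [gauss_eq, Real.div_rpow hpos.le hZ.le, div_mul_eq_mul_div]
  refine div_le_div_of_nonneg_right ?_ hc.le
  have h1 : 0 ≤ |x| ^ pstar p := Real.rpow_nonneg (abs_nonneg _) _
  rw [show profile (pstar p) μ x ^ μ = profile (pstar p) μ x ^ ((μ - 1) + 1) by ring_nf,
    Real.rpow_add_one hpos.ne', profile_rpow_sub_one hμ hx, ← mul_assoc]
  refine mul_le_mul_of_nonneg_right ?_ hpos.le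
  rw [profileBase]
  nlinarith [neg_abs_le (μ - 1), abs_nonneg (μ - 1)]

/-- Normalizing by `Z` scales the moment by `Z^(-1)` and the Rényi integral by `Z^(-μ)`, whence
`Z^(1-μ)`. The factor is grouped so that its power `p` is the constant in `F_gauss`. -/
lemma gauss_integration_by_parts (hP : 0 < pstar p) (hμ : μ ≠ 1) (hμP : 1 < μ * (1 + pstar p))
    (hμ0 : 0 < μ) :
    ENNReal.ofReal μ * (ENNReal.ofReal (pstar p * (∫ y, profile (pstar p) μ y) ^ (1 - μ)) *
      ∫⁻ x in supp (gauss p μ), ENNReal.ofReal (|x| ^ pstar p) * ENNReal.ofReal (gauss p μ x)) ≤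
      ∫⁻ x in supp (gauss p μ), ENNReal.ofReal (gauss p μ x ^ μ) := by
  have hZ := integral_profile_pos hP hμ hμP
  have key := profile_integration_by_parts hP hμ hμ0
  set Z := ∫ y, profile (pstar p) μ y with hZdef
  have hZμ : 0 < Z ^ (-μ) := Real.rpow_pos_of_pos hZ _
  have e1 : ∫⁻ x in supp (gauss p μ), ENNReal.ofReal (gauss p μ x ^ μ) = ENNReal.ofReal (Z ^ (-μ)) *
      ∫⁻ x in supp (profile (pstar p) μ), ENNReal.ofReal (profile (pstar p) μ x ^ μ) := by
    rw [supp_gauss hP hμ hμP, ← lintegral_const_mul' _ _ ENNReal.ofReal_ne_top]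
    refine lintegral_congr fun x => ?_
    rw [← ENNReal.ofReal_mul hZμ.le, gauss_eq, Real.div_rpow (profile_nonneg hμ x) hZ.le,
      Real.rpow_neg hZ.le, div_eq_inv_mul]
  have e2 : ∫⁻ x in supp (gauss p μ), ENNReal.ofReal (|x| ^ pstar p) * ENNReal.ofReal (gauss p μ x) =
      ENNReal.ofReal Z⁻¹ * ∫⁻ x in supp (profile (pstar p) μ),
        ENNReal.ofReal (|x| ^ pstar p * profile (pstar p) μ x) := by
    rw [supp_gauss hP hμ hμP, ← lintegral_const_mul' _ _ ENNReal.ofReal_ne_top]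
    refine lintegral_congr fun x => ?_
    have h1 : 0 ≤ |x| ^ pstar p := Real.rpow_nonneg (abs_nonneg _) _
    rw [← ENNReal.ofReal_mul (inv_nonneg.2 hZ.le), ← ENNReal.ofReal_mul h1, gauss_eq, ← hZdef]
    congr 1
    ring
  rw [e1, e2]
  refine le_trans (le_of_eq ?_) (mul_le_mul_right key _)
  rw [← mul_assoc, ← mul_assoc, ← mul_assoc, ← ENNReal.ofReal_mul hμ0.le,
    ← ENNReal.ofReal_mul (by positivity), ← ENNReal.ofReal_mul hZμ.le]
  congr 2
  rw [show 1 - μ = -μ + 1 by ring, Real.rpow_add_one hZ.ne']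
  field_simp

/-- Away from the origin `|g^(μ-2) g'| = p* Z^(1-μ) |x|^(p*-1)`, and `(p* - 1) p = p*`: the Fisher
information of the Gaussian is a multiple of its moment of order `p*`. -/
lemma F_gauss (hP : 0 < pstar p) (hμ : μ ≠ 1) (hμP : 1 < μ * (1 + pstar p))
    (hp : 1 < p) : F p μ (gauss p μ) =
    ENNReal.ofReal (pstar p * (∫ y, profile (pstar p) μ y) ^ (1 - μ)) ^ p *
      ∫⁻ x in supp (gauss p μ), ENNReal.ofReal (|x| ^ pstar p) * ENNReal.ofReal (gauss p μ x) := by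
  have hZ := integral_profile_pos hP hμ hμP
  have hp0 : 0 < p := by linarith
  have hpp : (pstar p - 1) * p = pstar p := by
    have : p - 1 ≠ 0 := by linarith
    rw [pstar]
    field_simp
    ring
  set Z := ∫ y, profile (pstar p) μ y with hZdef
  have hZμ : 0 < Z ^ (1 - μ) := Real.rpow_pos_of_pos hZ _
  have hd : ∀ x, 0 < x → x ∈ supp (gauss p μ) →
      |gauss p μ x ^ (μ - 2) * deriv (gauss p μ) x| = pstar p * Z ^ (1 - μ) * x ^ (pstar p - 1) := by
    intro x hx0 hx
    rw [supp_gauss hP hμ hμP] at hx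
    have hpos : 0 < profile (pstar p) μ x := hx
    have h1 : HasDerivAt (gauss p μ) _ x := (hasDerivAt_profile hP hμ hx0 hx).div_const Z
    have h2 : 0 < x ^ (pstar p - 1) := Real.rpow_pos_of_pos hx0 _
    rw [h1.deriv, gauss_eq, ← hZdef, Real.div_rpow hpos.le hZ.le, neg_div, mul_neg, abs_neg,
      abs_of_nonneg (by positivity), show μ - 2 = -(2 - μ) by ring, Real.rpow_neg hpos.le,
      Real.rpow_neg hZ.le, show 2 - μ = (1 - μ) + 1 by ring, Real.rpow_add_one hZ.ne']
    have := (Real.rpow_pos_of_pos hpos (1 - μ + 1)).ne'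
    field_simp
  have hd' : ∀ x, x ≠ 0 → x ∈ supp (gauss p μ) →
      |gauss p μ x ^ (μ - 2) * deriv (gauss p μ) x| =
        pstar p * Z ^ (1 - μ) * |x| ^ (pstar p - 1) := by
    intro x hx0 hx
    rcases lt_or_gt_of_ne hx0 with h | h
    · have hneg : deriv (gauss p μ) (-x) = -deriv (gauss p μ) x := by
        have h3 := deriv_comp_neg (gauss p μ) x
        rw [show (fun x => gauss p μ (-x)) = gauss p μ from funext gauss_neg] at h3
        linarith
      have := hd (-x) (by linarith) (by rwa [supp, mem_ofPred_eq, gauss_neg])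
      rwa [gauss_neg, hneg, mul_neg, abs_neg, ← abs_of_neg h] at this
    · rw [hd x h hx, abs_of_pos h]
  rw [F, ← lintegral_const_mul' _ _ (ENNReal.rpow_ne_top_of_nonneg hp0.le ENNReal.ofReal_ne_top)]
  refine lintegral_congr_ae ((ae_restrict_iff'
    (isIntervalDensity_gauss hP hμ hμP).isOpen.measurableSet).2 ?_)
  filter_upwards [Measure.ae_ne volume 0] with x hx0 hx
  rw [hd' x hx0 hx, ENNReal.ofReal_mul (by positivity), ENNReal.mul_rpow_of_nonneg _ _ hp0.le,
    mul_assoc, ENNReal.ofReal_rpow_of_nonneg (Real.rpow_nonneg (abs_nonneg _) _) hp0.le,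
    ← Real.rpow_mul (abs_nonneg _), hpp]

end Gauss

/-! ### The bi-parametric Stam inequality -/

lemma one_lt_mul_pos {P μ : ℝ} (hP : 0 < P) (h : 1 < μ * (1 + P)) : 0 < μ := by
  by_contra hn
  nlinarith

lemma pstar_pos {p : ℝ} (hp : 1 < p) : 0 < pstar p := div_pos (by linarith) (by linarith)

lemma N_of_ne_one {μ : ℝ} (hμ : μ ≠ 1) (h : ℝ → ℝ) :
    N μ h = (∫⁻ x in supp h, ENNReal.ofReal (h x ^ μ)) ^ (1 / (1 - μ)) := if_neg hμ

lemma ENNReal_rpow_ne_zero {x : ℝ≥0∞} (h0 : x ≠ 0) (ht : x ≠ ∞) (y : ℝ) : x ^ y ≠ 0 :=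
  (ENNReal.rpow_pos (pos_iff_ne_zero.2 h0) ht).ne'

lemma ENNReal_rpow_ne_top {x : ℝ≥0∞} (h0 : x ≠ 0) (ht : x ≠ ∞) (y : ℝ) : x ^ y ≠ ∞ :=
  ENNReal.rpow_ne_top_of_ne_zero h0 ht

lemma ENNReal_rpow_le_rpow_of_nonpos {x y : ℝ≥0∞} {z : ℝ} (hz : z ≤ 0) (hxy : x ≤ y) :
    y ^ z ≤ x ^ z := by
  rw [← neg_neg z, ENNReal.rpow_neg y, ENNReal.rpow_neg x, ENNReal.inv_le_inv]
  exact ENNReal.rpow_le_rpow hxy (neg_nonneg.2 hz)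

lemma stamConst_pos_lt_top {p μ : ℝ} (hp : 1 < p) (hμ : μ ≠ 1) (hμP : 1 < μ * (1 + pstar p)) :
    stamConst p μ ≠ 0 ∧ stamConst p μ ≠ ∞ := by
  have hP := pstar_pos hp
  have hZ := integral_profile_pos hP hμ hμP
  have h1 : F p μ (gauss p μ) ≠ 0 := by
    rw [F_gauss hP hμ hμP hp]
    refine mul_ne_zero (ENNReal_rpow_ne_zero ?_ ENNReal.ofReal_ne_top _)
      (gauss_moment_ne_zero hP hμ hμP)
    exact (ENNReal.ofReal_pos.2 (by positivity)).ne'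
  have h2 : F p μ (gauss p μ) ≠ ∞ := by
    rw [F_gauss hP hμ hμP hp]
    exact ENNReal.mul_ne_top (ENNReal.rpow_ne_top_of_nonneg (by linarith) ENNReal.ofReal_ne_top)
      (gauss_moment_ne_top hP hμ hμP)
  have h3 := lintegral_rpow_pos (isIntervalDensity_gauss hP hμ hμP) μ
  have h4 := gauss_rpow_ne_top hP hμ hμP
  rw [stamConst, if_neg hp.ne', N_of_ne_one hμ, phi]
  exact ⟨mul_ne_zero (ENNReal_rpow_ne_zero h1 h2 _) (ENNReal_rpow_ne_zero h3 h4 _),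
    ENNReal.mul_ne_top (ENNReal_rpow_ne_top h1 h2 _) (ENNReal_rpow_ne_top h3 h4 _)⟩

/-- The transport bound contains `μ F[h]^(1/p) m^(1-1/p)`, with `m` the moment of the Gaussian.
Replacing `F[h]` by the Fisher information `c^p m` of the Gaussian gives `μ c m`, which is at most
its Rényi integral `G` by `gauss_integration_by_parts`. -/
theorem stam_of_one_lt {h : ℝ → ℝ} (H : IsACDensity h) {p μ : ℝ} (hp : 1 < p) (hμ : μ ≠ 1)
    (hμP : 1 < μ * (1 + pstar p)) (hE : ∫⁻ x in supp h, ENNReal.ofReal (h x ^ μ) ≠ ∞) :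
    stamConst p μ ≤ phi p μ h * N μ h := by
  have hP := pstar_pos hp
  have hμ0 := one_lt_mul_pos hP hμP
  have hZ := integral_profile_pos hP hμ hμP
  have hp0 : 0 < p := by linarith
  have h1μ : 1 - μ ≠ 0 := fun h => hμ (by linarith)
  have key := rpow_le_rpow_mul_F H (isIntervalDensity_gauss hP hμ hμP)
    (by rw [supp_gauss hP hμ hμP]; exact zero_mem_supp_profile hP hμ) hp hμ0 hμ hE
    (gauss_rpow_ne_top hP hμ hμP)
  have hibp := gauss_integration_by_parts hP hμ hμP hμ0
  have hm0 := gauss_moment_ne_zero hP hμ hμP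
  have hmt := gauss_moment_ne_top hP hμ hμP
  have hG0 := lintegral_rpow_pos (isIntervalDensity_gauss hP hμ hμP) μ
  have hGt := gauss_rpow_ne_top hP hμ hμP
  rw [stamConst, if_neg hp.ne', N_of_ne_one hμ, N_of_ne_one hμ, phi, phi, F_gauss hP hμ hμP hp,
    ← ENNReal.rpow_le_rpow_iff hμ0, ENNReal.mul_rpow_of_nonneg _ _ hμ0.le,
    ENNReal.mul_rpow_of_nonneg _ _ hμ0.le, ← ENNReal.rpow_mul, ← ENNReal.rpow_mul,
    ← ENNReal.rpow_mul, ← ENNReal.rpow_mul, show 1 / (p * μ) * μ = 1 / p by field_simp,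
    show 1 / (1 - μ) * μ = μ / (1 - μ) by ring, ENNReal.mul_rpow_of_nonneg _ _ (by positivity),
    ← ENNReal.rpow_mul, mul_one_div_cancel hp0.ne', ENNReal.rpow_one]
  set m := ∫⁻ x in supp (gauss p μ), ENNReal.ofReal (|x| ^ pstar p) * ENNReal.ofReal (gauss p μ x)
  set c := ENNReal.ofReal (pstar p * (∫ y, profile (pstar p) μ y) ^ (1 - μ))
  set G := ∫⁻ x in supp (gauss p μ), ENNReal.ofReal (gauss p μ x ^ μ)
  set E := ∫⁻ x in supp h, ENNReal.ofReal (h x ^ μ)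
  have hG : G ^ (1 / (1 - μ)) = G * G ^ (μ / (1 - μ)) := by
    nth_rw 2 [← ENNReal.rpow_one G]
    rw [← ENNReal.rpow_add _ _ hG0 hGt]
    congr 1
    field_simp
    ring
  have hmm : m = m ^ (1 - 1 / p) * m ^ (1 / p) := by
    rw [← ENNReal.rpow_add _ _ hm0 hmt, sub_add_cancel, ENNReal.rpow_one]
  have hk0 : ENNReal.ofReal μ * m ^ (1 - 1 / p) ≠ 0 :=
    mul_ne_zero (ENNReal.ofReal_pos.2 hμ0).ne' (ENNReal_rpow_ne_zero hm0 hmt _)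
  have hkt : ENNReal.ofReal μ * m ^ (1 - 1 / p) ≠ ∞ :=
    ENNReal.mul_ne_top ENNReal.ofReal_ne_top (ENNReal_rpow_ne_top hm0 hmt _)
  -- The claim, raised to the power `μ`, reads `c m^(1/p) G^(μ/(1-μ)) ≤ F^(1/p) E^(μ/(1-μ))`.
  -- Multiplying by `μ m^(1-1/p)` completes the left side to `μ c m` and turns the right side into
  -- that of `key`.
  refine (ENNReal.mul_le_mul_iff_right hk0 hkt).1 ?_
  calc ENNReal.ofReal μ * m ^ (1 - 1 / p) * (c * m ^ (1 / p) * G ^ (μ / (1 - μ)))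
      = ENNReal.ofReal μ * (c * (m ^ (1 - 1 / p) * m ^ (1 / p))) * G ^ (μ / (1 - μ)) := by ring
    _ ≤ G * G ^ (μ / (1 - μ)) := by
        rw [← hmm]
        exact mul_le_mul_left hibp _
    _ ≤ _ := by
        rw [← hG]
        refine key.trans (le_of_eq ?_)
        ring

/-! ### The case `p = 1`: from a uniform bound to the Rényi power. -/

lemma lintegral_rpow_eq_lintegral_mul {h : ℝ → ℝ} (H : IsIntervalDensity h) (μ : ℝ) :
    ∫⁻ x in supp h, ENNReal.ofReal (h x ^ μ) =
      ∫⁻ x in supp h, ENNReal.ofReal (h x ^ (μ - 1)) * ENNReal.ofReal (h x) := by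
  refine setLIntegral_congr_fun H.isOpen.measurableSet fun x hx => ?_
  have hpos : 0 < h x := hx
  rw [← ENNReal.ofReal_mul (Real.rpow_nonneg hpos.le _), ← Real.rpow_add_one hpos.ne',
    sub_add_cancel]

lemma lintegral_rpow_le_of_bound {h : ℝ → ℝ} (H : IsIntervalDensity h) {μ K : ℝ} (hμ : 1 < μ)
    (hK : ∀ x ∈ supp h, h x ≤ K) :
    ∫⁻ x in supp h, ENNReal.ofReal (h x ^ μ) ≤ ENNReal.ofReal (K ^ (μ - 1)) := by
  rw [lintegral_rpow_eq_lintegral_mul H]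
  calc _ ≤ ∫⁻ x in supp h, ENNReal.ofReal (K ^ (μ - 1)) * ENNReal.ofReal (h x) :=
        setLIntegral_mono' H.isOpen.measurableSet fun x hx => mul_le_mul_left
          (ENNReal.ofReal_le_ofReal (Real.rpow_le_rpow (H.nonneg x) (hK x hx) (by linarith))) _
    _ = _ := by
        rw [lintegral_const_mul' _ _ ENNReal.ofReal_ne_top, H.lintegral_supp, mul_one]

lemma le_lintegral_rpow_of_bound {h : ℝ → ℝ} (H : IsIntervalDensity h) {μ K : ℝ} (hμ : μ < 1)
    (hK : ∀ x ∈ supp h, h x ≤ K) :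
    ENNReal.ofReal (K ^ (μ - 1)) ≤ ∫⁻ x in supp h, ENNReal.ofReal (h x ^ μ) := by
  rw [lintegral_rpow_eq_lintegral_mul H]
  calc _ = ∫⁻ x in supp h, ENNReal.ofReal (K ^ (μ - 1)) * ENNReal.ofReal (h x) := by
        rw [lintegral_const_mul' _ _ ENNReal.ofReal_ne_top, H.lintegral_supp, mul_one]
    _ ≤ _ := setLIntegral_mono' H.isOpen.measurableSet fun x hx => mul_le_mul_left
          (ENNReal.ofReal_le_ofReal (Real.rpow_le_rpow_of_nonpos hx (hK x hx) (by linarith))) _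

lemma IsACDensity.le_of_F_ne_top {h : ℝ → ℝ} (H : IsACDensity h) {p μ : ℝ} (hp : 1 ≤ p)
    (hμ : 0 < μ) (hF : F p μ h ≠ ∞) {x : ℝ} (hx : x ∈ supp h) :
    h x ≤ (μ * (F p μ h ^ (1 / p)).toReal / 2) ^ (1 / μ) := by
  have hpos : 0 < h x := hx
  have hp0 : 0 < p := by linarith
  have key := H.two_mul_rpow_le hμ hp hx
  have ht : ENNReal.ofReal μ * F p μ h ^ (1 / p) ≠ ∞ :=
    ENNReal.mul_ne_top ENNReal.ofReal_ne_top (ENNReal.rpow_ne_top_of_nonneg (by positivity) hF)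
  have h2 := ENNReal.toReal_mono ht key
  rw [ENNReal.toReal_mul, ENNReal.toReal_mul, ENNReal.toReal_ofReal hμ.le,
    ENNReal.toReal_ofReal (Real.rpow_nonneg hpos.le _), ENNReal.toReal_ofNat] at h2
  calc h x = (h x ^ μ) ^ (1 / μ) := by
        rw [← Real.rpow_mul hpos.le, mul_one_div_cancel hμ.ne', Real.rpow_one]
    _ ≤ _ := Real.rpow_le_rpow (Real.rpow_nonneg hpos.le _) (by linarith) (by positivity)

/-- If `h ≤ K` then `N_μ[h] ≥ 1/K` on either side of `μ = 1`. The total variation bound allows `K^μ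
= μ F / 2`, and `F^(1/μ) / K = (2/μ)^(1/μ)`. -/
theorem stam_one {h : ℝ → ℝ} (H : IsACDensity h) {μ : ℝ} (hμ0 : 0 < μ) (hμ : μ ≠ 1)
    (hE : ∫⁻ x in supp h, ENNReal.ofReal (h x ^ μ) ≠ ∞) :
    stamConst 1 μ ≤ phi 1 μ h * N μ h := by
  have hE0 := lintegral_rpow_pos H.toIsIntervalDensity μ
  rw [stamConst, if_pos rfl, N_of_ne_one hμ, phi, one_mul]
  by_cases hF : F 1 μ h = ∞
  · rw [hF, ENNReal.top_rpow_of_pos (by positivity),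
      ENNReal.top_mul (ENNReal_rpow_ne_zero hE0 hE _)]
    exact le_top
  have hF0 := H.F_ne_zero (p := 1) hμ0 le_rfl
  set a := (F 1 μ h).toReal with ha
  have hapos : 0 < a := ENNReal.toReal_pos hF0 hF
  have hbd : ∀ x ∈ supp h, h x ≤ (μ * a / 2) ^ (1 / μ) := fun x hx => by
    have := H.le_of_F_ne_top le_rfl hμ0 hF hx
    rwa [div_one, ENNReal.rpow_one, ← ha] at this
  set K := (μ * a / 2) ^ (1 / μ) with hKdef
  have hK : 0 < K := by positivity
  have hN : ENNReal.ofReal K⁻¹ ≤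
      (∫⁻ x in supp h, ENNReal.ofReal (h x ^ μ)) ^ (1 / (1 - μ)) := by
    have e : ENNReal.ofReal K⁻¹ = ENNReal.ofReal (K ^ (μ - 1)) ^ (1 / (1 - μ)) := by
      have h1μ : 1 - μ ≠ 0 := fun h => hμ (by linarith)
      rw [ENNReal.ofReal_rpow_of_pos (by positivity), ← Real.rpow_mul hK.le,
        show (μ - 1) * (1 / (1 - μ)) = -1 by field_simp; ring, Real.rpow_neg_one]
    rw [e]
    rcases lt_or_gt_of_ne hμ with h1 | h1
    · exact ENNReal.rpow_le_rpow (le_lintegral_rpow_of_bound H.toIsIntervalDensity h1 hbd)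
        (one_div_nonneg.2 (by linarith))
    · exact ENNReal_rpow_le_rpow_of_nonpos (one_div_nonpos.2 (by linarith))
        (lintegral_rpow_le_of_bound H.toIsIntervalDensity h1 hbd)
  refine le_trans (le_of_eq ?_) (mul_le_mul_right hN _)
  rw [← ENNReal.ofReal_toReal hF, ← ha, ENNReal.ofReal_rpow_of_pos hapos,
    ← ENNReal.ofReal_mul (by positivity), hKdef, ← Real.inv_rpow (by positivity),
    ← Real.mul_rpow hapos.le (by positivity)]
  congr 2
  field_simp

/-! ### The down transform -/

namespace IsDecreasingDensity

variable {f : ℝ → ℝ} {xi : ℝ} {xf : EReal} {lam : ℝ}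

lemma supp_eq (hf : IsDecreasingDensity f xi xf) : supp f = interval xi xf := by
  ext x
  constructor
  · intro hx
    by_contra h
    have : 0 < f x := hx
    rw [hf.zero x h] at this
    exact lt_irrefl _ this
  · exact hf.pos x

lemma nonneg (hf : IsDecreasingDensity f xi xf) (x : ℝ) : 0 ≤ f x := by
  by_cases h : x ∈ interval xi xf
  · exact (hf.pos x h).le
  · exact (hf.zero x h).ge

lemma isOpen_supp (hf : IsDecreasingDensity f xi xf) : IsOpen (supp f) := by
  rw [hf.supp_eq]
  exact (isOpen_lt continuous_const continuous_id).inter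
    (isOpen_lt continuous_coe_real_ereal continuous_const)

lemma ordConnected_supp (hf : IsDecreasingDensity f xi xf) : (supp f).OrdConnected := by
  rw [hf.supp_eq]
  refine ⟨fun a ha b hb y hy => ⟨ha.1.trans_le hy.1, lt_of_le_of_lt ?_ hb.2⟩⟩
  exact_mod_cast hy.2

lemma deriv_neg' (hf : IsDecreasingDensity f xi xf) {x : ℝ} (hx : x ∈ supp f) : deriv f x < 0 :=
  hf.deriv_neg x (by rwa [← hf.supp_eq])

/-- Differentiability is implied by `f' < 0`, because `deriv` takes the default value 0 where there
is no derivative. -/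
lemma hasStrictDerivAt (hf : IsDecreasingDensity f xi xf) {x : ℝ} (hx : x ∈ supp f) :
    HasStrictDerivAt f (deriv f x) x := by
  refine hasStrictDerivAt_of_hasDerivAt_of_continuousAt ?_ ?_
  · filter_upwards [hf.isOpen_supp.mem_nhds hx] with y hy
    exact (differentiableAt_of_deriv_ne_zero (hf.deriv_neg' hy).ne).hasDerivAt
  · have h := hf.deriv_cont
    rw [← hf.supp_eq] at h
    exact h.continuousAt (hf.isOpen_supp.mem_nhds hx)

lemma lintegral_supp (hf : IsDecreasingDensity f xi xf) :
    ∫⁻ x in supp f, ENNReal.ofReal (f x) = 1 := by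
  rw [← hf.mass]
  refine setLIntegral_eq_of_support_subset fun x hx => ?_
  by_contra hx'
  rw [hf.supp_eq] at hx'
  simp [hf.zero x hx'] at hx

lemma downMap_eq (hlam : lam ≠ 0) (x : ℝ) : downMap (2 - lam) f x = f x ^ lam / -lam := by
  rw [downMap, if_neg (fun h => hlam (by linarith))]
  congr 1
  · congr 1
    ring
  · ring

lemma abs_mul_downMap (hf : IsDecreasingDensity f xi xf) (hlam : lam ≠ 0) (x : ℝ) :
    |lam * downMap (2 - lam) f x| = f x ^ lam := by
  rw [downMap_eq hlam, div_neg, mul_neg, mul_div_cancel₀ _ hlam, abs_neg,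
    abs_of_nonneg (Real.rpow_nonneg (hf.nonneg x) _)]

lemma hasStrictDerivAt_downMap (hf : IsDecreasingDensity f xi xf) (hlam : lam ≠ 0) {x : ℝ}
    (hx : x ∈ supp f) :
    HasStrictDerivAt (downMap (2 - lam) f) (f x ^ (lam - 1) * -deriv f x) x := by
  have hpos : 0 < f x := hx
  have h := ((Real.hasStrictDerivAt_rpow_const (p := lam) (Or.inl hpos.ne')).comp x
    (hf.hasStrictDerivAt hx)).div_const (-lam)
  rw [show downMap (2 - lam) f = fun y => f y ^ lam / -lam from funext (downMap_eq hlam)]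
  refine h.congr_deriv ?_
  field_simp

lemma deriv_downMap_pos (hf : IsDecreasingDensity f xi xf) {x : ℝ} (hx : x ∈ supp f) :
    0 < f x ^ (lam - 1) * -deriv f x :=
  mul_pos (Real.rpow_pos_of_pos hx _) (neg_pos.2 (hf.deriv_neg' hx))

lemma continuousOn_downMap (hf : IsDecreasingDensity f xi xf) (hlam : lam ≠ 0) :
    ContinuousOn (downMap (2 - lam) f) (supp f) := fun _ hx =>
  (hf.hasStrictDerivAt_downMap hlam hx).hasDerivAt.continuousAt.continuousWithinAt

lemma strictMonoOn_downMap (hf : IsDecreasingDensity f xi xf) (hlam : lam ≠ 0) :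
    StrictMonoOn (downMap (2 - lam) f) (supp f) := by
  refine strictMonoOn_of_deriv_pos hf.ordConnected_supp.convex (hf.continuousOn_downMap hlam)
    fun x hx => ?_
  rw [hf.isOpen_supp.interior_eq] at hx
  rw [(hf.hasStrictDerivAt_downMap hlam hx).hasDerivAt.deriv]
  exact hf.deriv_downMap_pos hx

lemma invFunOn_downMap (hf : IsDecreasingDensity f xi xf) (hlam : lam ≠ 0) {x : ℝ}
    (hx : x ∈ supp f) :
    Function.invFunOn (downMap (2 - lam) f) (supp f) (downMap (2 - lam) f x) = x :=
  (hf.strictMonoOn_downMap hlam).injOn.leftInvOn_invFunOn hx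

lemma hasDerivAt_invFunOn_downMap (hf : IsDecreasingDensity f xi xf) (hlam : lam ≠ 0) {x : ℝ}
    (hx : x ∈ supp f) :
    HasDerivAt (Function.invFunOn (downMap (2 - lam) f) (supp f))
      (f x ^ (lam - 1) * -deriv f x)⁻¹ (downMap (2 - lam) f x) :=
  hasDerivAt_invFunOn hf.isOpen_supp (hf.strictMonoOn_downMap hlam).injOn
    (fun _ hy => hf.hasStrictDerivAt_downMap hlam hy) (fun _ hy => (hf.deriv_downMap_pos hy).ne') hx

lemma down_downMap (hf : IsDecreasingDensity f xi xf) (hlam : lam ≠ 0) {x : ℝ} (hx : x ∈ supp f) :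
    down (2 - lam) f (downMap (2 - lam) f x) = f x ^ (2 - lam) / |deriv f x| := by
  rw [down, if_pos (mem_image_of_mem _ hx), hf.invFunOn_downMap hlam hx]

lemma down_downMap_pos (hf : IsDecreasingDensity f xi xf) (hlam : lam ≠ 0) {x : ℝ}
    (hx : x ∈ supp f) : 0 < down (2 - lam) f (downMap (2 - lam) f x) := by
  rw [hf.down_downMap hlam hx]
  exact div_pos (Real.rpow_pos_of_pos hx _) (abs_pos.2 (hf.deriv_neg' hx).ne)

lemma supp_down (hf : IsDecreasingDensity f xi xf) (hlam : lam ≠ 0) :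
    supp (down (2 - lam) f) = downMap (2 - lam) f '' supp f := by
  ext s
  constructor
  · intro hs
    by_contra h
    have : 0 < down (2 - lam) f s := hs
    rw [down, if_neg h] at this
    exact lt_irrefl _ this
  · rintro ⟨x, hx, rfl⟩
    exact hf.down_downMap_pos hlam hx

lemma lintegral_supp_down (hf : IsDecreasingDensity f xi xf) (hlam : lam ≠ 0) (φ : ℝ → ℝ≥0∞) :
    ∫⁻ s in supp (down (2 - lam) f), φ s = ∫⁻ x in supp f,
      ENNReal.ofReal (f x ^ (lam - 1) * |deriv f x|) * φ (downMap (2 - lam) f x) := by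
  rw [hf.supp_down hlam, lintegral_image_eq_lintegral_abs_deriv_mul hf.isOpen_supp.measurableSet
    (fun x hx => (hf.hasStrictDerivAt_downMap hlam hx).hasDerivAt.hasDerivWithinAt)
    (hf.strictMonoOn_downMap hlam).injOn]
  refine setLIntegral_congr_fun hf.isOpen_supp.measurableSet fun x hx => ?_
  rw [abs_mul, abs_neg, abs_of_pos (Real.rpow_pos_of_pos hx _)]

lemma down_nonneg (hf : IsDecreasingDensity f xi xf) (hlam : lam ≠ 0) (s : ℝ) :
    0 ≤ down (2 - lam) f s := by
  by_cases hs : s ∈ downMap (2 - lam) f '' supp f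
  · obtain ⟨x, hx, rfl⟩ := hs
    exact (hf.down_downMap_pos hlam hx).le
  · rw [down, if_neg hs]

/-- The transformed density is the image of `f dx` under the change of variable; mass, moment and
Fisher identities all reduce to this. -/
lemma jacobian_mul_down (hf : IsDecreasingDensity f xi xf) (hlam : lam ≠ 0) {x : ℝ}
    (hx : x ∈ supp f) :
    ENNReal.ofReal (f x ^ (lam - 1) * |deriv f x|) *
      ENNReal.ofReal (down (2 - lam) f (downMap (2 - lam) f x)) = ENNReal.ofReal (f x) := by
  have hpos : 0 < f x := hx
  have hd : |deriv f x| ≠ 0 := abs_ne_zero.2 (hf.deriv_neg' hx).ne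
  rw [← ENNReal.ofReal_mul (mul_nonneg (Real.rpow_nonneg hpos.le _) (abs_nonneg _)),
    hf.down_downMap hlam hx]
  congr 1
  field_simp
  rw [← Real.rpow_add hpos]
  ring_nf
  rw [Real.rpow_one]

lemma isIntervalDensity_down (hf : IsDecreasingDensity f xi xf) (hlam : lam ≠ 0) :
    IsIntervalDensity (down (2 - lam) f) where
  nonneg := hf.down_nonneg hlam
  cont := by
    rw [hf.supp_down hlam]
    rintro _ ⟨x, hx, rfl⟩
    refine ContinuousAt.continuousWithinAt ?_
    have hψ := (hf.hasDerivAt_invFunOn_downMap hlam hx).continuousAt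
    have hpos : 0 < f x := hx
    have hc : ContinuousAt (fun y => f y ^ (2 - lam) / |deriv f y|) x := by
      refine ContinuousAt.div ?_ ?_ (abs_ne_zero.2 (hf.deriv_neg' hx).ne)
      · exact (hf.hasStrictDerivAt hx).hasDerivAt.continuousAt.rpow_const (Or.inl hpos.ne')
      · have h := hf.deriv_cont
        rw [← hf.supp_eq] at h
        exact (h.continuousAt (hf.isOpen_supp.mem_nhds hx)).abs
    rw [← hf.invFunOn_downMap hlam hx] at hc
    refine (ContinuousAt.comp (f := Function.invFunOn (downMap (2 - lam) f) (supp f))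
      hc hψ).congr ?_
    filter_upwards [(isOpen_image_of_hasStrictDerivAt hf.isOpen_supp
      (fun _ hy => hf.hasStrictDerivAt_downMap hlam hy)
      (fun _ hy => (hf.deriv_downMap_pos hy).ne')).mem_nhds (mem_image_of_mem _ hx)] with s hs
    rw [down, if_pos hs]
    rfl
  isOpen := by
    rw [hf.supp_down hlam]
    exact isOpen_image_of_hasStrictDerivAt hf.isOpen_supp
      (fun _ hy => hf.hasStrictDerivAt_downMap hlam hy) (fun _ hy => (hf.deriv_downMap_pos hy).ne')
  ordConnected := by
    rw [hf.supp_down hlam]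
    exact (hf.ordConnected_supp.isPreconnected.image _ (hf.continuousOn_downMap hlam)).ordConnected
  mass := by
    rw [← hf.lintegral_supp]
    trans ∫⁻ s in supp (down (2 - lam) f), ENNReal.ofReal (down (2 - lam) f s)
    · refine (setLIntegral_eq_of_support_subset fun s hs => ?_).symm
      by_contra hs'
      have h0 : down (2 - lam) f s = 0 := le_antisymm (not_lt.1 hs') (hf.down_nonneg hlam s)
      simp [h0] at hs
    · rw [hf.lintegral_supp_down hlam]
      exact setLIntegral_congr_fun hf.isOpen_supp.measurableSet fun x hx =>
        hf.jacobian_mul_down hlam hx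

/-- With `u = f^(lam-2) |f'|` the transformed density is `1/u` and `dt = u f dx`, so its power `1 -
s` integrates to `∫ u^s f`, for every real `s`. -/
lemma lintegral_down_rpow (hf : IsDecreasingDensity f xi xf) (hlam : lam ≠ 0) (s : ℝ) :
    ∫⁻ t in supp (down (2 - lam) f), ENNReal.ofReal (down (2 - lam) f t ^ (1 - s)) =
      F s lam f := by
  rw [hf.lintegral_supp_down hlam, F]
  refine setLIntegral_congr_fun hf.isOpen_supp.measurableSet fun x hx => ?_
  have hpos : 0 < f x := hx
  have hd : 0 < |deriv f x| := abs_pos.2 (hf.deriv_neg' hx).ne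
  have h1 : 0 < f x ^ (lam - 2) := Real.rpow_pos_of_pos hpos _
  have h2 : 0 < f x ^ (2 - lam) := Real.rpow_pos_of_pos hpos _
  have h3 : f x ^ (2 - lam) / |deriv f x| = (f x ^ (lam - 2) * |deriv f x|)⁻¹ := by
    rw [mul_inv, ← Real.rpow_neg hpos.le, neg_sub, div_eq_mul_inv]
  rw [abs_mul, abs_of_pos h1, ENNReal.ofReal_rpow_of_pos (mul_pos h1 hd),
    ← ENNReal.ofReal_mul (mul_pos (Real.rpow_pos_of_pos hpos _) hd).le,
    ← ENNReal.ofReal_mul (Real.rpow_pos_of_pos (mul_pos h1 hd) _).le, hf.down_downMap hlam hx, h3]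
  congr 1
  have h4 : f x ^ (lam - 1) * |deriv f x| = (f x ^ (lam - 2) * |deriv f x|) * f x := by
    rw [show lam - 1 = lam - 2 + 1 by ring, Real.rpow_add_one hpos.ne']
    ring
  set u := f x ^ (lam - 2) * |deriv f x| with hu
  have hu0 : 0 < u := mul_pos h1 hd
  rw [h4, Real.inv_rpow hu0.le, Real.rpow_sub hu0, Real.rpow_one]
  have := (Real.rpow_pos_of_pos hu0 s).ne'
  field_simp

lemma lintegral_moment_down (hf : IsDecreasingDensity f xi xf) (hlam : lam ≠ 0) :
    ∫⁻ t in supp (down (2 - lam) f), ENNReal.ofReal (|lam * t| ^ ((lam - 1) / lam)) *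
      ENNReal.ofReal (down (2 - lam) f t) = ∫⁻ x in supp f, ENNReal.ofReal (f x ^ lam) := by
  rw [hf.lintegral_supp_down hlam]
  refine setLIntegral_congr_fun hf.isOpen_supp.measurableSet fun x hx => ?_
  have hpos : 0 < f x := hx
  rw [mul_left_comm, hf.jacobian_mul_down hlam hx, hf.abs_mul_downMap hlam,
    ← ENNReal.ofReal_mul (Real.rpow_nonneg (Real.rpow_nonneg hpos.le _) _),
    ← Real.rpow_mul hpos.le, mul_div_cancel₀ _ hlam, ← Real.rpow_add_one hpos.ne', sub_add_cancel]

lemma supp_down_subset (hf : IsDecreasingDensity f xi xf) (hlam : lam ≠ 0) :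
    supp (down (2 - lam) f) ⊆ Iio 0 ∨ supp (down (2 - lam) f) ⊆ Ioi 0 := by
  rw [hf.supp_down hlam]
  rcases lt_or_gt_of_ne hlam with h | h
  · right
    rintro _ ⟨x, hx, rfl⟩
    rw [mem_Ioi, downMap_eq hlam]
    exact div_pos (Real.rpow_pos_of_pos hx _) (neg_pos.2 h)
  · left
    rintro _ ⟨x, hx, rfl⟩
    rw [mem_Iio, downMap_eq hlam]
    exact div_neg_of_pos_of_neg (Real.rpow_pos_of_pos hx _) (neg_neg_of_pos h)

/-- The points to avoid form the image of a null set under the inverse change of variable, which is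
differentiable on the image of the support and so preserves null sets. -/
lemma ae_differentiableAt_downMap (hf : IsDecreasingDensity f xi xf) (hlam : lam ≠ 0)
    (hac : LocallyAC (down (2 - lam) f)) :
    ∀ᵐ x, x ∈ supp f → DifferentiableAt ℝ (down (2 - lam) f) (downMap (2 - lam) f x) := by
  set B := {s | ¬ DifferentiableAt ℝ (down (2 - lam) f) s} with hB
  have hB0 : volume B = 0 := hac.ae_differentiableAt
  set ψ := Function.invFunOn (downMap (2 - lam) f) (supp f) with hψ
  have hnull : volume (ψ '' (B ∩ downMap (2 - lam) f '' supp f)) = 0 := by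
    refine addHaar_image_eq_zero_of_differentiableOn_of_addHaar_eq_zero _ ?_
      (measure_mono_null inter_subset_left hB0)
    rintro _ ⟨_, x, hx, rfl⟩
    exact (hf.hasDerivAt_invFunOn_downMap hlam hx).differentiableAt.differentiableWithinAt
  filter_upwards [measure_eq_zero_iff_ae_notMem.1 hnull] with x hx hxs
  by_contra hcon
  exact hx ⟨downMap (2 - lam) f x, ⟨hcon, mem_image_of_mem _ hxs⟩, hf.invFunOn_downMap hlam hxs⟩

/-- The density is only assumed `C¹`. The second derivative exists at `x` because `f' = -f^(2-lam) /
(D ∘ t)` near `x`, where `D` is the transformed density and is differentiable at `t(x)`. Computing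
`(D ∘ t)'` in two ways then gives the formula. -/
lemma abs_deriv_down (hf : IsDecreasingDensity f xi xf) (hlam : lam ≠ 0) {x : ℝ} (hx : x ∈ supp f)
    (hd : DifferentiableAt ℝ (down (2 - lam) f) (downMap (2 - lam) f x)) :
    |deriv (down (2 - lam) f) (downMap (2 - lam) f x)| =
      f x ^ (2 - 2 * lam) / |deriv f x| *
        |2 - lam - f x * deriv (deriv f) x / deriv f x ^ 2| := by
  have hpos : 0 < f x := hx
  have hf' := hf.deriv_neg' hx
  have hfd := (hf.hasStrictDerivAt hx).hasDerivAt
  have h1 := hd.hasDerivAt.comp x (hf.hasStrictDerivAt_downMap hlam hx).hasDerivAt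
  have hnum : HasDerivAt (fun y => f y ^ (2 - lam)) _ x := hfd.rpow_const (Or.inl hpos.ne')
  have hD0 := (hf.down_downMap_pos hlam hx).ne'
  have hloc : ∀ᶠ y in 𝓝 x, deriv f y =
      -(f y ^ (2 - lam) / (down (2 - lam) f ∘ downMap (2 - lam) f) y) := by
    filter_upwards [hf.isOpen_supp.mem_nhds hx] with y hy
    have hy0 : f y ^ (2 - lam) ≠ 0 := (Real.rpow_pos_of_pos hy _).ne'
    have hy1 : deriv f y ≠ 0 := (hf.deriv_neg' hy).ne
    rw [Function.comp_apply, hf.down_downMap hlam hy, abs_of_neg (hf.deriv_neg' hy)]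
    field_simp
  have hdd : DifferentiableAt ℝ (deriv f) x :=
    ((hnum.div h1 hD0).neg.congr_of_eventuallyEq hloc).differentiableAt
  have h2 : HasDerivAt (fun y => f y ^ (2 - lam) / -deriv f y) _ x :=
    hnum.div hdd.hasDerivAt.neg (neg_ne_zero.2 hf'.ne)
  have h3 : HasDerivAt (down (2 - lam) f ∘ downMap (2 - lam) f) _ x :=
    h2.congr_of_eventuallyEq (by
      filter_upwards [hf.isOpen_supp.mem_nhds hx] with y hy
      rw [Function.comp_apply, hf.down_downMap hlam hy, abs_of_neg (hf.deriv_neg' hy)])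
  have h4 := h1.unique h3
  set D' := deriv (down (2 - lam) f) (downMap (2 - lam) f x)
  have h5 : D' = f x ^ (2 - 2 * lam) / deriv f x *
      (2 - lam - f x * deriv (deriv f) x / deriv f x ^ 2) := by
    have e1 : f x ^ (2 - lam - 1) = f x ^ (2 - 2 * lam) * f x ^ (lam - 1) := by
      rw [← Real.rpow_add hpos]
      ring_nf
    have e2 : f x ^ (2 - lam) = f x ^ (2 - 2 * lam) * f x ^ (lam - 1) * f x := by
      rw [← e1, ← Real.rpow_add_one hpos.ne', sub_add_cancel]
    rw [e1, e2] at h4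
    have hp1 := (Real.rpow_pos_of_pos hpos (lam - 1)).ne'
    have hne : f x ^ (lam - 1) * -deriv f x ≠ 0 := mul_ne_zero hp1 (neg_ne_zero.2 hf'.ne)
    rw [← eq_div_iff hne] at h4
    rw [h4]
    have := hf'.ne
    field_simp
    ring
  rw [h5, abs_mul, abs_div, abs_of_pos (Real.rpow_pos_of_pos hpos _)]

theorem downFisher_eq (hf : IsDecreasingDensity f xi xf) (hlam : lam ≠ 0) {p q : ℝ} (hp : 1 ≤ p)
    (hpq : p ≠ q) (hac : LocallyAC (down (2 - lam) f)) :
    downFisher p q ((2 - lam) * (p - q) / p) f = F p ((p - q) / p) (down (2 - lam) f) := by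
  have hp0 : 0 < p := by linarith
  have hpq' : p - q ≠ 0 := sub_ne_zero.2 hpq
  rw [F, hf.lintegral_supp_down hlam, downFisher]
  refine lintegral_congr_ae ((ae_restrict_iff' hf.isOpen_supp.measurableSet).2 ?_)
  filter_upwards [hf.ae_differentiableAt_downMap hlam hac] with x hx hxs
  have hpos : 0 < f x := hxs
  have hd : 0 < |deriv f x| := abs_pos.2 (hf.deriv_neg' hxs).ne
  have hr : p * ((2 - lam) * (p - q) / p) / (p - q) = 2 - lam := by field_simp
  rw [mul_left_comm, hf.jacobian_mul_down hlam hxs, hr, abs_mul, hf.abs_deriv_down hlam hxs (hx hxs),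
    abs_of_pos (Real.rpow_pos_of_pos (hf.down_downMap_pos hlam hxs) _), hf.down_downMap hlam hxs]
  set b := |2 - lam - f x * deriv (deriv f) x / deriv f x ^ 2|
  have hb : 0 ≤ b := abs_nonneg _
  set d := |deriv f x|
  -- The exponent of `|f'|` is `-((p-q)/p - 2) - 1 = q/p`, which the outer power `p` turns into `q`.
  have e : (f x ^ (2 - lam) / d) ^ ((p - q) / p - 2) * (f x ^ (2 - 2 * lam) / d * b) =
      f x ^ ((2 - lam) * ((p - q) / p - 2) + (2 - 2 * lam)) * d ^ (q / p) * b := by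
    rw [Real.div_rpow (Real.rpow_nonneg hpos.le _) hd.le, ← Real.rpow_mul hpos.le,
      Real.rpow_add hpos, show q / p = -((p - q) / p - 2) - 1 by field_simp; ring,
      Real.rpow_sub_one hd.ne', Real.rpow_neg hd.le]
    ring
  have hA : 0 ≤ f x ^ ((2 - lam) * ((p - q) / p - 2) + (2 - 2 * lam)) := Real.rpow_nonneg hpos.le _
  have hdq : 0 ≤ d ^ (q / p) := Real.rpow_nonneg hd.le _
  rw [e, ENNReal.ofReal_mul (mul_nonneg hA hdq), ENNReal.ofReal_mul hA,
    ENNReal.mul_rpow_of_nonneg _ _ hp0.le, ENNReal.mul_rpow_of_nonneg _ _ hp0.le,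
    ENNReal.ofReal_rpow_of_nonneg hA hp0.le, ENNReal.ofReal_rpow_of_nonneg hdq hp0.le,
    ← Real.rpow_mul hpos.le, ← Real.rpow_mul hd.le, div_mul_cancel₀ _ hp0.ne',
    ENNReal.ofReal_rpow_of_pos hd,
    show 1 + p * ((2 - lam) * (p - q) / p - 2) =
      ((2 - lam) * ((p - q) / p - 2) + (2 - 2 * lam)) * p + 1 by field_simp; ring,
    Real.rpow_add_one hpos.ne', ENNReal.ofReal_mul (Real.rpow_nonneg hpos.le _)]
  ring

end IsDecreasingDensity

/-! ### Generalized Gaussians on the half-line -/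

lemma supp_halfGauss (p μ : ℝ) : supp (halfGauss p μ) = supp (gauss p μ) ∩ Ioi 0 := by
  ext x
  by_cases hx : 0 < x
  · simp [supp, halfGauss, hx]
  · simp [supp, halfGauss, hx]

lemma halfGauss_of_pos (p μ : ℝ) {x : ℝ} (hx : 0 < x) : halfGauss p μ x = 2 * gauss p μ x := if_pos hx

section HalfGauss

variable {p μ : ℝ}

lemma neg_mem_supp_gauss (x : ℝ) : -x ∈ supp (gauss p μ) ↔ x ∈ supp (gauss p μ) := by
  rw [supp, mem_ofPred_eq, mem_ofPred_eq, gauss_neg]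

lemma isIntervalDensity_halfGauss (hP : 0 < pstar p) (hμ : μ ≠ 1) (hμP : 1 < μ * (1 + pstar p)) :
    IsIntervalDensity (halfGauss p μ) := by
  have H := isIntervalDensity_gauss hP hμ hμP
  have hnn : ∀ x, 0 ≤ halfGauss p μ x := fun x => by
    rw [halfGauss]
    split_ifs
    · exact mul_nonneg zero_le_two (H.nonneg x)
    · exact le_rfl
  have hm : MeasurableSet (supp (gauss p μ) ∩ Ioi 0) := H.isOpen.measurableSet.inter measurableSet_Ioi
  refine ⟨hnn, ?_, ?_, ?_, ?_⟩
  · rw [supp_halfGauss]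
    refine ((continuous_gauss hP hμ).const_mul 2).continuousOn.congr fun x hx => ?_
    exact halfGauss_of_pos p μ hx.2
  · rw [supp_halfGauss]
    exact H.isOpen.inter isOpen_Ioi
  · rw [supp_halfGauss]
    exact H.ordConnected.inter ordConnected_Ioi
  · trans ∫⁻ x in supp (halfGauss p μ), ENNReal.ofReal (halfGauss p μ x)
    · refine (setLIntegral_eq_of_support_subset fun s hs => ?_).symm
      by_contra hs'
      have h0 : halfGauss p μ s = 0 := le_antisymm (not_lt.1 hs') (hnn s)
      simp [h0] at hs
    · rw [supp_halfGauss, ← H.lintegral_supp, setLIntegral_eq_two_mul_of_even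
        (S := supp (gauss p μ)) neg_mem_supp_gauss (by simp [gauss_neg]),
        ← lintegral_const_mul' _ _ (by simp)]
      refine setLIntegral_congr_fun hm fun x hx => ?_
      rw [halfGauss_of_pos p μ hx.2, ENNReal.ofReal_mul zero_le_two, ENNReal.ofReal_ofNat]

lemma halfGauss_moment_eq (hP : 0 < pstar p) (hμ : μ ≠ 1) (hμP : 1 < μ * (1 + pstar p)) :
    ∫⁻ x in supp (halfGauss p μ), ENNReal.ofReal (|x| ^ pstar p) * ENNReal.ofReal (halfGauss p μ x) =
      ∫⁻ x in supp (gauss p μ), ENNReal.ofReal (|x| ^ pstar p) * ENNReal.ofReal (gauss p μ x) := by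
  have H := isIntervalDensity_gauss hP hμ hμP
  rw [supp_halfGauss, setLIntegral_eq_two_mul_of_even
    (S := supp (gauss p μ)) neg_mem_supp_gauss (by simp [gauss_neg]),
    ← lintegral_const_mul' _ _ (by simp)]
  refine setLIntegral_congr_fun (H.isOpen.measurableSet.inter measurableSet_Ioi) fun x hx => ?_
  rw [halfGauss_of_pos p μ hx.2, ENNReal.ofReal_mul zero_le_two, ENNReal.ofReal_ofNat, mul_left_comm]

lemma halfGauss_rpow_ne_top (hP : 0 < pstar p) (hμ : μ ≠ 1) (hμP : 1 < μ * (1 + pstar p)) :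
    ∫⁻ x in supp (halfGauss p μ), ENNReal.ofReal (halfGauss p μ x ^ μ) ≠ ∞ := by
  have H := isIntervalDensity_gauss hP hμ hμP
  refine ne_top_of_le_ne_top (ENNReal.mul_ne_top (ENNReal.ofReal_ne_top (r := 2 ^ μ))
    (gauss_rpow_ne_top hP hμ hμP)) ?_
  rw [← lintegral_const_mul' _ _ ENNReal.ofReal_ne_top, supp_halfGauss]
  refine (setLIntegral_mono' (H.isOpen.measurableSet.inter measurableSet_Ioi) fun x hx => ?_).trans
    (lintegral_mono_set inter_subset_left)
  rw [halfGauss_of_pos p μ hx.2, Real.mul_rpow zero_le_two (H.nonneg x),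
    ENNReal.ofReal_mul (by positivity)]

/-- Affinity of `g^(μ-1)` in `x^P` is the extremal property: integrated against another density it
sees only mass and moment. -/
lemma halfGauss_rpow_sub_one (hP : 0 < pstar p) (hμ : μ ≠ 1) (hμP : 1 < μ * (1 + pstar p)) :
    ∃ A : ℝ, 0 < A ∧ ∀ x ∈ supp (halfGauss p μ),
      halfGauss p μ x ^ (μ - 1) = A * (1 - (μ - 1) * x ^ pstar p) := by
  have hZ := integral_profile_pos hP hμ hμP
  refine ⟨(2 / ∫ y, profile (pstar p) μ y) ^ (μ - 1), Real.rpow_pos_of_pos (by positivity) _,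
    fun x hx => ?_⟩
  rw [supp_halfGauss, supp_gauss hP hμ hμP] at hx
  rw [halfGauss_of_pos p μ hx.2, gauss_eq, mul_div_assoc', mul_comm, mul_div_assoc, mul_comm,
    Real.mul_rpow (by positivity) (profile_nonneg hμ x), profile_rpow_sub_one hμ hx.1, profileBase,
    abs_of_pos hx.2]

lemma mem_supp_halfGauss (hP : 0 < pstar p) (hμ : μ ≠ 1) (hμP : 1 < μ * (1 + pstar p)) {x : ℝ}
    (hx : 0 < x) : x ∈ supp (halfGauss p μ) ↔ 0 < 1 - (μ - 1) * x ^ pstar p := by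
  rw [supp_halfGauss, supp_gauss hP hμ hμP, mem_inter_iff, mem_supp_profile hμ, profileBase,
    abs_of_pos hx, mem_Ioi, and_iff_left hx]

end HalfGauss

/-! ### The moment-entropy inequality on a half-line -/

/-- Substitution `x = τ y` on the positive half-line; evenness in `x` covers the negative one. -/
lemma lintegral_scaled_rpow_le {g : ℝ → ℝ} (K : IsIntervalDensity g) {μ τ : ℝ} (hμ : 0 < μ)
    (hτ : 0 < τ) {S : Set ℝ} (hS : S ⊆ Iio 0 ∨ S ⊆ Ioi 0) :
    ∫⁻ x in S, ENNReal.ofReal (g (|x| / τ) ^ μ) ≤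
      ENNReal.ofReal τ * ∫⁻ x in supp g, ENNReal.ofReal (g x ^ μ) := by
  have h1 : ∫⁻ x in Ioi 0, ENNReal.ofReal (g (|x| / τ) ^ μ) ≤
      ENNReal.ofReal τ * ∫⁻ x in supp g, ENNReal.ofReal (g x ^ μ) := by
    have himg : (fun x : ℝ => τ * x) '' Ioi 0 = Ioi 0 := by
      rw [image_mul_left_Ioi hτ, mul_zero]
    rw [← himg, lintegral_image_eq_lintegral_abs_deriv_mul (f' := fun _ => τ) measurableSet_Ioi
      (fun x _ => by simpa using ((hasDerivAt_id x).const_mul τ).hasDerivWithinAt)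
      (fun a _ b _ hab => mul_left_cancel₀ hτ.ne' hab), abs_of_pos hτ,
      lintegral_const_mul' _ _ ENNReal.ofReal_ne_top]
    refine mul_le_mul_right ?_ _
    calc ∫⁻ x in Ioi 0, ENNReal.ofReal (g (|τ * x| / τ) ^ μ)
        = ∫⁻ x in Ioi 0, ENNReal.ofReal (g x ^ μ) := by
          refine setLIntegral_congr_fun measurableSet_Ioi fun x hx => ?_
          rw [abs_of_pos (mul_pos hτ hx), mul_div_cancel_left₀ _ hτ.ne']
      _ ≤ ∫⁻ x, ENNReal.ofReal (g x ^ μ) := setLIntegral_le_lintegral _ _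
      _ = _ := by
          refine (setLIntegral_eq_of_support_subset fun x hx => ?_).symm
          by_contra hx'
          simp [K.eq_zero hx', Real.zero_rpow hμ.ne'] at hx
  rcases hS with hS | hS
  · refine (lintegral_mono_set hS).trans ?_
    have := setLIntegral_Iio_eq_Ioi_of_even (S := univ) (by simp)
      (φ := fun x => ENNReal.ofReal (g (|x| / τ) ^ μ)) (by simp)
    rw [univ_inter, univ_inter] at this
    rw [this]
    exact h1
  · exact (lintegral_mono_set hS).trans h1

/-- With `w(x) = g(|x|/τ)`, write `h^μ = (w^(μ-1) h)^μ (w^μ)^(1-μ)` and apply Hölder. Matching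
moments makes the first integral equal to `∫ g^μ`; the second is at most `τ ∫ g^μ`. -/
lemma lintegral_rpow_le_scaled_of_lt_one {h g : ℝ → ℝ} (H : IsIntervalDensity h)
    (K : IsIntervalDensity g) {μ P A τ : ℝ} (hμ0 : 0 < μ) (hμ1 : μ < 1) (hA : 0 < A)
    (hτ : 0 < τ) (hgs : supp g = Ioi 0)
    (hg : ∀ x ∈ supp g, g x ^ (μ - 1) = A * (1 - (μ - 1) * x ^ P))
    (hS : supp h ⊆ Iio 0 ∨ supp h ⊆ Ioi 0)
    (hM : ∫⁻ x in supp h, ENNReal.ofReal (|x| ^ P) * ENNReal.ofReal (h x) =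
      ENNReal.ofReal (τ ^ P) * ∫⁻ x in supp g, ENNReal.ofReal (|x| ^ P) * ENNReal.ofReal (g x)) :
    ∫⁻ x in supp h, ENNReal.ofReal (h x ^ μ) ≤
      ENNReal.ofReal (τ ^ (1 - μ)) * ∫⁻ x in supp g, ENNReal.ofReal (g x ^ μ) := by
  have h1 : 0 < 1 - μ := by linarith
  -- Used for `h` at scale `τ` and for `g` at scale `1`: by the choice of `τ` the two right-hand
  -- sides agree.
  have weight : ∀ {k : ℝ → ℝ} (_ : IsIntervalDensity k) (_ : supp k ⊆ Iio 0 ∨ supp k ⊆ Ioi 0)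
      {σ : ℝ} (_ : 0 < σ), ∫⁻ x in supp k, ENNReal.ofReal (g (|x| / σ) ^ (μ - 1)) *
        ENNReal.ofReal (k x) = ENNReal.ofReal A + ENNReal.ofReal (A * (1 - μ) * (σ ^ P)⁻¹) *
        ∫⁻ x in supp k, ENNReal.ofReal (|x| ^ P) * ENNReal.ofReal (k x) := by
    intro k hk hks σ hσ
    have hσP : 0 < σ ^ P := Real.rpow_pos_of_pos hσ _
    calc _ = ∫⁻ x in supp k, (ENNReal.ofReal A * ENNReal.ofReal (k x) +
          ENNReal.ofReal (A * (1 - μ) * (σ ^ P)⁻¹) *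
            (ENNReal.ofReal (|x| ^ P) * ENNReal.ofReal (k x))) := by
          refine setLIntegral_congr_fun hk.isOpen.measurableSet fun x hx => ?_
          have hx0 : 0 < |x| := abs_pos.2 (by
            rcases hks with hks | hks
            · exact ne_of_lt (hks hx)
            · exact ne_of_gt (hks hx))
          have hxP : 0 ≤ |x| ^ P := Real.rpow_nonneg hx0.le _
          rw [hg _ (by rw [hgs]; exact div_pos hx0 hσ), ← mul_assoc, ← add_mul,
            Real.div_rpow hx0.le hσ.le,
            ← ENNReal.ofReal_mul (p := A * (1 - μ) * (σ ^ P)⁻¹) (by positivity),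
            ← ENNReal.ofReal_add hA.le (by positivity)]
          congr 2
          field_simp
          ring
      _ = _ := by
          rw [lintegral_add_left (hk.measurable.ennreal_ofReal.const_mul _),
            lintegral_const_mul' _ _ ENNReal.ofReal_ne_top,
            lintegral_const_mul' _ _ ENNReal.ofReal_ne_top, hk.lintegral_supp, mul_one]
  have hτP : 0 < τ ^ P := Real.rpow_pos_of_pos hτ _
  have e1 : ∫⁻ x in supp h, ENNReal.ofReal (g (|x| / τ) ^ (μ - 1)) * ENNReal.ofReal (h x) =
      ∫⁻ x in supp g, ENNReal.ofReal (g x ^ μ) := by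
    rw [weight H hS hτ, hM, ← mul_assoc, ← ENNReal.ofReal_mul (by positivity),
      lintegral_rpow_eq_lintegral_mul K]
    have := weight K (Or.inr hgs.le) one_pos
    rw [Real.one_rpow, inv_one, mul_one] at this
    rw [inv_mul_cancel_right₀ hτP.ne', ← this]
    refine setLIntegral_congr_fun K.isOpen.measurableSet fun x hx => ?_
    rw [hgs] at hx
    rw [div_one, abs_of_pos hx]
  have hmw : Measurable fun x => g (|x| / τ) := K.measurable.comp
    ((measurable_id.abs).div_const τ)
  have hold := ENNReal.lintegral_mul_norm_pow_le (μ := volume.restrict (supp h))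
    (f := fun x => ENNReal.ofReal (g (|x| / τ) ^ (μ - 1)) * ENNReal.ofReal (h x))
    (g := fun x => ENNReal.ofReal (g (|x| / τ) ^ μ))
    ((hmw.pow_const _).ennreal_ofReal.mul H.measurable.ennreal_ofReal).aemeasurable
    ((hmw.pow_const _).ennreal_ofReal).aemeasurable hμ0.le h1.le (by ring)
  have e2 : ∫⁻ x in supp h, ENNReal.ofReal (h x ^ μ) = ∫⁻ x in supp h,
      (ENNReal.ofReal (g (|x| / τ) ^ (μ - 1)) * ENNReal.ofReal (h x)) ^ μ *
        (ENNReal.ofReal (g (|x| / τ) ^ μ)) ^ (1 - μ) := by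
    refine setLIntegral_congr_fun H.isOpen.measurableSet fun x hx => ?_
    have hpos : 0 < h x := hx
    have hx0 : 0 < |x| := abs_pos.2 (by
      rcases hS with hS | hS
      · exact ne_of_lt (hS hx)
      · exact ne_of_gt (hS hx))
    have hw : 0 < g (|x| / τ) := by
      have : |x| / τ ∈ supp g := by rw [hgs]; exact div_pos hx0 hτ
      exact this
    have hw1 := Real.rpow_pos_of_pos hw (μ - 1)
    have hw2 := Real.rpow_pos_of_pos hw μ
    rw [← ENNReal.ofReal_mul hw1.le, ENNReal.ofReal_rpow_of_pos (mul_pos hw1 hpos),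
      ENNReal.ofReal_rpow_of_pos hw2, ← ENNReal.ofReal_mul (by positivity),
      Real.mul_rpow hw1.le hpos.le, ← Real.rpow_mul hw.le, ← Real.rpow_mul hw.le,
      mul_right_comm, ← Real.rpow_add hw, show (μ - 1) * μ + μ * (1 - μ) = 0 by ring,
      Real.rpow_zero, one_mul]
  rw [← e2, e1] at hold
  have hG0 := lintegral_rpow_pos K μ
  by_cases hGt : ∫⁻ x in supp g, ENNReal.ofReal (g x ^ μ) = ∞
  · rw [hGt, ENNReal.mul_top (ENNReal.ofReal_pos.2 (by positivity)).ne']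
    exact le_top
  calc _ ≤ _ := hold
    _ ≤ (∫⁻ x in supp g, ENNReal.ofReal (g x ^ μ)) ^ μ *
        (ENNReal.ofReal τ * ∫⁻ x in supp g, ENNReal.ofReal (g x ^ μ)) ^ (1 - μ) :=
        mul_le_mul_right (ENNReal.rpow_le_rpow (lintegral_scaled_rpow_le K hμ0 hτ hS) h1.le) _
    _ = _ := by
        rw [ENNReal.mul_rpow_of_nonneg _ _ h1.le, mul_left_comm, ← ENNReal.rpow_add _ _ hG0 hGt,
          add_sub_cancel, ENNReal.rpow_one, ENNReal.ofReal_rpow_of_pos hτ]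

/-- Here `g` has bounded support. Beyond it the affine expression is nonpositive while `w^(μ-1) ≥
0`, where `w(x) = g(|x|/τ)`; hence `∫ w^(μ-1) h ≥ ∫ g^μ`, and Hölder bounds the left side by `(∫
w^μ)^(1-1/μ) (∫ h^μ)^(1/μ)`. -/
lemma scaled_le_lintegral_rpow_of_one_lt {h g : ℝ → ℝ} (H : IsIntervalDensity h)
    (K : IsIntervalDensity g) {μ P A τ : ℝ} (hμ1 : 1 < μ) (hA : 0 < A)
    (hτ : 0 < τ) (hgs : supp g ⊆ Ioi 0)
    (hg : ∀ x ∈ supp g, g x ^ (μ - 1) = A * (1 - (μ - 1) * x ^ P))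
    (hg' : ∀ x, 0 < x → x ∉ supp g → 1 - (μ - 1) * x ^ P ≤ 0)
    (hS : supp h ⊆ Iio 0 ∨ supp h ⊆ Ioi 0)
    (hM : ∫⁻ x in supp h, ENNReal.ofReal (|x| ^ P) * ENNReal.ofReal (h x) =
      ENNReal.ofReal (τ ^ P) * ∫⁻ x in supp g, ENNReal.ofReal (|x| ^ P) * ENNReal.ofReal (g x))
    (hMg : ∫⁻ x in supp g, ENNReal.ofReal (|x| ^ P) * ENNReal.ofReal (g x) ≠ ∞)
    (hGt : ∫⁻ x in supp g, ENNReal.ofReal (g x ^ μ) ≠ ∞) :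
    ENNReal.ofReal (τ ^ (1 - μ)) * ∫⁻ x in supp g, ENNReal.ofReal (g x ^ μ) ≤
      ∫⁻ x in supp h, ENNReal.ofReal (h x ^ μ) := by
  have hμ0 : 0 < μ := by linarith
  have h1 : 0 < μ - 1 := by linarith
  have h1' : 0 < 1 - 1 / μ := by
    rw [sub_pos, div_lt_one hμ0]
    exact hμ1
  have hτP : 0 < τ ^ P := Real.rpow_pos_of_pos hτ _
  set G := ∫⁻ x in supp g, ENNReal.ofReal (g x ^ μ) with hG
  set Mg := ∫⁻ x in supp g, ENNReal.ofReal (|x| ^ P) * ENNReal.ofReal (g x) with hMgdef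
  have hG0 : G ≠ 0 := lintegral_rpow_pos K μ
  have eA : G + ENNReal.ofReal (A * (μ - 1)) * Mg = ENNReal.ofReal A := by
    have hmeas : Measurable fun x => ENNReal.ofReal (g x ^ (μ - 1)) * ENNReal.ofReal (g x) :=
      (K.measurable.pow_const _).ennreal_ofReal.mul K.measurable.ennreal_ofReal
    rw [hG, hMgdef, lintegral_rpow_eq_lintegral_mul K, ← lintegral_const_mul' _ _
      ENNReal.ofReal_ne_top, ← lintegral_add_left hmeas, ← mul_one (ENNReal.ofReal A), ← K.lintegral_supp,
      ← lintegral_const_mul' _ _ ENNReal.ofReal_ne_top]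
    refine setLIntegral_congr_fun K.isOpen.measurableSet fun x hx => ?_
    have hx0 : 0 < x := hgs hx
    have hpos : 0 < g x := hx
    have hxP : 0 ≤ |x| ^ P := Real.rpow_nonneg (abs_nonneg _) _
    rw [← mul_assoc, ← add_mul, ← ENNReal.ofReal_mul (by positivity),
      ← ENNReal.ofReal_add (Real.rpow_nonneg hpos.le _) (by positivity), hg x hx, abs_of_pos hx0]
    congr 2
    ring
  -- The negative part of the affine function is carried to the other side, since subtraction in
  -- `ℝ≥0∞` truncates; finiteness of the moment cancels it afterwards.
  have hle : ENNReal.ofReal A ≤ (∫⁻ x in supp h, ENNReal.ofReal (g (|x| / τ) ^ (μ - 1)) *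
      ENNReal.ofReal (h x)) + ENNReal.ofReal (A * (μ - 1)) * Mg := by
    have e : ENNReal.ofReal (A * (μ - 1)) * Mg = ENNReal.ofReal (A * (μ - 1) * (τ ^ P)⁻¹) *
        ∫⁻ x in supp h, ENNReal.ofReal (|x| ^ P) * ENNReal.ofReal (h x) := by
      rw [hM, ← mul_assoc, ← ENNReal.ofReal_mul (by positivity), inv_mul_cancel_right₀ hτP.ne']
    have hmeas : Measurable fun x => ENNReal.ofReal (A * (μ - 1) * (τ ^ P)⁻¹) *
        (ENNReal.ofReal (|x| ^ P) * ENNReal.ofReal (h x)) :=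
      (((measurable_id.abs).pow_const P).ennreal_ofReal.mul
        H.measurable.ennreal_ofReal).const_mul _
    rw [e, ← lintegral_const_mul' _ _ ENNReal.ofReal_ne_top, ← lintegral_add_right _ hmeas,
      ← mul_one (ENNReal.ofReal A), ← H.lintegral_supp,
      ← lintegral_const_mul' _ _ ENNReal.ofReal_ne_top]
    refine setLIntegral_mono' H.isOpen.measurableSet fun x hx => ?_
    have hx0 : 0 < |x| := abs_pos.2 (by
      rcases hS with hS | hS
      · exact ne_of_lt (hS hx)
      · exact ne_of_gt (hS hx))
    have hxτ : 0 < |x| / τ := div_pos hx0 hτ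
    have hxP : 0 ≤ |x| ^ P := Real.rpow_nonneg hx0.le _
    rw [← mul_assoc, ← add_mul,
      ← ENNReal.ofReal_mul (p := A * (μ - 1) * (τ ^ P)⁻¹) (by positivity)]
    refine mul_le_mul_left ?_ _
    rw [← ENNReal.ofReal_add (Real.rpow_nonneg (K.nonneg _) _) (by positivity)]
    refine ENNReal.ofReal_le_ofReal ?_
    have hbase : A * (1 - (μ - 1) * (|x| / τ) ^ P) ≤ g (|x| / τ) ^ (μ - 1) := by
      by_cases hmem : |x| / τ ∈ supp g
      · exact (hg _ hmem).ge
      · exact (mul_nonpos_of_nonneg_of_nonpos hA.le (hg' _ hxτ hmem)).trans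
          (Real.rpow_nonneg (K.nonneg _) _)
    rw [Real.div_rpow hx0.le hτ.le] at hbase
    have : A = A * (1 - (μ - 1) * (|x| ^ P / τ ^ P)) + A * (μ - 1) * (τ ^ P)⁻¹ * |x| ^ P := by
      field_simp
      ring
    linarith
  rw [← eA] at hle
  have hGw := (ENNReal.add_le_add_iff_right
    (ENNReal.mul_ne_top ENNReal.ofReal_ne_top hMg)).1 hle
  have hmw : Measurable fun x => g (|x| / τ) := K.measurable.comp
    ((measurable_id.abs).div_const τ)
  have hold := ENNReal.lintegral_mul_norm_pow_le (μ := volume.restrict (supp h))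
    (f := fun x => ENNReal.ofReal (g (|x| / τ) ^ μ)) (g := fun x => ENNReal.ofReal (h x ^ μ))
    ((hmw.pow_const _).ennreal_ofReal).aemeasurable
    ((H.measurable.pow_const _).ennreal_ofReal).aemeasurable h1'.le
    (show 0 ≤ 1 / μ by positivity) (by ring)
  have e2 : ∫⁻ x in supp h, ENNReal.ofReal (g (|x| / τ) ^ (μ - 1)) * ENNReal.ofReal (h x) =
      ∫⁻ x in supp h, (ENNReal.ofReal (g (|x| / τ) ^ μ)) ^ (1 - 1 / μ) *
        (ENNReal.ofReal (h x ^ μ)) ^ (1 / μ) := by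
    refine setLIntegral_congr_fun H.isOpen.measurableSet fun x hx => ?_
    rw [ENNReal.ofReal_rpow_of_nonneg (Real.rpow_nonneg (K.nonneg _) _) h1'.le,
      ENNReal.ofReal_rpow_of_nonneg (Real.rpow_nonneg (H.nonneg _) _) (by positivity),
      ← Real.rpow_mul (K.nonneg _), ← Real.rpow_mul (H.nonneg _), mul_one_div_cancel hμ0.ne',
      Real.rpow_one, show μ * (1 - 1 / μ) = μ - 1 by field_simp]
  rw [← e2] at hold
  set E := ∫⁻ x in supp h, ENNReal.ofReal (h x ^ μ)
  have hfin : G ≤ (ENNReal.ofReal τ * G) ^ (1 - 1 / μ) * E ^ (1 / μ) :=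
    hGw.trans (hold.trans (mul_le_mul_left (ENNReal.rpow_le_rpow
      (lintegral_scaled_rpow_le K hμ0 hτ hS) h1'.le) _))
  have hfin2 : G ^ μ ≤ (ENNReal.ofReal τ * G) ^ (μ - 1) * E := by
    have := ENNReal.rpow_le_rpow hfin hμ0.le
    rwa [ENNReal.mul_rpow_of_nonneg _ _ hμ0.le, ← ENNReal.rpow_mul, ← ENNReal.rpow_mul,
      one_div_mul_cancel hμ0.ne', ENNReal.rpow_one,
      show (1 - 1 / μ) * μ = μ - 1 by field_simp] at this
  rw [ENNReal.mul_rpow_of_nonneg _ _ h1.le] at hfin2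
  have hGμ0 := ENNReal_rpow_ne_zero hG0 hGt (μ - 1)
  have hGμt := ENNReal_rpow_ne_top hG0 hGt (μ - 1)
  have hτ0 := (ENNReal.ofReal_pos.2 (Real.rpow_pos_of_pos hτ (μ - 1))).ne'
  have hfin3 : G ≤ ENNReal.ofReal (τ ^ (μ - 1)) * E := by
    refine (ENNReal.mul_le_mul_iff_right hGμ0 hGμt).1 ?_
    calc G ^ (μ - 1) * G = G ^ μ := by
          nth_rw 2 [← ENNReal.rpow_one G]
          rw [← ENNReal.rpow_add _ _ hG0 hGt, sub_add_cancel]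
      _ ≤ _ := hfin2
      _ = _ := by
          rw [ENNReal.ofReal_rpow_of_pos hτ]
          ring
  rw [← neg_sub μ 1, Real.rpow_neg hτ.le, ENNReal.ofReal_inv_of_pos (Real.rpow_pos_of_pos hτ _)]
  rw [mul_comm, ← div_eq_mul_inv]
  refine ENNReal.div_le_of_le_mul ?_
  rwa [mul_comm]

lemma moment_ne_zero {h : ℝ → ℝ} (H : IsIntervalDensity h)
    (hS : supp h ⊆ Iio 0 ∨ supp h ⊆ Ioi 0) (P : ℝ) :
    ∫⁻ x in supp h, ENNReal.ofReal (|x| ^ P) * ENNReal.ofReal (h x) ≠ 0 := by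
  intro h0
  have hm : Measurable fun x => ENNReal.ofReal (|x| ^ P) * ENNReal.ofReal (h x) :=
    ((measurable_id.abs).pow_const _).ennreal_ofReal.mul H.measurable.ennreal_ofReal
  rw [lintegral_eq_zero_iff hm, EventuallyEq, ae_restrict_iff' H.isOpen.measurableSet] at h0
  have : volume (supp h) = 0 := by
    rw [measure_eq_zero_iff_ae_notMem]
    filter_upwards [h0] with x hx hxs
    have hx0 : x ≠ 0 := by
      rcases hS with hS | hS
      · exact ne_of_lt (hS hxs)
      · exact ne_of_gt (hS hxs)
    have h2 : 0 < |x| ^ P := Real.rpow_pos_of_pos (abs_pos.2 hx0) _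
    have := hx hxs
    simp only [Pi.zero_apply, mul_eq_zero, ENNReal.ofReal_eq_zero] at this
    rcases this with h | h
    · exact absurd h2 (not_lt.2 h)
    · exact absurd hxs (not_lt.2 h)
  exact (H.isOpen.measure_pos volume H.supp_nonempty).ne' this

/-- Moment-entropy inequality on a half-line. -/
theorem moment_entropy {h : ℝ → ℝ} (H : IsIntervalDensity h)
    (hS : supp h ⊆ Iio 0 ∨ supp h ⊆ Ioi 0) {p μ : ℝ} (hP : 0 < pstar p) (hμ : μ ≠ 1)
    (hμP : 1 < μ * (1 + pstar p))
    (hMt : ∫⁻ x in supp h, ENNReal.ofReal (|x| ^ pstar p) * ENNReal.ofReal (h x) ≠ ∞) :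
    (∫⁻ x in supp h, ENNReal.ofReal (h x ^ μ)) ^ (1 / (1 - μ)) ≤
      ((∫⁻ x in supp h, ENNReal.ofReal (|x| ^ pstar p) * ENNReal.ofReal (h x)) /
        ∫⁻ x in supp (halfGauss p μ), ENNReal.ofReal (|x| ^ pstar p) *
          ENNReal.ofReal (halfGauss p μ x)) ^ (1 / pstar p) *
      (∫⁻ x in supp (halfGauss p μ), ENNReal.ofReal (halfGauss p μ x ^ μ)) ^ (1 / (1 - μ)) := by
  have K := isIntervalDensity_halfGauss hP hμ hμP
  obtain ⟨A, hA, hAeq⟩ := halfGauss_rpow_sub_one hP hμ hμP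
  have hMg0 := gauss_moment_ne_zero hP hμ hμP
  have hMgt := gauss_moment_ne_top hP hμ hμP
  rw [← halfGauss_moment_eq hP hμ hμP] at hMg0 hMgt
  have hμ0 := one_lt_mul_pos hP hμP
  have hM0 := moment_ne_zero H hS (pstar p)
  have hGt := halfGauss_rpow_ne_top hP hμ hμP
  set M := ∫⁻ x in supp h, ENNReal.ofReal (|x| ^ pstar p) * ENNReal.ofReal (h x) with hMdef
  set Mg := ∫⁻ x in supp (halfGauss p μ), ENNReal.ofReal (|x| ^ pstar p) *
          ENNReal.ofReal (halfGauss p μ x) with hMgdef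
  -- The scale at which the dilated Gaussian has the same moment as `h`.
  set τ := (M / Mg).toReal ^ (1 / pstar p) with hτdef
  have hq0 : M / Mg ≠ 0 := (ENNReal.div_pos hM0 hMgt).ne'
  have hqt : M / Mg ≠ ∞ := ENNReal.div_ne_top hMt hMg0
  have hτ : 0 < τ := Real.rpow_pos_of_pos (ENNReal.toReal_pos hq0 hqt) _
  have hτe : ENNReal.ofReal τ = (M / Mg) ^ (1 / pstar p) := by
    rw [hτdef, ← ENNReal.ofReal_rpow_of_pos (ENNReal.toReal_pos hq0 hqt), ENNReal.ofReal_toReal hqt]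
  have hτP : ENNReal.ofReal (τ ^ pstar p) = M / Mg := by
    rw [← ENNReal.ofReal_rpow_of_pos hτ, hτe, ← ENNReal.rpow_mul, one_div_mul_cancel hP.ne',
      ENNReal.rpow_one]
  have hM : M = ENNReal.ofReal (τ ^ pstar p) * Mg := by
    rw [hτP, ENNReal.div_mul_cancel hMg0 hMgt]
  have h1μ : 1 - μ ≠ 0 := fun h => hμ (by linarith)
  have hpow : (ENNReal.ofReal (τ ^ (1 - μ)) *
      ∫⁻ x in supp (halfGauss p μ), ENNReal.ofReal (halfGauss p μ x ^ μ)) ^ (1 / (1 - μ)) =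
      (M / Mg) ^ (1 / pstar p) *
      (∫⁻ x in supp (halfGauss p μ), ENNReal.ofReal (halfGauss p μ x ^ μ)) ^ (1 / (1 - μ)) := by
    rw [ENNReal.mul_rpow_of_ne_top ENNReal.ofReal_ne_top hGt, ← ENNReal.ofReal_rpow_of_pos hτ,
      ← ENNReal.rpow_mul, mul_one_div_cancel h1μ, ENNReal.rpow_one, hτe]
  rw [← hpow]
  rcases lt_or_gt_of_ne hμ with h1 | h1
  · refine ENNReal.rpow_le_rpow (lintegral_rpow_le_scaled_of_lt_one H K hμ0 h1 hA hτ ?_ hAeq hS hM)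
      (one_div_nonneg.2 (by linarith))
    ext x
    refine ⟨fun hx => ?_, fun hx => ?_⟩
    · rw [supp_halfGauss] at hx
      exact hx.2
    · rw [mem_supp_halfGauss hP hμ hμP hx]
      have : 0 < x ^ pstar p := Real.rpow_pos_of_pos hx _
      nlinarith
  · refine ENNReal_rpow_le_rpow_of_nonpos (one_div_nonpos.2 (by linarith))
      (scaled_le_lintegral_rpow_of_one_lt H K h1 hA hτ ?_ hAeq ?_ hS hM hMgt hGt)
    · rw [supp_halfGauss]
      exact inter_subset_right
    · intro x hx hxs
      rw [mem_supp_halfGauss hP hμ hμP hx] at hxs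
      exact not_lt.1 hxs

/-! ### The up transform of a half-line Gaussian -/

section Up

variable {p μ lam : ℝ}

/-- By `hlam` the weight is a multiple of `v^(P-1)` with `P = pstar p`. Near 0 the Gaussian is
bounded and `P > 0`; beyond 1 the finite moment of order `P` dominates. Without integrability
`upMap` could be the default value 0. -/
lemma integrable_up_weight (hP : 0 < pstar p) (hμ : μ ≠ 1) (hμP : 1 < μ * (1 + pstar p))
    (hlam : 1 / -lam = pstar p - 1) :
    Integrable fun v => |-lam * v| ^ (1 / -lam) * halfGauss p μ v := by
  have K := isIntervalDensity_halfGauss hP hμ hμP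
  have hZ := integral_profile_pos hP hμ hμP
  have hmeas : Measurable fun v => |-lam * v| ^ (1 / -lam) * halfGauss p μ v :=
    (((measurable_id.const_mul (-lam)).abs).pow_const _).mul K.measurable
  have hnn : ∀ v, 0 ≤ |-lam * v| ^ (1 / -lam) * halfGauss p μ v := fun v =>
    mul_nonneg (Real.rpow_nonneg (abs_nonneg _) _) (K.nonneg v)
  have hsupp : ∀ v, v ∉ Ioi (0 : ℝ) → |-lam * v| ^ (1 / -lam) * halfGauss p μ v = 0 := fun v hv => by
    rw [halfGauss, if_neg (show ¬ 0 < v from hv), mul_zero]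
  have hbd : ∀ v, halfGauss p μ v ≤ 2 / ∫ y, profile (pstar p) μ y := fun v => by
    rw [halfGauss]
    split_ifs
    · rw [gauss_eq, mul_div_assoc']
      refine div_le_div_of_nonneg_right ?_ hZ.le
      linarith [profile_le_one (P := pstar p) hμ v]
    · positivity
  have hpow : ∀ v : ℝ, 0 < v → |-lam * v| ^ (1 / -lam) = |lam| ^ (1 / -lam) * v ^ (pstar p - 1) := by
    intro v hv
    rw [abs_mul, abs_neg, abs_of_pos hv, Real.mul_rpow (abs_nonneg _) hv.le, hlam]
  have hc : 0 ≤ |lam| ^ (1 / -lam) := Real.rpow_nonneg (abs_nonneg _) _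
  have h01 : IntegrableOn (fun v => |-lam * v| ^ (1 / -lam) * halfGauss p μ v) (Ioc 0 1) := by
    have hi : IntegrableOn (fun v : ℝ => (|lam| ^ (1 / -lam) * (2 / ∫ y, profile (pstar p) μ y)) *
        v ^ (pstar p - 1)) (Ioc 0 1) := by
      have := intervalIntegral.intervalIntegrable_rpow' (a := 0) (b := 1)
        (show -1 < pstar p - 1 by linarith)
      exact ((intervalIntegrable_iff_integrableOn_Ioc_of_le zero_le_one).1 this).const_mul _
    refine hi.mono' hmeas.aestronglyMeasurable ((ae_restrict_iff' measurableSet_Ioc).2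
      (ae_of_all _ fun v hv => ?_))
    rw [Real.norm_of_nonneg (hnn v), hpow v hv.1, mul_right_comm]
    refine mul_le_mul_of_nonneg_right (mul_le_mul_of_nonneg_left (hbd v) hc)
      (Real.rpow_nonneg hv.1.le _)
  have h1 : IntegrableOn (fun v => |-lam * v| ^ (1 / -lam) * halfGauss p μ v) (Ioi 1) := by
    have hi : Integrable fun v : ℝ => |lam| ^ (1 / -lam) *
        (|v| ^ pstar p * halfGauss p μ v) := by
      have hmm : Measurable fun v : ℝ => |v| ^ pstar p * halfGauss p μ v :=
        (measurable_id.abs.pow_const _).mul K.measurable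
      refine Integrable.const_mul ⟨hmm.aestronglyMeasurable, ?_⟩ _
      rw [hasFiniteIntegral_iff_ofReal (ae_of_all _ fun v =>
        mul_nonneg (Real.rpow_nonneg (abs_nonneg _) _) (K.nonneg v))]
      refine lt_of_le_of_lt (le_of_eq ?_) (gauss_moment_ne_top hP hμ hμP).lt_top
      rw [← halfGauss_moment_eq hP hμ hμP]
      trans ∫⁻ v in supp (halfGauss p μ), ENNReal.ofReal (|v| ^ pstar p * halfGauss p μ v)
      · refine (setLIntegral_eq_of_support_subset fun v hv => ?_).symm
        by_contra hv'
        simp [K.eq_zero hv'] at hv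
      · exact lintegral_congr fun v => ENNReal.ofReal_mul (Real.rpow_nonneg (abs_nonneg _) _)
    refine hi.integrableOn.mono' hmeas.aestronglyMeasurable ((ae_restrict_iff' measurableSet_Ioi).2
      (ae_of_all _ fun v (hv : 1 < v) => ?_))
    have hv0 : 0 < v := by linarith
    rw [Real.norm_of_nonneg (hnn v), hpow v hv0, mul_assoc, abs_of_pos hv0]
    refine mul_le_mul_of_nonneg_left (mul_le_mul_of_nonneg_right ?_ (K.nonneg v)) hc
    exact Real.rpow_le_rpow_of_exponent_le hv.le (by linarith)
  have h2 := h01.union h1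
  rw [Ioc_union_Ioi_eq_Ioi zero_le_one] at h2
  exact (integrableOn_iff_integrable_of_support_subset fun v hv => by
    by_contra hv'
    exact hv (hsupp v hv')).1 h2

lemma upMap_eq (hP : 0 < pstar p) (hμ : μ ≠ 1) (hμP : 1 < μ * (1 + pstar p)) (hlam0 : lam ≠ 0)
    (x : ℝ) : upMap (2 - lam) (halfGauss p μ) x =
      ∫ v in Ioi x, |-lam * v| ^ (1 / -lam) * halfGauss p μ v := by
  have K := isIntervalDensity_halfGauss hP hμ hμP
  rw [upMap]
  simp only [if_neg (show (2 : ℝ) - lam ≠ 2 from fun h => hlam0 (by linarith)),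
    show (2 : ℝ) - lam - 2 = -lam by ring]
  refine (setIntegral_eq_of_subset_of_forall_sdiff_eq_zero measurableSet_Ioi inter_subset_right
    fun v hv => ?_).symm
  rw [K.eq_zero (fun hv' => hv.2 ⟨hv', hv.1⟩), mul_zero]

lemma hasStrictDerivAt_upMap (hP : 0 < pstar p) (hμ : μ ≠ 1) (hμP : 1 < μ * (1 + pstar p))
    (hlam0 : lam ≠ 0) (hlam : 1 / -lam = pstar p - 1) {x : ℝ} (hx : x ∈ supp (halfGauss p μ)) :
    HasStrictDerivAt (upMap (2 - lam) (halfGauss p μ))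
      (-(|-lam * x| ^ (1 / -lam) * halfGauss p μ x)) x := by
  have K := isIntervalDensity_halfGauss hP hμ hμP
  rw [funext (upMap_eq hP hμ hμP hlam0)]
  refine hasStrictDerivAt_integral_Ioi (integrable_up_weight hP hμ hμP hlam) K.isOpen ?_ hx
  refine ContinuousOn.mul (fun y hy => ?_) K.cont
  rw [supp_halfGauss] at hy
  have hne : |-lam * y| ≠ 0 := abs_ne_zero.2 (mul_ne_zero (neg_ne_zero.2 hlam0) (ne_of_gt hy.2))
  have hc : ContinuousAt (fun v => |-lam * v|) y := by fun_prop
  exact (hc.rpow_const (Or.inl hne)).continuousWithinAt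

lemma up_weight_pos (hlam0 : lam ≠ 0) {x : ℝ} (hx : x ∈ supp (halfGauss p μ)) :
    0 < |-lam * x| ^ (1 / -lam) * halfGauss p μ x := by
  have hx0 := hx
  rw [supp_halfGauss] at hx0
  exact mul_pos (Real.rpow_pos_of_pos (abs_pos.2 (mul_ne_zero (neg_ne_zero.2 hlam0)
    (ne_of_gt hx0.2))) _) hx

lemma injOn_upMap (hP : 0 < pstar p) (hμ : μ ≠ 1) (hμP : 1 < μ * (1 + pstar p))
    (hlam0 : lam ≠ 0) (hlam : 1 / -lam = pstar p - 1) :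
    InjOn (upMap (2 - lam) (halfGauss p μ)) (supp (halfGauss p μ)) := by
  have K := isIntervalDensity_halfGauss hP hμ hμP
  refine (strictAntiOn_of_deriv_neg K.ordConnected.convex (fun x hx =>
    (hasStrictDerivAt_upMap hP hμ hμP hlam0 hlam hx).hasDerivAt.continuousAt.continuousWithinAt)
    fun x hx => ?_).injOn
  rw [K.isOpen.interior_eq] at hx
  rw [(hasStrictDerivAt_upMap hP hμ hμP hlam0 hlam hx).hasDerivAt.deriv]
  exact neg_neg_of_pos (up_weight_pos hlam0 hx)

lemma up_of_mem (hlam0 : lam ≠ 0) {g : ℝ → ℝ} {u : ℝ}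
    (hu : u ∈ upMap (2 - lam) g '' supp g) :
    up (2 - lam) g u =
      |-lam * Function.invFunOn (upMap (2 - lam) g) (supp g) u| ^ (1 / lam) := by
  rw [up, if_pos hu, if_neg (show (2 : ℝ) - lam ≠ 2 from fun h => hlam0 (by linarith)),
    show (2 : ℝ) - lam - 2 = -lam by ring, show (2 : ℝ) - (2 - lam) = lam by ring]

lemma up_upMap (hP : 0 < pstar p) (hμ : μ ≠ 1) (hμP : 1 < μ * (1 + pstar p))
    (hlam0 : lam ≠ 0) (hlam : 1 / -lam = pstar p - 1) {x : ℝ} (hx : x ∈ supp (halfGauss p μ)) :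
    up (2 - lam) (halfGauss p μ) (upMap (2 - lam) (halfGauss p μ) x) = |-lam * x| ^ (1 / lam) := by
  rw [up_of_mem hlam0 (mem_image_of_mem _ hx),
    (injOn_upMap hP hμ hμP hlam0 hlam).leftInvOn_invFunOn hx]

lemma supp_up (hP : 0 < pstar p) (hμ : μ ≠ 1) (hμP : 1 < μ * (1 + pstar p))
    (hlam0 : lam ≠ 0) (hlam : 1 / -lam = pstar p - 1) :
    supp (up (2 - lam) (halfGauss p μ)) =
      upMap (2 - lam) (halfGauss p μ) '' supp (halfGauss p μ) := by
  ext u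
  constructor
  · intro hu
    by_contra h
    have : 0 < up (2 - lam) (halfGauss p μ) u := hu
    rw [up, if_neg h] at this
    exact lt_irrefl _ this
  · rintro ⟨x, hx, rfl⟩
    have hx0 := hx
    rw [supp_halfGauss] at hx0
    rw [supp, mem_ofPred_eq, up_upMap hP hμ hμP hlam0 hlam hx]
    exact Real.rpow_pos_of_pos (abs_pos.2 (mul_ne_zero (neg_ne_zero.2 hlam0) (ne_of_gt hx0.2))) _

lemma lintegral_supp_up (hP : 0 < pstar p) (hμ : μ ≠ 1) (hμP : 1 < μ * (1 + pstar p))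
    (hlam0 : lam ≠ 0) (hlam : 1 / -lam = pstar p - 1) (φ : ℝ → ℝ≥0∞) :
    ∫⁻ u in supp (up (2 - lam) (halfGauss p μ)), φ u = ∫⁻ x in supp (halfGauss p μ),
      ENNReal.ofReal (|-lam * x| ^ (1 / -lam) * halfGauss p μ x) *
        φ (upMap (2 - lam) (halfGauss p μ) x) := by
  have K := isIntervalDensity_halfGauss hP hμ hμP
  rw [supp_up hP hμ hμP hlam0 hlam, lintegral_image_eq_lintegral_abs_deriv_mul
    K.isOpen.measurableSet (fun x hx => (hasStrictDerivAt_upMap hP hμ hμP hlam0 hlam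
      hx).hasDerivAt.hasDerivWithinAt) (injOn_upMap hP hμ hμP hlam0 hlam)]
  refine setLIntegral_congr_fun K.isOpen.measurableSet fun x hx => ?_
  rw [abs_neg, abs_of_pos (up_weight_pos hlam0 hx)]

lemma abs_deriv_up (hP : 0 < pstar p) (hμ : μ ≠ 1) (hμP : 1 < μ * (1 + pstar p))
    (hlam0 : lam ≠ 0) (hlam : 1 / -lam = pstar p - 1) {x : ℝ} (hx : x ∈ supp (halfGauss p μ)) :
    |deriv (up (2 - lam) (halfGauss p μ)) (upMap (2 - lam) (halfGauss p μ) x)| =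
      |-lam * x| ^ (1 / lam - 1) / (|-lam * x| ^ (1 / -lam) * halfGauss p μ x) := by
  have K := isIntervalDensity_halfGauss hP hμ hμP
  have hx0 := hx
  rw [supp_halfGauss] at hx0
  have hx1 : 0 < x := hx0.2
  have hl : 0 < |lam| := abs_pos.2 hlam0
  have hinj := injOn_upMap hP hμ hμP hlam0 hlam
  have hψ := hasDerivAt_invFunOn K.isOpen hinj
    (fun y hy => hasStrictDerivAt_upMap hP hμ hμP hlam0 hlam hy)
    (fun y hy => neg_ne_zero.2 (up_weight_pos hlam0 hy).ne') hx
  have hX : |-lam * x| = |lam| * x := by rw [abs_mul, abs_neg, abs_of_pos hx1]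
  have h1 : HasDerivAt (fun y : ℝ => (|lam| * y) ^ (1 / lam)) _ x :=
    ((hasDerivAt_id x).const_mul |lam|).rpow_const (p := 1 / lam)
      (Or.inl (mul_pos hl hx1).ne')
  have h2 : HasDerivAt (fun y : ℝ => |-lam * y| ^ (1 / lam)) _ x :=
    h1.congr_of_eventuallyEq (by
      filter_upwards [lt_mem_nhds hx1] with y hy
      rw [abs_mul, abs_neg, abs_of_pos hy])
  rw [← hinj.leftInvOn_invFunOn hx] at h2
  have h3 := HasDerivAt.comp (upMap (2 - lam) (halfGauss p μ) x) h2 hψ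
  have h4 := h3.congr_of_eventuallyEq (f₁ := up (2 - lam) (halfGauss p μ)) (by
    filter_upwards [(isOpen_image_of_hasStrictDerivAt K.isOpen
      (fun y hy => hasStrictDerivAt_upMap hP hμ hμP hlam0 hlam hy)
      (fun y hy => neg_ne_zero.2 (up_weight_pos hlam0 hy).ne')).mem_nhds
        (mem_image_of_mem _ hx)] with u hu
    rw [up_of_mem hlam0 hu]
    rfl)
  rw [h4.deriv, hinj.leftInvOn_invFunOn hx]
  simp only [id, mul_one]
  rw [abs_mul, abs_inv, abs_neg, abs_of_pos (up_weight_pos hlam0 hx), abs_mul, abs_mul, abs_abs,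
    hX, abs_of_pos (Real.rpow_pos_of_pos (mul_pos hl hx1) _), abs_div, abs_one,
    mul_one_div_cancel hl.ne', one_mul]
  exact (div_eq_mul_inv _ _).symm

lemma up_weight_mul (hlam0 : lam ≠ 0) {x : ℝ} (hx : x ∈ supp (halfGauss p μ)) :
    |-lam * x| ^ (1 / -lam) * halfGauss p μ x * |-lam * x| ^ (1 / lam) = halfGauss p μ x := by
  have hx0 := hx
  rw [supp_halfGauss] at hx0
  have hX : 0 < |-lam * x| := abs_pos.2 (mul_ne_zero (neg_ne_zero.2 hlam0) (ne_of_gt hx0.2))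
  rw [mul_right_comm, ← Real.rpow_add hX, show 1 / -lam + 1 / lam = 0 by field_simp; ring,
    Real.rpow_zero, one_mul]

/-- The counterpart of `lintegral_down_rpow`: along the change of variable the Fisher factor
`|f^(lam-2) f'|` of the up transform is `1/g`, and `up_weight_mul` identifies the measure with `g
dx`. -/
lemma F_up (hP : 0 < pstar p) (hμ : μ ≠ 1) (hμP : 1 < μ * (1 + pstar p))
    (hlam0 : lam ≠ 0) (hlam : 1 / -lam = pstar p - 1) :
    F (1 - μ) lam (up (2 - lam) (halfGauss p μ)) =
      ∫⁻ x in supp (halfGauss p μ), ENNReal.ofReal (halfGauss p μ x ^ μ) := by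
  have K := isIntervalDensity_halfGauss hP hμ hμP
  rw [F, lintegral_supp_up hP hμ hμP hlam0 hlam]
  refine setLIntegral_congr_fun K.isOpen.measurableSet fun x hx => ?_
  have hx0 := hx
  rw [supp_halfGauss] at hx0
  have hg : 0 < halfGauss p μ x := hx
  have hX : 0 < |-lam * x| := abs_pos.2 (mul_ne_zero (neg_ne_zero.2 hlam0) (ne_of_gt hx0.2))
  have hw := up_weight_pos hlam0 hx
  have e : |(|-lam * x| ^ (1 / lam)) ^ (lam - 2) *
      deriv (up (2 - lam) (halfGauss p μ)) (upMap (2 - lam) (halfGauss p μ) x)| =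
      (halfGauss p μ x)⁻¹ := by
    rw [abs_mul, abs_deriv_up hP hμ hμP hlam0 hlam hx,
      abs_of_pos (Real.rpow_pos_of_pos (Real.rpow_pos_of_pos hX _) _), ← Real.rpow_mul hX.le,
      mul_div_assoc', ← Real.rpow_add hX,
      show 1 / lam * (lam - 2) + (1 / lam - 1) = 1 / -lam by field_simp; ring]
    rw [div_mul_eq_div_div, div_self (Real.rpow_pos_of_pos hX _).ne', one_div]
  rw [up_upMap hP hμ hμP hlam0 hlam hx, e, mul_left_comm, ← ENNReal.ofReal_mul hw.le,
    up_weight_mul hlam0 hx, ENNReal.ofReal_rpow_of_pos (inv_pos.2 hg),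
    ← ENNReal.ofReal_mul (Real.rpow_nonneg (inv_pos.2 hg).le _), Real.inv_rpow hg.le,
    ← Real.rpow_neg hg.le, ← Real.rpow_add_one hg.ne']
  congr 2
  ring

/-- The power `lam` of the up transform is `|lam x|`, and `du = |lam x|^(P-1) g dx` with `P = pstar
p`. -/
lemma lintegral_up_rpow (hP : 0 < pstar p) (hμ : μ ≠ 1) (hμP : 1 < μ * (1 + pstar p))
    (hlam0 : lam ≠ 0) (hlam : 1 / -lam = pstar p - 1) :
    ∫⁻ u in supp (up (2 - lam) (halfGauss p μ)),
        ENNReal.ofReal (up (2 - lam) (halfGauss p μ) u ^ lam) =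
      ENNReal.ofReal (|lam| ^ pstar p) * ∫⁻ x in supp (halfGauss p μ),
        ENNReal.ofReal (|x| ^ pstar p) * ENNReal.ofReal (halfGauss p μ x) := by
  have K := isIntervalDensity_halfGauss hP hμ hμP
  rw [lintegral_supp_up hP hμ hμP hlam0 hlam, ← lintegral_const_mul' _ _ ENNReal.ofReal_ne_top]
  refine setLIntegral_congr_fun K.isOpen.measurableSet fun x hx => ?_
  have hx0 := hx
  rw [supp_halfGauss] at hx0
  have hX : 0 < |-lam * x| := abs_pos.2 (mul_ne_zero (neg_ne_zero.2 hlam0) (ne_of_gt hx0.2))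
  have hl : 0 ≤ |lam| ^ pstar p := Real.rpow_nonneg (abs_nonneg _) _
  rw [up_upMap hP hμ hμP hlam0 hlam hx, ← ENNReal.ofReal_mul (up_weight_pos hlam0 hx).le,
    ← mul_assoc, ← ENNReal.ofReal_mul hl, ← ENNReal.ofReal_mul (mul_nonneg hl
      (Real.rpow_nonneg (abs_nonneg _) _)), ← Real.mul_rpow (abs_nonneg _) (abs_nonneg _),
    ← Real.rpow_mul hX.le, one_div_mul_cancel hlam0, Real.rpow_one, mul_right_comm,
    ← Real.rpow_add_one hX.ne', hlam, sub_add_cancel, ← abs_mul, neg_mul, abs_neg]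

end Up

/-! ### Ranges of parameters -/

lemma pstar_one_sub (lam : ℝ) : pstar (1 - lam) = (lam - 1) / lam := by
  rw [pstar, show (1 : ℝ) - lam - 1 = -lam by ring, div_neg, ← neg_div, neg_sub]

lemma one_div_neg_eq_pstar {lam : ℝ} (hlam : lam ≠ 0) : 1 / -lam = pstar (1 - lam) - 1 := by
  rw [pstar_one_sub lam]
  field_simp
  ring

/-- Equal signs of `lam - 1` and `lam` mean `lam < 0` or `lam > 1`, which is positivity of the
moment exponent `(lam-1)/lam`. Then `2 lam - 1` has the sign of `lam`, and the remaining sign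
condition is the moment condition for the Gaussian of index `1 - s`. -/
lemma MirroredRange.spec {s lam : ℝ} (h : MirroredRange s lam lam) :
    s < 1 ∧ lam ≠ 0 ∧ lam ≠ 1 ∧ 0 < pstar (1 - lam) ∧ 1 < (1 - s) * (1 + pstar (1 - lam)) := by
  obtain ⟨hs, h1, -, h2, h3⟩ := h
  have hs1 : s - 1 ≠ 0 := by linarith
  rcases lt_trichotomy lam 0 with hl | hl | hl
  · refine ⟨hs, hl.ne, by linarith, ?_, ?_⟩
    · rw [pstar_one_sub lam]
      exact div_pos_of_neg_of_neg (by linarith) hl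
    · rw [sign_neg (show lam + lam - 1 < 0 by linarith), sign_eq_neg_one_iff, pstar] at h1
      rw [pstar_one_sub lam]
      have h4 : (1 - s) * (1 + (lam - 1) / lam) - 1 =
          (s / (s - 1) * lam + lam - 1) * (s - 1) / -lam := by
        field_simp [hl.ne]
        ring
      have h5 : 0 < (s / (s - 1) * lam + lam - 1) * (s - 1) / -lam :=
        div_pos (mul_pos_of_neg_of_neg h1 (by linarith)) (by linarith)
      linarith
  · exact absurd (by rw [hl, sign_zero]) h3
  · rw [sign_pos hl, sign_eq_one_iff] at h2
    refine ⟨hs, hl.ne', by linarith, ?_, ?_⟩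
    · rw [pstar_one_sub lam]
      exact div_pos h2 hl
    · rw [sign_pos (show 0 < lam + lam - 1 by linarith), sign_eq_one_iff, pstar] at h1
      rw [pstar_one_sub lam]
      have h4 : (1 - s) * (1 + (lam - 1) / lam) - 1 =
          (s / (s - 1) * lam + lam - 1) * (1 - s) / lam := by
        field_simp [hl.ne']
        ring
      have h5 : 0 < (s / (s - 1) * lam + lam - 1) * (1 - s) / lam :=
        div_pos (mul_pos h1 (by linarith)) hl
      linarith

/-- For `s = q/p` the second quantity is `1`, so the first sign is positive; for `p > 1` that
difference is exactly `μ (1 + p*) - 1` with `μ = (p-q)/p`. -/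
lemma DownFisherRange.spec {p q : ℝ} (hp : 1 ≤ p) (h : DownFisherRange p q (q / p)) :
    0 < (p - q) / p ∧ (1 < p → 1 < (p - q) / p * (1 + pstar p)) := by
  have hp0 : 0 < p := by linarith
  obtain ⟨h1, -⟩ := h
  rw [show (p - q) / p + q / p = 1 by field_simp; ring, sign_one] at h1
  rcases hp.eq_or_lt with rfl | hp1
  · rw [if_pos rfl, sign_eq_one_iff] at h1
    exact ⟨by simpa using h1, fun h => absurd h (lt_irrefl _)⟩
  · rw [if_neg hp1.ne', sign_eq_one_iff] at h1
    have hp1' : p - 1 ≠ 0 := by linarith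
    have h2 : (p - q) / p * (1 + pstar p) - 1 = (p - q) / (p - 1) - q / p := by
      rw [pstar]
      field_simp
      ring
    have h3 : 1 < (p - q) / p * (1 + pstar p) := by linarith
    exact ⟨one_lt_mul_pos (pstar_pos hp1) h3, fun _ => h3⟩

/-! ### The constants -/

lemma kappa2_pos_lt_top {p q : ℝ} (hp : 1 ≤ p) (hq : q ≠ 0) (h : DownFisherRange p q (q / p)) :
    kappa2 p q ≠ 0 ∧ kappa2 p q ≠ ∞ := by
  obtain ⟨hμ, hμP⟩ := h.spec hp
  have hp0 : 0 < p := by linarith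
  have hμ1 : (p - q) / p ≠ 1 := by
    rw [Ne, div_eq_one_iff_eq hp0.ne']
    exact fun h => hq (by linarith)
  rcases hp.eq_or_lt with rfl | hp1
  · rw [kappa2, stamConst, if_pos rfl]
    exact ⟨(ENNReal.ofReal_pos.2 (Real.rpow_pos_of_pos (by positivity) _)).ne',
      ENNReal.ofReal_ne_top⟩
  · exact stamConst_pos_lt_top hp1 hμ1 (hμP hp1)

/-- Up-transforming gives Gaussian integrals; the exponents follow from `-lam/(1-lam) = 1/pstar (1 -
lam)`. -/
lemma kappa1_eq {s lam : ℝ} (hs0 : s ≠ 0) (h : MirroredRange s lam lam) :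
    kappa1 s lam = (∫⁻ x in supp (halfGauss (1 - lam) (1 - s)),
        ENNReal.ofReal (halfGauss (1 - lam) (1 - s) x ^ (1 - s))) ^ (-(1 / s)) *
      (ENNReal.ofReal (|lam| ^ pstar (1 - lam)) * ∫⁻ x in supp (halfGauss (1 - lam) (1 - s)),
        ENNReal.ofReal (|x| ^ pstar (1 - lam)) *
          ENNReal.ofReal (halfGauss (1 - lam) (1 - s) x)) ^ (1 / pstar (1 - lam)) := by
  obtain ⟨hs, hl0, hl1, hP, hμP⟩ := h.spec
  have hμ : (1 : ℝ) - s ≠ 1 := fun h => hs0 (by linarith)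
  have hl := one_div_neg_eq_pstar hl0
  have hF := F_up hP hμ hμP hl0 hl
  rw [sub_sub_cancel] at hF
  have hG0 := lintegral_rpow_pos (isIntervalDensity_halfGauss hP hμ hμP) (1 - s)
  have hGt := halfGauss_rpow_ne_top hP hμ hμP
  have hM0 := gauss_moment_ne_zero hP hμ hμP
  have hMt := gauss_moment_ne_top hP hμ hμP
  rw [← halfGauss_moment_eq hP hμ hμP] at hM0 hMt
  have hc0 : ENNReal.ofReal (|lam| ^ pstar (1 - lam)) ≠ 0 :=
    (ENNReal.ofReal_pos.2 (Real.rpow_pos_of_pos (abs_pos.2 hl0) _)).ne'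
  have hl1' : 1 - lam ≠ 0 := fun h => hl1 (by linarith)
  have hl1'' : lam - 1 ≠ 0 := fun h => hl1 (by linarith)
  rw [kappa1, mirroredMin, phi, N_of_ne_one hl1, hF, lintegral_up_rpow hP hμ hμP hl0 hl,
    ENNReal.mul_rpow_of_ne_top (ENNReal_rpow_ne_top hG0 hGt _)
      (ENNReal_rpow_ne_top (mul_ne_zero hc0 hM0) (ENNReal.mul_ne_top ENNReal.ofReal_ne_top hMt) _),
    ← ENNReal.rpow_mul, ← ENNReal.rpow_mul]
  congr 2
  · field_simp
  · rw [pstar_one_sub lam]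
    field_simp
    ring

lemma kappa1_pos_lt_top {s lam : ℝ} (hs0 : s ≠ 0) (h : MirroredRange s lam lam) :
    kappa1 s lam ≠ 0 ∧ kappa1 s lam ≠ ∞ := by
  obtain ⟨hs, hl0, hl1, hP, hμP⟩ := h.spec
  have hμ : (1 : ℝ) - s ≠ 1 := fun h => hs0 (by linarith)
  have hG0 := lintegral_rpow_pos (isIntervalDensity_halfGauss hP hμ hμP) (1 - s)
  have hGt := halfGauss_rpow_ne_top hP hμ hμP
  have hM0 := gauss_moment_ne_zero hP hμ hμP
  have hMt := gauss_moment_ne_top hP hμ hμP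
  rw [← halfGauss_moment_eq hP hμ hμP] at hM0 hMt
  have hc0 : ENNReal.ofReal (|lam| ^ pstar (1 - lam)) ≠ 0 :=
    (ENNReal.ofReal_pos.2 (Real.rpow_pos_of_pos (abs_pos.2 hl0) _)).ne'
  rw [kappa1_eq hs0 h]
  exact ⟨mul_ne_zero (ENNReal_rpow_ne_zero hG0 hGt _) (ENNReal_rpow_ne_zero (mul_ne_zero hc0 hM0)
      (ENNReal.mul_ne_top ENNReal.ofReal_ne_top hMt) _),
    ENNReal.mul_ne_top (ENNReal_rpow_ne_top hG0 hGt _) (ENNReal_rpow_ne_top (mul_ne_zero hc0 hM0)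
      (ENNReal.mul_ne_top ENNReal.ofReal_ne_top hMt) _)⟩

/-! ### The informational inequalities for decreasing densities -/

namespace IsDecreasingDensity

variable {f : ℝ → ℝ} {xi : ℝ} {xf : EReal} {p q lam : ℝ}

lemma isACDensity_down (hf : IsDecreasingDensity f xi xf) (hlam : lam ≠ 0)
    (hac : LocallyAC (down (2 - lam) f)) : IsACDensity (down (2 - lam) f) :=
  ⟨hf.isIntervalDensity_down hlam, hac⟩

lemma F_ne_zero (hf : IsDecreasingDensity f xi xf) (hlam : lam ≠ 0) (s : ℝ) : F s lam f ≠ 0 := by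
  rw [← hf.lintegral_down_rpow hlam s]
  exact lintegral_rpow_pos (hf.isIntervalDensity_down hlam) _

/-- Stam for the transformed density at `μ = 1 - q/p`; the exponents match through `1 - μ = q/p` and
`p μ = p - q`. -/
theorem kappa2_le (hf : IsDecreasingDensity f xi xf) (hp : 1 ≤ p) (hq : q ≠ 0) (hpq : p ≠ q)
    (hlam : lam ≠ 0) (hC : DownFisherRange p q (q / p)) (hac : LocallyAC (down (2 - lam) f))
    (hF : F (q / p) lam f ≠ ∞) :
    kappa2 p q ≤ F (q / p) lam f ^ (1 / (q / p)) *
      downFisher p q ((2 - lam) * (p - q) / p) f ^ (1 / (p - q)) := by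
  obtain ⟨hμ, hμP⟩ := hC.spec hp
  have hp0 : 0 < p := by linarith
  have hsμ : 1 - q / p = (p - q) / p := by field_simp
  have hμ1 : (p - q) / p ≠ 1 := by
    rw [Ne, div_eq_one_iff_eq hp0.ne']
    exact fun h => hq (by linarith)
  have H := hf.isACDensity_down hlam hac
  have hE := hf.lintegral_down_rpow hlam (q / p)
  rw [hsμ] at hE
  have key : stamConst p ((p - q) / p) ≤
      phi p ((p - q) / p) (down (2 - lam) f) * N ((p - q) / p) (down (2 - lam) f) := by
    rcases hp.eq_or_lt with rfl | hp1
    · exact stam_one H hμ hμ1 (by rwa [hE])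
    · exact stam_of_one_lt H hp1 hμ1 (hμP hp1) (by rwa [hE])
  rw [phi, N_of_ne_one hμ1, hE, ← hf.downFisher_eq hlam hp hpq hac, mul_div_cancel₀ _ hp0.ne',
    ← hsμ, sub_sub_cancel, mul_comm, hsμ] at key
  exact key

lemma lintegral_rpow_eq_moment (hf : IsDecreasingDensity f xi xf) (hlam : lam ≠ 0) :
    ∫⁻ x in supp f, ENNReal.ofReal (f x ^ lam) = ENNReal.ofReal (|lam| ^ pstar (1 - lam)) *
      ∫⁻ t in supp (down (2 - lam) f), ENNReal.ofReal (|t| ^ pstar (1 - lam)) *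
        ENNReal.ofReal (down (2 - lam) f t) := by
  rw [← hf.lintegral_moment_down hlam, ← lintegral_const_mul' _ _ ENNReal.ofReal_ne_top]
  refine lintegral_congr fun t => ?_
  have hl : 0 ≤ |lam| ^ pstar (1 - lam) := Real.rpow_nonneg (abs_nonneg _) _
  rw [← mul_assoc, ← ENNReal.ofReal_mul hl, ← Real.mul_rpow (abs_nonneg _) (abs_nonneg _),
    ← abs_mul, pstar_one_sub lam]

lemma lintegral_rpow_ne_zero (hf : IsDecreasingDensity f xi xf) (hlam : lam ≠ 0) :
    ∫⁻ x in supp f, ENNReal.ofReal (f x ^ lam) ≠ 0 := by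
  rw [hf.lintegral_rpow_eq_moment hlam]
  exact mul_ne_zero (ENNReal.ofReal_pos.2 (Real.rpow_pos_of_pos (abs_pos.2 hlam) _)).ne'
    (moment_ne_zero (hf.isIntervalDensity_down hlam) (hf.supp_down_subset hlam) _)

lemma N_rpow (hlam0 : lam ≠ 0) (hlam1 : lam ≠ 1) (f : ℝ → ℝ) :
    N lam f ^ lam = (∫⁻ x in supp f, ENNReal.ofReal (f x ^ lam)) ^ (-(1 / pstar (1 - lam))) := by
  have h1 : 1 - lam ≠ 0 := fun h => hlam1 (by linarith)
  have h2 : lam - 1 ≠ 0 := fun h => hlam1 (by linarith)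
  rw [N_of_ne_one hlam1, ← ENNReal.rpow_mul, pstar_one_sub lam]
  congr 1
  field_simp
  ring

/-- This is `moment_entropy` for the transformed density, solved for the moment; the factor
`|lam|^pstar (1 - lam)` occurs on both sides and cancels. -/
theorem kappa1_le {s : ℝ} (hf : IsDecreasingDensity f xi xf) (hs0 : s ≠ 0)
    (hM : MirroredRange s lam lam) (hF : F s lam f ≠ ∞) :
    kappa1 s lam ≤ F s lam f ^ (-(1 / s)) * N lam f ^ (-lam) := by
  obtain ⟨hs, hl0, hl1, hP, hμP⟩ := hM.spec
  have hμ : (1 : ℝ) - s ≠ 1 := fun h => hs0 (by linarith)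
  have hF0 := hf.F_ne_zero hl0 s
  rw [kappa1_eq hs0 hM, ENNReal.rpow_neg (N lam f), N_rpow hl0 hl1, ENNReal.rpow_neg _ (1 / pstar _),
    inv_inv, hf.lintegral_rpow_eq_moment hl0]
  have hG0 := lintegral_rpow_pos (isIntervalDensity_halfGauss hP hμ hμP) (1 - s)
  have hGt := halfGauss_rpow_ne_top hP hμ hμP
  have hM0 := gauss_moment_ne_zero hP hμ hμP
  have hMt := gauss_moment_ne_top hP hμ hμP
  rw [← halfGauss_moment_eq hP hμ hμP] at hM0 hMt
  have key := moment_entropy (hf.isIntervalDensity_down hl0) (hf.supp_down_subset hl0) hP hμ hμP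
  rw [hf.lintegral_down_rpow hl0 s, sub_sub_cancel] at key
  set M := ∫⁻ t in supp (down (2 - lam) f), ENNReal.ofReal (|t| ^ pstar (1 - lam)) *
        ENNReal.ofReal (down (2 - lam) f t)
  set Mg := ∫⁻ x in supp (halfGauss (1 - lam) (1 - s)), ENNReal.ofReal (|x| ^ pstar (1 - lam)) *
          ENNReal.ofReal (halfGauss (1 - lam) (1 - s) x)
  set G := ∫⁻ x in supp (halfGauss (1 - lam) (1 - s)),
        ENNReal.ofReal (halfGauss (1 - lam) (1 - s) x ^ (1 - s))
  have hPi : 0 < 1 / pstar (1 - lam) := one_div_pos.2 hP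
  have hc0 : ENNReal.ofReal (|lam| ^ pstar (1 - lam)) ≠ 0 :=
    (ENNReal.ofReal_pos.2 (Real.rpow_pos_of_pos (abs_pos.2 hl0) _)).ne'
  -- An infinite moment makes the right side infinite, as `F_{s,lam}[f]` is neither 0 nor infinite.
  by_cases hMtop : M = ∞
  · rw [hMtop, ENNReal.mul_top hc0, ENNReal.top_rpow_of_pos hPi,
      ENNReal.mul_top (ENNReal_rpow_ne_zero hF0 hF _)]
    exact le_top
  have key := key hMtop
  rw [ENNReal.mul_rpow_of_nonneg _ _ hPi.le, ENNReal.mul_rpow_of_nonneg _ _ hPi.le,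
    mul_left_comm, mul_left_comm (F s lam f ^ _)]
  refine mul_le_mul_right ?_ _
  rw [ENNReal.div_rpow_of_nonneg _ _ hPi.le] at key
  have a0 := ENNReal_rpow_ne_zero hF0 hF (1 / s)
  have at' := ENNReal_rpow_ne_top hF0 hF (1 / s)
  have b0 := ENNReal_rpow_ne_zero hG0 hGt (1 / s)
  have bt := ENNReal_rpow_ne_top hG0 hGt (1 / s)
  have c0 := ENNReal_rpow_ne_zero hM0 hMt (1 / pstar (1 - lam))
  have ct := ENNReal_rpow_ne_top hM0 hMt (1 / pstar (1 - lam))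
  rw [ENNReal.rpow_neg, ENNReal.rpow_neg]
  rw [mul_comm, ← div_eq_mul_inv, mul_comm, ← div_eq_mul_inv,
    ENNReal.le_div_iff_mul_le (Or.inl a0) (Or.inl at')]
  calc Mg ^ (1 / pstar (1 - lam)) / G ^ (1 / s) * F s lam f ^ (1 / s)
      ≤ Mg ^ (1 / pstar (1 - lam)) / G ^ (1 / s) *
        (M ^ (1 / pstar (1 - lam)) / Mg ^ (1 / pstar (1 - lam)) * G ^ (1 / s)) :=
        mul_le_mul_right key _
    _ = (Mg ^ (1 / pstar (1 - lam)) * (Mg ^ (1 / pstar (1 - lam)))⁻¹) *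
        (G ^ (1 / s) * (G ^ (1 / s))⁻¹) * M ^ (1 / pstar (1 - lam)) := by
        generalize Mg ^ (1 / pstar (1 - lam)) = a, G ^ (1 / s) = b,
          M ^ (1 / pstar (1 - lam)) = c
        simp only [div_eq_mul_inv]
        ring
    _ = _ := by
        rw [ENNReal.mul_inv_cancel c0 ct, ENNReal.mul_inv_cancel b0 bt, one_mul, one_mul]

theorem kappa1_mul_kappa2_le (hf : IsDecreasingDensity f xi xf) (hp : 1 ≤ p) (hq : q ≠ 0)
    (hpq : p ≠ q) (hC : DownFisherRange p q (q / p)) (hM : MirroredRange (q / p) lam lam)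
    (hac : LocallyAC (down (2 - lam) f)) :
    kappa1 (q / p) lam * kappa2 p q ≤
      downFisher p q ((2 - lam) * (p - q) / p) f ^ (1 / (p - q)) / N lam f ^ lam := by
  obtain ⟨hs, hl0, hl1, hP, hμP⟩ := hM.spec
  obtain ⟨hμ0, -⟩ := hC.spec hp
  have hp0 : 0 < p := by linarith
  have hs0 : q / p ≠ 0 := div_ne_zero hq hp0.ne'
  have hsμ : 1 - q / p = (p - q) / p := by field_simp
  have hμ : 1 - q / p ≠ 1 := fun h => hs0 (by linarith)
  have hpq0 : 0 < p - q := by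
    have := mul_pos hμ0 hp0
    rwa [div_mul_cancel₀ _ hp0.ne'] at this
  have hF0 := hf.F_ne_zero hl0 (q / p)
  have H := hf.isACDensity_down hl0 hac
  by_cases hF : F (q / p) lam f = ∞
  · suffices h : downFisher p q ((2 - lam) * (p - q) / p) f ^ (1 / (p - q)) / N lam f ^ lam = ∞ by
      rw [h]
      exact le_top
    have hE := hf.lintegral_down_rpow hl0 (q / p)
    rw [N_rpow hl0 hl1, hf.downFisher_eq hl0 hp hpq hac]
    rcases lt_or_gt_of_ne hμ with h1 | h1
    -- For `s > 0` infinite `F_{s,lam}[f]` forces an infinite moment, so the denominator `N^lam` is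
    -- 0 while the numerator is not.
    · have hq0 : 0 < q / p := by linarith
      have hMtop : ∫⁻ t in supp (down (2 - lam) f), ENNReal.ofReal (|t| ^ pstar (1 - lam)) *
          ENNReal.ofReal (down (2 - lam) f t) = ∞ := by
        by_contra hMt
        have key := moment_entropy (hf.isIntervalDensity_down hl0) (hf.supp_down_subset hl0) hP hμ
          hμP hMt
        rw [hE, hF, sub_sub_cancel, ENNReal.top_rpow_of_pos (one_div_pos.2 hq0), top_le_iff] at key
        have hMg0 := gauss_moment_ne_zero hP hμ hμP
        rw [← halfGauss_moment_eq hP hμ hμP] at hMg0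
        exact ENNReal.mul_ne_top (ENNReal.rpow_ne_top_of_nonneg (one_div_pos.2 hP).le
          (ENNReal.div_ne_top hMt hMg0)) (ENNReal.rpow_ne_top_of_nonneg (one_div_pos.2 hq0).le
            (halfGauss_rpow_ne_top hP hμ hμP)) key
      have hc0 : ENNReal.ofReal (|lam| ^ pstar (1 - lam)) ≠ 0 :=
        (ENNReal.ofReal_pos.2 (Real.rpow_pos_of_pos (abs_pos.2 hl0) _)).ne'
      rw [hf.lintegral_rpow_eq_moment hl0, hMtop, ENNReal.mul_top hc0,
        ENNReal.top_rpow_of_neg (neg_neg_of_pos (one_div_pos.2 hP)), ENNReal.div_zero]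
      intro h0
      rw [ENNReal.rpow_eq_zero_iff] at h0
      rcases h0 with ⟨h0, -⟩ | ⟨-, h0⟩
      · exact H.F_ne_zero hμ0 hp h0
      · exact absurd (one_div_pos.2 hpq0) (not_lt.2 h0.le)
    -- For `s < 0` finite down-Fisher measure would bound the transformed density, and its power `1
    -- - s > 1` would be integrable. So the numerator is infinite, and the denominator is finite.
    · have hDF : F p ((p - q) / p) (down (2 - lam) f) = ∞ := by
        by_contra hDF
        have hbd := lintegral_rpow_le_of_bound H.toIsIntervalDensity h1
          fun x hx => H.le_of_F_ne_top hp hμ0 hDF hx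
        rw [hE, hF, top_le_iff] at hbd
        exact ENNReal.ofReal_ne_top hbd
      rw [hDF, ENNReal.top_rpow_of_pos (one_div_pos.2 hpq0)]
      refine ENNReal.top_div_of_ne_top fun h => ?_
      rw [ENNReal.rpow_eq_top_iff] at h
      rcases h with ⟨h, -⟩ | ⟨-, h⟩
      · exact hf.lintegral_rpow_ne_zero hl0 h
      · exact absurd (one_div_pos.2 hP) (by linarith)
  · calc kappa1 (q / p) lam * kappa2 p q
        ≤ (F (q / p) lam f ^ (-(1 / (q / p))) * N lam f ^ (-lam)) *
          (F (q / p) lam f ^ (1 / (q / p)) *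
            downFisher p q ((2 - lam) * (p - q) / p) f ^ (1 / (p - q))) :=
          mul_le_mul' (hf.kappa1_le hs0 hM hF) (hf.kappa2_le hp hq hpq hl0 hC hac hF)
      _ = (F (q / p) lam f ^ (-(1 / (q / p))) * F (q / p) lam f ^ (1 / (q / p))) *
          (downFisher p q ((2 - lam) * (p - q) / p) f ^ (1 / (p - q)) * N lam f ^ (-lam)) := by
          ring
      _ = _ := by
          rw [← ENNReal.rpow_add _ _ hF0 hF, neg_add_cancel, ENNReal.rpow_zero, one_mul,
            ENNReal.rpow_neg]
          exact (div_eq_mul_inv _ _).symm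

end IsDecreasingDensity

/-! ### Solving for the entropy power -/

lemma le_of_le_div_rpow {κ A X : ℝ≥0∞} {lam : ℝ} (hlam : 0 < lam) (h0 : κ ≠ 0) (ht : κ ≠ ∞)
    (h : κ ≤ A / X ^ lam) : X ≤ κ ^ (-(1 / lam)) * A ^ (1 / lam) := by
  have h1 := ENNReal.rpow_le_rpow (ENNReal.mul_le_of_le_div h) (one_div_pos.2 hlam).le
  rw [ENNReal.mul_rpow_of_nonneg _ _ (one_div_pos.2 hlam).le, ← ENNReal.rpow_mul,
    mul_one_div_cancel hlam.ne', ENNReal.rpow_one] at h1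
  calc X = κ ^ (-(1 / lam)) * (κ ^ (1 / lam) * X) := by
        rw [← mul_assoc, ← ENNReal.rpow_add _ _ h0 ht, neg_add_cancel, ENNReal.rpow_zero, one_mul]
    _ ≤ _ := mul_le_mul_right h1 _

/-- The exponent `1 / lam` is now negative and reverses the inequality; it distributes over the
product because `κ` is neither 0 nor infinite. -/
lemma ge_of_le_div_rpow {κ A X : ℝ≥0∞} {lam : ℝ} (hlam : lam < 0) (h0 : κ ≠ 0) (ht : κ ≠ ∞)
    (h : κ ≤ A / X ^ lam) : κ ^ (-(1 / lam)) * A ^ (1 / lam) ≤ X := by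
  have hneg : 1 / lam ≤ 0 := (one_div_neg.2 hlam).le
  have h1 := ENNReal_rpow_le_rpow_of_nonpos hneg (ENNReal.mul_le_of_le_div h)
  have h2 : (κ * X ^ lam) ^ (1 / lam) = κ ^ (1 / lam) * X := by
    rw [ENNReal.mul_rpow_eq_ite, if_neg (by simp [h0, ht]), ← ENNReal.rpow_mul,
      mul_one_div_cancel hlam.ne, ENNReal.rpow_one]
  rw [h2] at h1
  calc _ ≤ κ ^ (-(1 / lam)) * (κ ^ (1 / lam) * X) := mul_le_mul_right h1 _
    _ = X := by
        rw [← mul_assoc, ← ENNReal.rpow_add _ _ h0 ht, neg_add_cancel, ENNReal.rpow_zero, one_mul]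

end DownFisher

theorem mainTheorem11 (p q lam : ℝ) (hp : 1 ≤ p) (hq : q ≠ 0) (hpq : p ≠ q) (hlam : lam ≠ 0)
    (f : ℝ → ℝ) (xi : ℝ) (xf : EReal) (hf : IsDecreasingDensity f xi xf) :
    -- down-Fisher--Fisher inequality with `s = q / p`
    (DownFisherRange p q (q / p) → LocallyAC (down (2 - lam) f) → F (q / p) lam f ≠ ∞ →
      kappa2 p q ≤ F (q / p) lam f ^ (1 / (q / p)) *
        downFisher p q ((2 - lam) * (p - q) / p) f ^ (1 / (p - q))) ∧
    -- mirrored Stam inequality with parameters `(s, lam, lam)`, `s = q / p`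
    (MirroredRange (q / p) lam lam → F (q / p) lam f ≠ ∞ →
      kappa1 (q / p) lam ≤ F (q / p) lam f ^ (-(1 / (q / p))) * N lam f ^ (-lam)) ∧
    -- down-Fisher--entropy inequality and its consequences
    (DownFisherRange p q (q / p) → MirroredRange (q / p) lam lam →
      LocallyAC (down (2 - lam) f) →
      (0 < kappa1 (q / p) lam * kappa2 p q ∧ kappa1 (q / p) lam * kappa2 p q < ∞) ∧
      kappa1 (q / p) lam * kappa2 p q ≤
        downFisher p q ((2 - lam) * (p - q) / p) f ^ (1 / (p - q)) / N lam f ^ lam ∧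
      (0 < lam →
        N lam f ≤ (kappa1 (q / p) lam * kappa2 p q) ^ (-(1 / lam)) *
          downFisher p q ((2 - lam) * (p - q) / p) f ^ (1 / (lam * (p - q))) ∧
        ∀ β : ℝ, β ≠ 0 →
          N lam f * phi p β f ≤ (kappa1 (q / p) lam * kappa2 p q) ^ (-(1 / lam)) *
            downFisher p q ((2 - lam) * (p - q) / p) f ^ (1 / (lam * (p - q))) * phi p β f) ∧
      (lam < 0 →
        (kappa1 (q / p) lam * kappa2 p q) ^ (-(1 / lam)) *
          downFisher p q ((2 - lam) * (p - q) / p) f ^ (1 / (lam * (p - q))) ≤ N lam f ∧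
        ∀ β : ℝ, β ≠ 0 →
          (kappa1 (q / p) lam * kappa2 p q) ^ (-(1 / lam)) *
            downFisher p q ((2 - lam) * (p - q) / p) f ^ (1 / (lam * (p - q))) * phi p β f ≤
              N lam f * phi p β f)) := by
  have hp0 : 0 < p := by linarith
  have hs0 : q / p ≠ 0 := div_ne_zero hq hp0.ne'
  refine ⟨fun hC hac hF => hf.kappa2_le hp hq hpq hlam hC hac hF,
    fun hM hF => hf.kappa1_le hs0 hM hF, fun hC hM hac => ?_⟩
  obtain ⟨h10, h1t⟩ := kappa1_pos_lt_top hs0 hM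
  obtain ⟨h20, h2t⟩ := kappa2_pos_lt_top hp hq hC
  have h0 := mul_ne_zero h10 h20
  have ht := ENNReal.mul_ne_top h1t h2t
  have hmain := hf.kappa1_mul_kappa2_le hp hq hpq hC hM hac
  have hexp : downFisher p q ((2 - lam) * (p - q) / p) f ^ (1 / (lam * (p - q))) =
      (downFisher p q ((2 - lam) * (p - q) / p) f ^ (1 / (p - q))) ^ (1 / lam) := by
    rw [← ENNReal.rpow_mul, one_div_mul_one_div, mul_comm lam (p - q)]
  rw [hexp]
  refine ⟨⟨pos_iff_ne_zero.2 h0, ht.lt_top⟩, hmain, fun hl => ?_, fun hl => ?_⟩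
  · have h := le_of_le_div_rpow hl h0 ht hmain
    exact ⟨h, fun β _ => mul_le_mul_left h _⟩
  · have h := ge_of_le_div_rpow hl h0 ht hmain
    exact ⟨h, fun β _ => mul_le_mul_left h _⟩
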